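/- **Green–Griffiths filtration.** Let $X,Y$ be complex manifolds of dimension $n$ and let $\Delta=\sum_{i}(1-\tfrac1{m_i})\Delta_i$ be an orbifold divisor on $X$: $\sum_i\Delta_i$ is a normal crossing divisor and $m_i=a_i/b_i\in\mathbb Q\cup\{\infty\}$ with integers $a_i\ge b_i\ge0$, $a_i\ge1$. For $j\ge1$ put $\Delta^{(j)}=\sum_i(1-\tfrac j{m_i})^+\Delta_i$, where $x^+=\max\{x,0\}$. Let $\pi\colon Y\to X$ be adapted to $(X,\Delta)$, i.e. every point of $Y$ is the centre of adapted coordinates (as holds for every adapted Galois covering): coordinates $w_1,\dots,w_n$ on $Y$ and $z_1,\dots,z_n$ on $X$ such that $\pi$ is given by $z_l=w_l^{p_l}$ with $p_l\ge1$, every $\Delta_i$ is locally a union of hyperplanes $\{z_l=0\}$, and $p_l$ is a multiple of $a_i$ whenever $\{z_l=0\}\subseteq\Delta_i$. Write $m_l$ also for the multiplicity of $\Delta$ along $\{z_l=0\}$ (equal to $1$ if this hyperplane belongs to no $\Delta_i$). Let $d^{(j)}z_l$ denote the jet coordinate on $J_kX$ that is the $j$-th Taylor coefficient of $z_l$ along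 curves. The sheaf $\Omega_{\pi,\Delta^{(j)}}$ is the sheaf of $\mathcal O_Y$-modules locally generated in adapted coordinates by the meromorphic sections $w_l^{-p_l(1-j/m_l)^+}\pi^*dz_l$ of $\pi^*\Omega_X$. For $k,N\ge0$, the sheaf $E_{k,N}\Omega_{\pi,\Delta}$ of orbifold jet differentials of order $k$ and weighted degree $N$ is the sheaf of $\mathcal O_Y$-modules locally generated in adapted coordinates by the monomials $$\omega^\alpha=\prod_{l=1}^n\prod_{j=1}^k\Bigl(w_l^{-p_l(1-j/m_l)^+}\,\pi^*d^{(j)}z_l\Bigr)^{\alpha_{l,j}},\qquad \|\alpha\|:=\sum_{l,j}j\,\alpha_{l,j}=N .$$ For $1\le q\le k$ put $\|\alpha\|_q=\sum_{j\le q}\sum_l j\,\alpha_{l,j}$, and for $\ell\in(\mathbb Z_{\ge0})^k$ put $\|\ell\|=\sum_j j\,\ell_j$. Then: 1. $E_{k,N}\Omega_{\pi,\Delta}$ is locally free; in any adapted coordinates the monomials $\omega^\alpha$ with $\|\alpha\|=N$ form a frame. 2. For every $q$ and $m\ge 0$, the condition on a section that only monomials with $\|\alpha\|_q\ge m$ occur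 in it does not depend on the adapted coordinates; and likewise, for every $d\in(\mathbb Z_{\ge0})^{k-1}$, for the conditions that only monomials with $(\|\alpha\|_{k-1},\dots,\|\alpha\|_1)\ge d$, respectively $>d$, in the lexicographic order occur. These conditions define subbundles; we write $F^d$ and $F^{>d}$ for the latter two. They form a finite descending filtration of $E_{k,N}\Omega_{\pi,\Delta}$, with $F^0=E_{k,N}\Omega_{\pi,\Delta}$. 3. There is an isomorphism of sheaves of $\mathcal O_Y$-modules $$\mathrm{Gr}_\bullet E_{k,N}\Omega_{\pi,\Delta}=\bigoplus_{d}F^d/F^{>d}\;\cong\;\bigoplus_{\ell\in(\mathbb Z_{\ge0})^k\colon\|\ell\|=N}S^{\ell_1}\Omega_{\pi,\Delta^{(1)}}\otimes S^{\ell_2}\Omega_{\pi,\Delta^{(2)}}\otimes\cdots\otimes S^{\ell_k}\Omega_{\pi,\Delta^{(k)}} .$$ In all adapted coordinates it maps the class of $\omega^\alpha$ (in the piece $d=(\|\alpha\|_{k-1},\dots,\|\alpha\|_1)$) to $\bigotimes_{j=1}^k\prod_{l=1}^n\bigl(w_l^{-p_l(1-j/m_l)^+}\pi^*dz_l\bigr)^{\alpha_{l,j}}$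 (in the piece $\ell_j=\sum_l\alpha_{l,j}$). -/

import Mathlib

open scoped Manifold ContDiff TensorProduct DirectSum
open TopologicalSpace (Opens)

noncomputable section

namespace OrbifoldJets

/-! ## Sheaves of functions and subsheaves generated by local generators -/

/-- The ring `𝒪_Y(U)` of holomorphic functions on an open subset `U` of a complex manifold `Y` of
dimension `n`. -/
abbrev Hol (n : ℕ) {Y : Type*} [TopologicalSpace Y] [ChartedSpace (Fin n → ℂ) Y] (U : Opens Y) :=
  C^ω⟮𝓘(ℂ, Fin n → ℂ), U; 𝓘(ℂ), ℂ⟯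

/-- Complex valued functions on the part of a family `pr : T → Y` that lies over `U`. -/
def LocFun {T Y : Type*} [TopologicalSpace Y] (pr : T → Y) (U : Opens Y) :=
  {t : T // pr t ∈ U} → ℂ

section LocFun

variable {n : ℕ} {T Y : Type*} [TopologicalSpace Y] [ChartedSpace (Fin n → ℂ) Y] (pr : T → Y)

instance (U : Opens Y) : AddCommGroup (LocFun pr U) :=
  inferInstanceAs (AddCommGroup ({t : T // pr t ∈ U} → ℂ))

/-- `f • s` is the function `t ↦ f (pr t) * s t`. -/
instance (U : Opens Y) : Module (Hol n U) (LocFun pr U) where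
  smul f s := fun t => f ⟨pr t.1, t.2⟩ * s t
  one_smul s := funext fun t => one_mul (s t)
  mul_smul f g s := funext fun t => mul_assoc (f ⟨pr t.1, t.2⟩) (g ⟨pr t.1, t.2⟩) (s t)
  smul_zero f := funext fun t => mul_zero (f ⟨pr t.1, t.2⟩)
  smul_add f s s' := funext fun t => mul_add (f ⟨pr t.1, t.2⟩) (s t) (s' t)
  add_smul f g s := funext fun t => add_mul (f ⟨pr t.1, t.2⟩) (g ⟨pr t.1, t.2⟩) (s t)
  zero_smul s := funext fun t => zero_mul (s t)

variable {pr}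

/-- Restriction of functions to the part over a smaller open set. -/
def LocFun.res {U V : Opens Y} (h : V ≤ U) (s : LocFun pr U) : LocFun pr V :=
  fun t => s ⟨t.1, h t.2⟩

variable (pr) in
/-- The restriction to the part over `U` of a function on the whole family. -/
def LocFun.of (f : T → ℂ) (U : Opens Y) : LocFun pr U := fun t => f t.1

/-- Let `G` be a collection of functions `f` that are considered over given open sets `D` only.
These are the members of `G` that are defined over `V`. -/
def gens (pr : T → Y) (G : Set (Opens Y × (T → ℂ))) (V : Opens Y) : Set (LocFun pr V) :=
  {s | ∃ D f, (D, f) ∈ G ∧ V ≤ D ∧ s = LocFun.of pr f V}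

theorem res_mem_span {G : Set (Opens Y × (T → ℂ))} {V W : Opens Y} (h : W ≤ V)
    {s : LocFun pr V} (hs : s ∈ Submodule.span (Hol n V) (gens pr G V)) :
    LocFun.res h s ∈ Submodule.span (Hol n W) (gens pr G W) := by
  induction hs using Submodule.span_induction with
  | mem s hs =>
    obtain ⟨D, f, hG, hV, rfl⟩ := hs
    exact Submodule.subset_span ⟨D, f, hG, h.trans hV, rfl⟩
  | zero => exact Submodule.zero_mem _
  | add s s' _ _ ih ih' => exact Submodule.add_mem _ ih ih'
  | smul a s _ ih =>
    exact Submodule.smul_mem _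
      (ContMDiffMap.restrictRingHom 𝓘(ℂ, Fin n → ℂ) 𝓘(ℂ) ℂ h a) ih

variable (n) in
/-- The sections over `U` of the sheaf of `𝒪_Y`-modules that is locally generated by `G`: the
functions which near every point are `𝒪_Y`-linear combinations of members of `G`. -/
def generatedSheaf (pr : T → Y) (G : Set (Opens Y × (T → ℂ))) (U : Opens Y) :
    Submodule (Hol n U) (LocFun pr U) where
  carrier := {s | ∀ y ∈ U, ∃ V : Opens Y, y ∈ V ∧ ∃ h : V ≤ U,
    LocFun.res h s ∈ Submodule.span (Hol n V) (gens pr G V)}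
  add_mem' := by
    intro s s' hs hs' y hy
    obtain ⟨V, hyV, h, hV⟩ := hs y hy
    obtain ⟨V', hyV', h', hV'⟩ := hs' y hy
    refine ⟨V ⊓ V', ⟨hyV, hyV'⟩, inf_le_left.trans h, ?_⟩
    exact Submodule.add_mem _ (res_mem_span (inf_le_left : V ⊓ V' ≤ V) hV)
      (res_mem_span (inf_le_right : V ⊓ V' ≤ V') hV')
  zero_mem' := fun y hy => ⟨U, hy, le_rfl, Submodule.zero_mem _⟩
  smul_mem' := by
    intro a s hs y hy
    obtain ⟨V, hyV, h, hV⟩ := hs y hy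
    exact ⟨V, hyV, h, Submodule.smul_mem _
      (ContMDiffMap.restrictRingHom 𝓘(ℂ, Fin n → ℂ) 𝓘(ℂ) ℂ h a) hV⟩

theorem of_mem_generatedSheaf {G : Set (Opens Y × (T → ℂ))} {D U : Opens Y} {f : T → ℂ}
    (hG : (D, f) ∈ G) (h : U ≤ D) : LocFun.of pr f U ∈ generatedSheaf n pr G U :=
  fun _ hy => ⟨U, hy, le_rfl, Submodule.subset_span ⟨D, f, hG, h, rfl⟩⟩

theorem res_mem_generatedSheaf {G : Set (Opens Y × (T → ℂ))} {U V : Opens Y} (h : V ≤ U)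
    {s : LocFun pr U} (hs : s ∈ generatedSheaf n pr G U) :
    LocFun.res h s ∈ generatedSheaf n pr G V := by
  intro y hy
  obtain ⟨W, hyW, hW, hs⟩ := hs y (h hy)
  exact ⟨W ⊓ V, ⟨hyW, hy⟩, inf_le_right, res_mem_span (inf_le_left : W ⊓ V ≤ W) hs⟩

/-- `P` is a sheaf: it is stable under restriction, and membership in `P` is a local condition. -/
def IsSubsheaf (P : ∀ U : Opens Y, Submodule (Hol n U) (LocFun pr U)) : Prop :=
  (∀ (U V : Opens Y) (h : V ≤ U), ∀ s ∈ P U, LocFun.res h s ∈ P V) ∧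
  (∀ (U : Opens Y) (s : LocFun pr U),
    (∀ y ∈ U, ∃ V : Opens Y, y ∈ V ∧ ∃ h : V ≤ U, LocFun.res h s ∈ P V) → s ∈ P U)

end LocFun

/-! ## Symmetric powers -/

section Sym

variable (R : Type*) [CommRing R] (M : Type*) [AddCommGroup M] [Module R M]

/-- The symmetric power `S^ℓ M`: the part of degree `ℓ` of the symmetric algebra of `M`. -/
def SymPow (ℓ : ℕ) : Submodule R (SymmetricAlgebra R M) :=
  LinearMap.range (SymmetricAlgebra.ι R M) ^ ℓ

variable {M}

/-- The symmetric product `s 0 ⋯ s (ℓ - 1)`, an element of `S^ℓ M`. -/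
def symProd {ℓ : ℕ} (s : Fin ℓ → M) : SymPow R M ℓ :=
  ⟨∏ t, SymmetricAlgebra.ι R M (s t), by
    induction ℓ with
    | zero => simp [SymPow]
    | succ ℓ ih =>
      rw [Fin.prod_univ_succ, SymPow, pow_succ']
      exact Submodule.mul_mem_mul ⟨s 0, rfl⟩ (ih fun t => s t.succ)⟩

end Sym

/-! ## Orbifold pairs and adapted coverings -/

section Orbifold

variable {n : ℕ} {ι X Y : Type*}
  [TopologicalSpace X] [ChartedSpace (Fin n → ℂ) X]
  [TopologicalSpace Y] [ChartedSpace (Fin n → ℂ) Y]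

/-- In the coordinates `z`, each member `comp i` of the family is the union of the coordinate
hyperplanes `z_l = 0` with label `i`; unlabelled hyperplanes play no role. -/
def IsLabelling (comp : ι → Set X) (z : OpenPartialHomeomorph X (Fin n → ℂ))
    (label : Fin n → Option ι) : Prop :=
  ∀ i, ∀ x ∈ z.source, x ∈ comp i ↔ ∃ l, label l = some i ∧ z x l = 0

variable (n ι X) in
/-- An orbifold divisor `Δ = ∑ i, (1 - 1 / m i) Δ_i` with normal crossings on a complex manifold `X`
of dimension `n`, where `m i = a i / b i ∈ ℚ ∪ {∞}` is at least `1` (it is `∞` if `b i = 0`). -/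
structure OrbifoldDivisor where
  comp : ι → Set X
  a : ι → ℕ
  b : ι → ℕ
  a_pos : ∀ i, 0 < a i
  b_le_a : ∀ i, b i ≤ a i
  normalCrossings : ∀ x : X, ∃ z ∈ IsManifold.maximalAtlas 𝓘(ℂ, Fin n → ℂ) ω X,
    x ∈ z.source ∧ z x = 0 ∧ ∃ label : Fin n → Option ι, IsLabelling comp z label

/-- The coefficient `1 - 1 / m i = 1 - b i / a i` of `Δ_i` in `Δ`. -/
def OrbifoldDivisor.coeff (Δ : OrbifoldDivisor n ι X) (i : ι) : ℚ := 1 - Δ.b i / Δ.a i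

/-- The divisor `Δ^(j) = ∑ i, max (1 - j / m i) 0 • Δ_i`. -/
def OrbifoldDivisor.trunc (Δ : OrbifoldDivisor n ι X) (j : ℕ) : OrbifoldDivisor n ι X where
  comp := Δ.comp
  a := Δ.a
  b := fun i => min (j * Δ.b i) (Δ.a i)
  a_pos := Δ.a_pos
  b_le_a := fun _ => min_le_right _ _
  normalCrossings := Δ.normalCrossings

theorem OrbifoldDivisor.coeff_trunc (Δ : OrbifoldDivisor n ι X) (j : ℕ) (i : ι) :
    (Δ.trunc j).coeff i = max (1 - j * (Δ.b i / Δ.a i : ℚ)) 0 := by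
  have h : (0 : ℚ) < Δ.a i := by exact_mod_cast Δ.a_pos i
  simp only [coeff, trunc, Nat.cast_min, Nat.cast_mul]
  rw [← mul_div_assoc, ← min_div_div_right h.le, div_self h.ne', ← max_sub_sub_left, sub_self]

/-- Local coordinates `w` on `Y` and `z` on `X` adapted to `π` and `Δ`: `π` has the form
`(w_1, …, w_n) ↦ (w_1 ^ p_1, …, w_n ^ p_n)`, the components of `Δ` are unions of coordinate
hyperplanes `z_l = 0`, and `p_l` is a multiple of `a i` if `z_l = 0` belongs to `Δ_i`. -/
structure AdaptedChart (Δ : OrbifoldDivisor n ι X) (π : Y → X) where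
  w : OpenPartialHomeomorph Y (Fin n → ℂ)
  z : OpenPartialHomeomorph X (Fin n → ℂ)
  w_mem : w ∈ IsManifold.maximalAtlas 𝓘(ℂ, Fin n → ℂ) ω Y
  z_mem : z ∈ IsManifold.maximalAtlas 𝓘(ℂ, Fin n → ℂ) ω X
  mapsTo : Set.MapsTo π w.source z.source
  label : Fin n → Option ι
  isLabelling : IsLabelling Δ.comp z label
  p : Fin n → ℕ
  p_pos : ∀ l, 0 < p l
  a_dvd_p : ∀ l i, label l = some i → Δ.a i ∣ p l
  z_eq : ∀ y ∈ w.source, ∀ l, z (π y) l = w y l ^ p l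

/-- `π : Y → X` is adapted to `(X, Δ)`: centered adapted coordinates exist around every point. -/
def IsAdapted (Δ : OrbifoldDivisor n ι X) (π : Y → X) : Prop :=
  ∀ y : Y, ∃ c : AdaptedChart Δ π, y ∈ c.w.source ∧ c.w y = 0

namespace AdaptedChart

variable {Δ : OrbifoldDivisor n ι X} {π : Y → X}

/-- The domain of the coordinates on `Y`. -/
def domain (c : AdaptedChart Δ π) : Opens Y := ⟨c.w.source, c.w.open_source⟩

/-- Coordinates adapted to `Δ` are adapted to every `Δ^(j)`. -/
def trunc (c : AdaptedChart Δ π) (j : ℕ) : AdaptedChart (Δ.trunc j) π where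
  w := c.w
  z := c.z
  w_mem := c.w_mem
  z_mem := c.z_mem
  mapsTo := c.mapsTo
  label := c.label
  isLabelling := c.isLabelling
  p := c.p
  p_pos := c.p_pos
  a_dvd_p := c.a_dvd_p
  z_eq := c.z_eq

/-- The natural number `p_l (1 - 1 / m_l)`, where `m_l` is the multiplicity of `Δ` along `z_l = 0`
(`1` if this hyperplane is not labelled). -/
def poleOrder (c : AdaptedChart Δ π) (l : Fin n) : ℕ :=
  match c.label l with
  | none => 0
  | some i => c.p l / Δ.a i * (Δ.a i - Δ.b i)

theorem poleOrder_eq (c : AdaptedChart Δ π) {l : Fin n} {i : ι} (h : c.label l = some i) :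
    (c.poleOrder l : ℚ) = c.p l * Δ.coeff i := by
  have ha : (Δ.a i : ℚ) ≠ 0 := by exact_mod_cast (Δ.a_pos i).ne'
  simp only [poleOrder, h, OrbifoldDivisor.coeff]
  rw [Nat.cast_mul, Nat.cast_div (c.a_dvd_p l i h) ha, Nat.cast_sub (Δ.b_le_a i)]
  field_simp

end AdaptedChart

/-! ## Orbifold differential forms -/

/-- A tangent vector of `X` at `π y`, where `y` lies outside the preimage of the components of the
divisor. -/
structure TangentPoint (Δ : OrbifoldDivisor n ι X) (π : Y → X) where
  pt : Y
  off : ∀ i, π pt ∉ Δ.comp i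
  vec : TangentSpace 𝓘(ℂ, Fin n → ℂ) (π pt)

/-- The form `w_l ^ (-p_l (1 - 1 / m_l)) π^* dz_l`, as a function of tangent vectors. -/
def AdaptedChart.form {Δ : OrbifoldDivisor n ι X} {π : Y → X} (c : AdaptedChart Δ π) (l : Fin n)
    (v : TangentPoint Δ π) : ℂ :=
  (c.w v.pt l ^ c.poleOrder l)⁻¹ *
    (mfderiv 𝓘(ℂ, Fin n → ℂ) 𝓘(ℂ, Fin n → ℂ) c.z (π v.pt) v.vec : Fin n → ℂ) l

/-- The generators of the orbifold cotangent sheaf, in all adapted coordinates. -/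
def formGens (Δ : OrbifoldDivisor n ι X) (π : Y → X) : Set (Opens Y × (TangentPoint Δ π → ℂ)) :=
  {g | ∃ (c : AdaptedChart Δ π) (l : Fin n), g = (c.domain, c.form l)}

/-- The orbifold cotangent sheaf `Ω_{π,Δ}`. Its sections are meromorphic sections of `π^* Ω_X`
without poles outside the preimage of the divisor; they are determined by the functions on
tangent vectors that they define outside this preimage, which is nowhere dense. -/
def OrbForms (Δ : OrbifoldDivisor n ι X) (π : Y → X) (U : Opens Y) :
    Submodule (Hol n U) (LocFun (TangentPoint.pt (Δ := Δ) (π := π)) U) :=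
  generatedSheaf n _ (formGens Δ π) U

/-- Restriction of orbifold forms. -/
def OrbForms.res {Δ : OrbifoldDivisor n ι X} {π : Y → X} {U V : Opens Y} (h : V ≤ U)
    (s : OrbForms Δ π U) : OrbForms Δ π V :=
  ⟨LocFun.res h s.1, res_mem_generatedSheaf h s.2⟩

/-- The generator `w_l ^ (-p_l (1 - 1 / m_l)) π^* dz_l` as a section of `Ω_{π,Δ}`. -/
def AdaptedChart.formSection {Δ : OrbifoldDivisor n ι X} {π : Y → X} (c : AdaptedChart Δ π)
    {U : Opens Y} (h : U ≤ c.domain) (l : Fin n) : OrbForms Δ π U :=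
  ⟨LocFun.of _ (c.form l) U, of_mem_generatedSheaf ⟨c, l, rfl⟩ h⟩

/-! ## Orbifold jet differentials -/

/-- A germ of holomorphic curve in `X` through `π y`, where `y` lies outside the preimage of the
components of the divisor. Jet differentials of order `k` are functions on such germs that depend on
the `k`-jet only. -/
structure JetPoint (Δ : OrbifoldDivisor n ι X) (π : Y → X) where
  pt : Y
  off : ∀ i, π pt ∉ Δ.comp i
  curve : ℂ → X
  base : curve 0 = π pt
  holomorphic : ContMDiffAt 𝓘(ℂ) 𝓘(ℂ, Fin n → ℂ) ω curve 0

/-- Exponents of a monomial in jet coordinates of order at most `k`; the index `j : Fin k` stands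
for the order `j + 1`. -/
abbrev MultiIndex (n k : ℕ) := Fin n → Fin k → ℕ

/-- The partial weighted degree `‖α‖_q = ∑_{j ≤ q} ∑_l j α_{l,j}`. -/
def partialWeight {k : ℕ} (q : ℕ) (α : MultiIndex n k) : ℕ :=
  ∑ j : Fin k, if (j : ℕ) + 1 ≤ q then ∑ l, ((j : ℕ) + 1) * α l j else 0

/-- The total weighted degree `‖α‖ = ‖α‖_k`. -/
def totalWeight {k : ℕ} (α : MultiIndex n k) : ℕ := partialWeight k α

/-- The tuple `(‖α‖_{k-1}, …, ‖α‖_1)`, ordered lexicographically. -/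
def weightVector {k : ℕ} (α : MultiIndex n k) : Lex (Fin (k - 1) → ℕ) :=
  toLex fun r => partialWeight (k - 1 - (r : ℕ)) α

namespace AdaptedChart

variable {Δ : OrbifoldDivisor n ι X} {π : Y → X} {k : ℕ}

/-- The function `w_l ^ (-p_l max (1 - j / m_l) 0) π^* d^j z_l` of curves, where `d^j z_l` is the
`j`th Taylor coefficient of the coordinate `z_l` along the curve. -/
def jetCoord (c : AdaptedChart Δ π) (l : Fin n) (j : ℕ) (q : JetPoint Δ π) : ℂ :=
  (c.w q.pt l ^ (c.trunc j).poleOrder l)⁻¹ *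
    (iteratedDeriv j (fun t => c.z (q.curve t) l) 0 / (j.factorial : ℂ))

/-- The monomial with exponents `α` in the functions `jetCoord`. -/
def monomial (c : AdaptedChart Δ π) (α : MultiIndex n k) (q : JetPoint Δ π) : ℂ :=
  ∏ l, ∏ j : Fin k, c.jetCoord l ((j : ℕ) + 1) q ^ α l j

/-- The span over `𝒪_Y(V)` of the monomials of weighted degree `N` with exponents in `S`. -/
def monomialSpan (c : AdaptedChart Δ π) (k N : ℕ) (S : Set (MultiIndex n k)) (V : Opens Y) :
    Submodule (Hol n V) (LocFun (JetPoint.pt (Δ := Δ) (π := π)) V) :=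
  Submodule.span (Hol n V) {s | ∃ α ∈ S, totalWeight α = N ∧ s = LocFun.of _ (c.monomial α) V}

end AdaptedChart

/-- The monomials of weighted degree `N`, in all adapted coordinates. -/
def jetGens (Δ : OrbifoldDivisor n ι X) (π : Y → X) (k N : ℕ) :
    Set (Opens Y × (JetPoint Δ π → ℂ)) :=
  {g | ∃ (c : AdaptedChart Δ π) (α : MultiIndex n k), totalWeight α = N ∧
    g = (c.domain, c.monomial α)}

/-- The sheaf `E_{k,N} Ω_{π,Δ}` of orbifold jet differentials of order `k` and weighted degree
`N`. -/
def JetDiff (Δ : OrbifoldDivisor n ι X) (π : Y → X) (k N : ℕ) (U : Opens Y) :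
    Submodule (Hol n U) (LocFun (JetPoint.pt (Δ := Δ) (π := π)) U) :=
  generatedSheaf n _ (jetGens Δ π k N) U

/-- The sections of `E_{k,N} Ω_{π,Δ}` such that in all adapted coordinates only monomials with
exponents in `S` occur. -/
def filt (Δ : OrbifoldDivisor n ι X) (π : Y → X) (k N : ℕ) (S : Set (MultiIndex n k))
    (U : Opens Y) : Submodule (Hol n U) (LocFun (JetPoint.pt (Δ := Δ) (π := π)) U) where
  carrier := {s | s ∈ JetDiff Δ π k N U ∧ ∀ (c : AdaptedChart Δ π) (V : Opens Y) (h : V ≤ U),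
    V ≤ c.domain → LocFun.res h s ∈ c.monomialSpan k N S V}
  add_mem' := fun hs hs' => ⟨Submodule.add_mem _ hs.1 hs'.1,
    fun c V h hc => Submodule.add_mem _ (hs.2 c V h hc) (hs'.2 c V h hc)⟩
  zero_mem' := ⟨Submodule.zero_mem _, fun _ _ _ _ => Submodule.zero_mem _⟩
  smul_mem' := fun a _ hs => ⟨Submodule.smul_mem _ a hs.1,
    fun c V h hc => Submodule.smul_mem _
      (ContMDiffMap.restrictRingHom 𝓘(ℂ, Fin n → ℂ) 𝓘(ℂ) ℂ h a) (hs.2 c V h hc)⟩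

/-- Exponents with `m ≤ ‖α‖_q`. -/
def degGE (k q m : ℕ) : Set (MultiIndex n k) := {α | m ≤ partialWeight q α}

/-- Exponents with `d ≤ (‖α‖_{k-1}, …, ‖α‖_1)` lexicographically. -/
def lexGE (k : ℕ) (d : Lex (Fin (k - 1) → ℕ)) : Set (MultiIndex n k) := {α | d ≤ weightVector α}

/-- Exponents with `d < (‖α‖_{k-1}, …, ‖α‖_1)` lexicographically. -/
def lexGT (k : ℕ) (d : Lex (Fin (k - 1) → ℕ)) : Set (MultiIndex n k) := {α | d < weightVector α}

/-- The graded piece `F^d / F^{>d}` of the filtration by `(‖·‖_{k-1}, …, ‖·‖_1)`, over `U`. -/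
abbrev GrPiece (Δ : OrbifoldDivisor n ι X) (π : Y → X) (k N : ℕ) (d : Lex (Fin (k - 1) → ℕ))
    (U : Opens Y) :=
  (filt Δ π k N (lexGE k d) U) ⧸
    (filt Δ π k N (lexGT k d) U).comap (filt Δ π k N (lexGE k d) U).subtype

/-- The tuples `ℓ = (ℓ_1, …, ℓ_k)` with `‖ℓ‖ = ∑ j ℓ_j = N`. -/
abbrev Weights (k N : ℕ) := {ℓ : Fin k → ℕ // ∑ j : Fin k, ((j : ℕ) + 1) * ℓ j = N}

/-- The tuple `(‖α‖_{k-1}, …, ‖α‖_1)` of the monomials of multidegree `ℓ`, i.e. those with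
`∑_l α_{l,j} = ℓ_j`. -/
def Weights.degree {k N : ℕ} (ℓ : Weights k N) : Lex (Fin (k - 1) → ℕ) :=
  toLex fun r => ∑ j : Fin k, if (j : ℕ) + 1 ≤ k - 1 - (r : ℕ) then ((j : ℕ) + 1) * ℓ.1 j else 0

/-- `S^{ℓ_1} Ω_{π,Δ^(1)} ⊗ ⋯ ⊗ S^{ℓ_k} Ω_{π,Δ^(k)}`, over `U`. -/
abbrev TensorPiece (Δ : OrbifoldDivisor n ι X) (π : Y → X) {k N : ℕ} (ℓ : Weights k N)
    (U : Opens Y) :=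
  ⨂[Hol n U] j : Fin k, SymPow (Hol n U) (OrbForms (Δ.trunc ((j : ℕ) + 1)) π U) (ℓ.1 j)

/-- The decomposable element `⨂_j (s_{j,1} ⋯ s_{j,ℓ_j})`. -/
def pureTensor {Δ : OrbifoldDivisor n ι X} {π : Y → X} {k N : ℕ} (ℓ : Weights k N) {U : Opens Y}
    (s : ∀ j : Fin k, Fin (ℓ.1 j) → OrbForms (Δ.trunc ((j : ℕ) + 1)) π U) : TensorPiece Δ π ℓ U :=
  PiTensorProduct.tprod (Hol n U) fun j => symProd (Hol n U) (s j)

/-- The open sets contained in the domain of some adapted coordinates; they form a basis of the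
topology of `Y` if `π` is adapted. -/
def IsCoordOpen (Δ : OrbifoldDivisor n ι X) (π : Y → X) (U : Opens Y) : Prop :=
  ∃ c : AdaptedChart Δ π, U ≤ c.domain

end Orbifold

end OrbifoldJets

end

open OrbifoldJets

/-! Everything reduces to how jet coordinates change between two adapted charts. If `z'_l = g(z)`,
the `j`th Taylor coefficient of `g` along a curve is `dg` applied to the vector of `j`th Taylor
coefficients, plus a combination with holomorphic coefficients of products of jet coordinates whose
positive orders add up to `j` (`AdaptedChart.germSpan_taylorCoeff`). Replacing one coordinate of
order `i + j` by a product of coordinates of orders `i` and `j` strictly increases the profile `q ↦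
‖α‖_q` (`jetProfile_add_lt`), so the nonlinear terms lie deeper in the filtration.

The normalizing factors need a separate argument. Away from a labelled hyperplane they are units. At
a point of such a hyperplane, irreducibility and division by a coordinate show that it is also a
coordinate hyperplane of the other chart, with the same ramification index, and `z'_l = z_s u`, `w_s
= w'_l v` with `v` a unit (`AdaptedChart.exists_unit_of_label`). In the Leibniz expansion of `z_s u`
the poles are harmless because pole orders decrease with the jet order and never exceed `p_s`. Thus
normalized jet coordinates transform, up to strictly larger profiles, like the generators of
`Ω_{π,Δ^(j)}` (`AdaptedChart.germSpan_jetCoord_sub`).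

Consequently a monomial is locally a combination of monomials of at least its profile in any other
chart. With linear independence, obtained by testing on polynomial curves, this gives the frames and
makes every condition that passes to larger profiles independent of the chart
(`AdaptedChart.filt_eq`).

For the graded pieces, a chart turns a form into a function on jets by evaluating it on the vector
of Taylor coefficients; products of forms become products of functions. This sends a spanning set of
the tensor product to the monomials of weight vector exactly `d`, so it is bijective onto `F^d /
F^{>d}` (`AdaptedChart.grMap_bijective`), and modulo `F^{>d}` it does not depend on the chart
(`AdaptedChart.grMap_eq`). Since `‖·‖ = N` and the weight vector determine the multidegree, each `d`
belongs to at most one `ℓ`, and the remaining graded pieces vanish. -/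

noncomputable section

namespace OrbifoldJets

open Filter Topology

/-! ### Division of analytic functions by a coordinate, and irreducibility of germs -/

section CoordinateDivision

variable {n : ℕ}

/-- The projection of `ℂⁿ` onto the coordinate hyperplane `x_s = 0`. -/
def hyperplaneProj (s : Fin n) : (Fin n → ℂ) →L[ℂ] (Fin n → ℂ) :=
  ContinuousLinearMap.pi fun r => if r = s then 0 else ContinuousLinearMap.proj r

theorem hyperplaneProj_apply (s r : Fin n) (x : Fin n → ℂ) :
    hyperplaneProj s x r = if r = s then 0 else x r := by
  by_cases h : r = s <;> simp [hyperplaneProj, h]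

theorem norm_hyperplaneProj_apply_le (s : Fin n) (x : Fin n → ℂ) : ‖hyperplaneProj s x‖ ≤ ‖x‖ := by
  refine (pi_norm_le_iff_of_nonneg (norm_nonneg x)).2 fun r => ?_
  rw [hyperplaneProj_apply]
  split_ifs
  · simp
  · exact norm_le_pi_norm x r

theorem norm_hyperplaneProj_le (s : Fin n) : ‖hyperplaneProj s‖ ≤ 1 :=
  ContinuousLinearMap.opNorm_le_bound _ zero_le_one fun x => by
    simpa using norm_hyperplaneProj_apply_le s x

theorem sub_hyperplaneProj (s : Fin n) (x : Fin n → ℂ) :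
    x - hyperplaneProj s x = x s • Pi.single s (1 : ℂ) := by
  ext r
  by_cases h : r = s
  · subst h; simp [hyperplaneProj_apply]
  · simp [hyperplaneProj_apply, h]

/-- The power series of the quotient `(f(x) - f(x with x_s replaced by 0)) / x_s`. -/
def quotSeries (p : FormalMultilinearSeries ℂ (Fin n → ℂ) ℂ) (s : Fin n) :
    FormalMultilinearSeries ℂ (Fin n → ℂ) ℂ := fun m =>
  ∑ i : Fin (m + 1), ((p (m + 1)).curryMid i (Pi.single s 1)).compContinuousLinearMap
    fun j => if i.succAbove j < i then ContinuousLinearMap.id ℂ _ else hyperplaneProj s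

theorem norm_quotSeries_le (p : FormalMultilinearSeries ℂ (Fin n → ℂ) ℂ) (s : Fin n) (m : ℕ) :
    ‖quotSeries p s m‖ ≤ (m + 1) * ‖p (m + 1)‖ := by
  refine (norm_sum_le _ _).trans ?_
  have key : ∀ i : Fin (m + 1), ‖((p (m + 1)).curryMid i (Pi.single s 1)).compContinuousLinearMap
      (fun j => if i.succAbove j < i then ContinuousLinearMap.id ℂ _ else hyperplaneProj s)‖ ≤
        ‖p (m + 1)‖ := by
    intro i
    refine (ContinuousMultilinearMap.norm_compContinuousLinearMap_le _ _).trans ?_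
    have h1 : ‖(p (m + 1)).curryMid i (Pi.single s 1)‖ ≤ ‖p (m + 1)‖ := by
      refine (ContinuousLinearMap.le_opNorm _ _).trans ?_
      rw [ContinuousMultilinearMap.norm_curryMid, Pi.norm_single]
      simp
    refine (mul_le_mul h1 (Finset.prod_le_one (fun _ _ => norm_nonneg _) fun j _ => ?_)
      (Finset.prod_nonneg fun _ _ => norm_nonneg _) (norm_nonneg _)).trans (mul_one _).le
    split_ifs
    · exact ContinuousLinearMap.norm_id_le
    · exact norm_hyperplaneProj_le s
  refine (Finset.sum_le_sum fun i _ => key i).trans ?_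
  simp

/-- Telescoping: the arguments `y` are exchanged for their projections one slot at a time. The
difference made by slot `i` has `y` in the earlier slots, the projection in the later ones, and
`y_s` times the basis vector in slot `i`. -/
theorem quotSeries_apply (p : FormalMultilinearSeries ℂ (Fin n → ℂ) ℂ) (s : Fin n) (m : ℕ)
    (y : Fin n → ℂ) :
    (p (m + 1) fun _ => y) - (p (m + 1) fun _ => hyperplaneProj s y) =
      y s * quotSeries p s m fun _ => y := by
  have h := (p (m + 1)).toMultilinearMap.map_sub_map_piecewise (fun _ => y)
    (fun _ => hyperplaneProj s y) Finset.univ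
  simp only [Finset.piecewise_univ, Finset.mem_univ, true_imp_iff,
    ContinuousMultilinearMap.coe_coe] at h
  rw [h, quotSeries, sum_apply, Finset.mul_sum]
  refine Finset.sum_congr rfl fun i _ => ?_
  rw [ContinuousMultilinearMap.compContinuousLinearMap_apply,
    ContinuousMultilinearMap.curryMid_apply, ← smul_eq_mul]
  have h2 := (p (m + 1)).map_update_smul (i.insertNth (0 : Fin n → ℂ) fun j => (if i.succAbove j < i then
    ContinuousLinearMap.id ℂ _ else hyperplaneProj s) y) i (y s) (Pi.single s 1)
  simp only [Fin.update_insertNth] at h2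
  rw [← h2]
  congr 1
  ext1 j
  rcases Fin.eq_self_or_eq_succAbove i j with rfl | ⟨j, rfl⟩
  · simp [sub_hyperplaneProj]
  · rw [Fin.insertNth_apply_succAbove]
    have : i ≠ i.succAbove j := (Fin.succAbove_ne i j).symm
    simp only [this, if_false]
    split_ifs <;> rfl

/-- The `m + 1` summands of degree `m` cost only a factor `m + 1 ≤ 2 ^ m`, which is absorbed by
halving the radius. -/
theorem quotSeries_radius_pos (p : FormalMultilinearSeries ℂ (Fin n → ℂ) ℂ) (hp : 0 < p.radius)
    (s : Fin n) : 0 < (quotSeries p s).radius := by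
  obtain ⟨C, r, hC, hr, h⟩ := p.le_mul_pow_of_radius_pos hp
  have hr2 : (0 : ℝ) < (2 * r)⁻¹ := by positivity
  obtain ⟨ρ, hρ⟩ : ∃ ρ : NNReal, (ρ : ℝ) = (2 * r)⁻¹ := ⟨⟨_, hr2.le⟩, rfl⟩
  have : (ρ : ENNReal) ≤ (quotSeries p s).radius := by
    refine (quotSeries p s).le_radius_of_bound (C * r) fun m => ?_
    rw [hρ]
    calc ‖quotSeries p s m‖ * ((2 * r)⁻¹) ^ m
        ≤ ((m + 1) * (C * r ^ (m + 1))) * ((2 * r)⁻¹) ^ m := by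
          gcongr
          exact (norm_quotSeries_le p s m).trans (by gcongr; exact h _)
      _ = (C * r) * (((m : ℝ) + 1) * ((2 : ℝ)⁻¹) ^ m) := by
          rw [mul_inv, mul_pow, inv_pow r, pow_succ]; field_simp
      _ ≤ (C * r) * 1 := by
          gcongr
          rw [inv_pow, ← div_eq_mul_inv, div_le_one (by positivity)]
          exact_mod_cast Nat.lt_two_pow_self
      _ = C * r := mul_one _
  refine lt_of_lt_of_le ?_ this
  rw [← hρ] at hr2
  exact_mod_cast hr2

/-- A holomorphic function that vanishes on the coordinate hyperplane `x_s = 0` is divisible by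
`x_s`. -/
theorem exists_eq_coord_mul {f : (Fin n → ℂ) → ℂ} {a : Fin n → ℂ} (hf : AnalyticAt ℂ f a) (s : Fin n)
    (has : a s = 0) (h0 : ∀ᶠ x in 𝓝 a, x s = 0 → f x = 0) :
    ∃ h : (Fin n → ℂ) → ℂ, AnalyticAt ℂ h a ∧ ∀ᶠ x in 𝓝 a, f x = x s * h x := by
  obtain ⟨p, r, hp⟩ := hf
  have hq := quotSeries_radius_pos p (hp.r_pos.trans_le hp.r_le) s
  have hqs := (quotSeries p s).hasFPowerSeriesOnBall hq
  refine ⟨fun x => (quotSeries p s).sum (x - a), ?_, ?_⟩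
  · have h1 : AnalyticAt ℂ (quotSeries p s).sum (a - a) := by
      rw [sub_self]; exact hqs.analyticAt
    exact h1.fun_comp (f := fun x : Fin n → ℂ => x - a) (by fun_prop)
  · have hPa : hyperplaneProj s a = a := by
      ext r
      rw [hyperplaneProj_apply]
      split_ifs with h
      · rw [h, has]
      · rfl
    have h0' : ∀ᶠ x in 𝓝 a, f (hyperplaneProj s x) = 0 := by
      have ht : Tendsto (hyperplaneProj s) (𝓝 a) (𝓝 a) := by
        have := (hyperplaneProj s).continuous.tendsto a
        rwa [hPa] at this
      filter_upwards [ht.eventually h0] with x hx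
      exact hx (by simp [hyperplaneProj_apply])
    have hb := Metric.eball_mem_nhds a (lt_min hp.r_pos hq)
    filter_upwards [hb, h0'] with x hx hx0
    have hx' : ‖x - a‖ₑ < min r (quotSeries p s).radius := by
      rwa [Metric.mem_eball, edist_eq_enorm_sub] at hx
    set y := x - a with hy
    have hxy : x = a + y := by rw [hy]; abel
    have hyr : y ∈ Metric.eball (0 : Fin n → ℂ) r := by
      rw [Metric.mem_eball, edist_zero_right]; exact hx'.trans_le (min_le_left _ _)
    have hPr : hyperplaneProj s y ∈ Metric.eball (0 : Fin n → ℂ) r := by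
      rw [Metric.mem_eball, edist_zero_right] at hyr ⊢
      refine lt_of_le_of_lt ?_ hyr
      exact enorm_le_iff_norm_le.2 (norm_hyperplaneProj_apply_le s y)
    have hyq : y ∈ Metric.eball (0 : Fin n → ℂ) (quotSeries p s).radius := by
      rw [Metric.mem_eball, edist_zero_right]; exact hx'.trans_le (min_le_right _ _)
    have e1 := hp.hasSum hyr
    have e2 := hp.hasSum hPr
    have hPx : a + hyperplaneProj s y = hyperplaneProj s x := by rw [hxy, map_add, hPa]
    rw [hPx, hx0] at e2
    have e3 := e1.sub e2
    rw [sub_zero, ← hxy] at e3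
    -- The constant terms of the two expansions cancel, so the sum may start in degree one, where
    -- the telescoping identity applies.
    have e4 : HasSum (fun m => (p (m + 1) fun _ => y) - p (m + 1) fun _ => hyperplaneProj s y)
        (f x) := by
      rw [hasSum_nat_add_iff (f := fun m => (p m fun _ => y) - p m fun _ => hyperplaneProj s y) 1]
      convert e3 using 1
      simp only [Finset.range_one, Finset.sum_singleton]
      rw [show (fun _ : Fin 0 => y) = fun _ => hyperplaneProj s y from funext fun i => i.elim0]
      ring
    simp only [quotSeries_apply] at e4
    have e5 := ((quotSeries p s).hasSum hyq).mul_left (y s)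
    have := e4.unique e5
    rw [this, hxy, Pi.add_apply, has, zero_add]

/-- Germs of analytic functions form a domain: where one factor is nonzero the other vanishes on an
open set, hence on the whole ball by the identity theorem. -/
theorem eventually_eq_zero_or_of_mul {E : Type*} [NormedAddCommGroup E] [NormedSpace ℂ E]
    {f g : E → ℂ} {a : E} (hf : AnalyticAt ℂ f a) (hg : AnalyticAt ℂ g a)
    (h : ∀ᶠ x in 𝓝 a, f x * g x = 0) : (∀ᶠ x in 𝓝 a, f x = 0) ∨ ∀ᶠ x in 𝓝 a, g x = 0 := by
  obtain ⟨ε, hε, hb⟩ := Metric.eventually_nhds_iff_ball.1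
    (hf.eventually_analyticAt.and (hg.eventually_analyticAt.and h))
  by_cases hz : ∀ x ∈ Metric.ball a ε, f x = 0
  · left
    filter_upwards [Metric.ball_mem_nhds a hε] with x hx using hz x hx
  · right
    push Not at hz
    obtain ⟨x, hx, hfx⟩ := hz
    have hgx : g =ᶠ[𝓝 x] 0 := by
      filter_upwards [(hb x hx).1.continuousAt.eventually_ne hfx,
        Metric.isOpen_ball.mem_nhds hx] with x' h1 h2
      exact (mul_eq_zero.1 (hb x' h2).2.2).resolve_left h1
    have hU : AnalyticOnNhd ℂ g (Metric.ball a ε) := fun x' h' => (hb x' h').2.1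
    have hpc : IsPreconnected (Metric.ball a ε) :=
      letI := NormedSpace.restrictScalars ℝ ℂ E
      (convex_ball a ε).isPreconnected
    have := hU.eqOn_zero_of_preconnected_of_eventuallyEq_zero hpc hx hgx
    filter_upwards [Metric.ball_mem_nhds a hε] with x hx using this hx

/-- The product of the functions vanishes near the point, so one of its factors does. Applied on a
hyperplane, this expresses that an irreducible set covered by finitely many hypersurfaces lies in
one of them. -/
theorem exists_eventually_eq_zero_of_prod {E κ : Type*} [NormedAddCommGroup E] [NormedSpace ℂ E]
    (L : Finset κ) {f : κ → E → ℂ} {a : E} (hf : ∀ s, AnalyticAt ℂ (f s) a)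
    (h : ∀ᶠ x in 𝓝 a, ∃ s ∈ L, f s x = 0) : ∃ s ∈ L, ∀ᶠ x in 𝓝 a, f s x = 0 := by
  classical
  induction L using Finset.induction_on with
  | empty =>
    obtain ⟨x, hx⟩ := h.exists
    simp at hx
  | insert s L hs ih =>
    have h' : ∀ᶠ x in 𝓝 a, f s x * ∏ t ∈ L, f t x = 0 := by
      filter_upwards [h] with x ⟨t, ht, hx⟩
      rw [← Finset.prod_insert (f := fun t => f t x) hs]
      exact Finset.prod_eq_zero ht hx
    have hp : AnalyticAt ℂ (fun x => ∏ t ∈ L, f t x) a :=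
      Finset.analyticAt_fun_prod L fun t _ => hf t
    rcases eventually_eq_zero_or_of_mul (hf s) hp h' with h1 | h1
    · exact ⟨s, Finset.mem_insert_self _ _, h1⟩
    · obtain ⟨t, ht, h2⟩ := ih (by
        filter_upwards [h1] with x hx
        exact Finset.prod_eq_zero_iff.1 hx)
      exact ⟨t, Finset.mem_insert_of_mem ht, h2⟩

end CoordinateDivision

/-! ### Comparison of coordinate hyperplanes in two charts -/

section Charts

variable {n : ℕ} {M : Type*} [TopologicalSpace M] [ChartedSpace (Fin n → ℂ) M]
  {z z' : OpenPartialHomeomorph M (Fin n → ℂ)} {x₀ : M}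

theorem analyticAt_transition (hz : z ∈ IsManifold.maximalAtlas 𝓘(ℂ, Fin n → ℂ) ω M)
    (hz' : z' ∈ IsManifold.maximalAtlas 𝓘(ℂ, Fin n → ℂ) ω M) (hx : x₀ ∈ z.source)
    (hx' : x₀ ∈ z'.source) : AnalyticAt ℂ (fun a => z (z'.symm a)) (z' x₀) := by
  have h1 : ContMDiffAt 𝓘(ℂ, Fin n → ℂ) 𝓘(ℂ, Fin n → ℂ) ω z'.symm (z' x₀) :=
    contMDiffAt_symm_of_mem_maximalAtlas hz' (z'.map_source hx')
  have h2 : ContMDiffAt 𝓘(ℂ, Fin n → ℂ) 𝓘(ℂ, Fin n → ℂ) ω z (z'.symm (z' x₀)) := by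
    rw [z'.left_inv hx']
    exact contMDiffAt_of_mem_maximalAtlas hz hx
  exact (h2.comp _ h1).contDiffAt.analyticAt

theorem analyticAt_transition_coord (hz : z ∈ IsManifold.maximalAtlas 𝓘(ℂ, Fin n → ℂ) ω M)
    (hz' : z' ∈ IsManifold.maximalAtlas 𝓘(ℂ, Fin n → ℂ) ω M) (hx : x₀ ∈ z.source)
    (hx' : x₀ ∈ z'.source) (s : Fin n) :
    AnalyticAt ℂ (fun a => z (z'.symm a) s) (z' x₀) :=
  ((ContinuousLinearMap.proj (R := ℂ) (φ := fun _ : Fin n => ℂ) s).analyticAt _).fun_comp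
    (analyticAt_transition hz hz' hx hx')

/-- Composition with the inverse transition map gives back the coordinate function `b ↦ b s`, whose
differential is not zero. -/
theorem fderiv_transition_coord_ne_zero
    (hz : z ∈ IsManifold.maximalAtlas 𝓘(ℂ, Fin n → ℂ) ω M)
    (hz' : z' ∈ IsManifold.maximalAtlas 𝓘(ℂ, Fin n → ℂ) ω M) (hx : x₀ ∈ z.source)
    (hx' : x₀ ∈ z'.source) (s : Fin n) :
    fderiv ℂ (fun a => z (z'.symm a) s) (z' x₀) ≠ 0 := by
  intro h0
  have h1 : HasFDerivAt (fun a => z (z'.symm a) s)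
      (0 : (Fin n → ℂ) →L[ℂ] ℂ) ((fun b => z' (z.symm b)) (z x₀)) := by
    rw [← h0]
    simp only [z.left_inv hx]
    exact (analyticAt_transition_coord hz hz' hx hx' s).differentiableAt.hasFDerivAt
  have h2 := (analyticAt_transition hz' hz hx' hx).differentiableAt.hasFDerivAt
  have h3 := HasFDerivAt.comp (g := fun a => z (z'.symm a) s) (f := fun b => z' (z.symm b)) (z x₀) h1 h2
  have h4 : HasFDerivAt (fun b : Fin n → ℂ => b s)
      (ContinuousLinearMap.proj (R := ℂ) (φ := fun _ : Fin n => ℂ) s) (z x₀) :=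
    (ContinuousLinearMap.proj (R := ℂ) (φ := fun _ : Fin n => ℂ) s).hasFDerivAt
  have h5 : (fun b : Fin n → ℂ => b s) =ᶠ[𝓝 (z x₀)]
      ((fun a => z (z'.symm a) s) ∘ fun b => z' (z.symm b)) := by
    have ht : Tendsto z.symm (𝓝 (z x₀)) (𝓝 x₀) := z.tendsto_symm hx
    filter_upwards [ht.eventually (z'.open_source.mem_nhds hx'),
      z.open_target.mem_nhds (z.map_source hx)] with b hb hb'
    simp [z'.left_inv hb, z.right_inv hb']
  have h6 := (h3.congr_of_eventuallyEq h5).unique h4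
  have := congrArg (fun L : (Fin n → ℂ) →L[ℂ] ℂ => L (Pi.single s 1)) h6
  simp at this

/-- If one coordinate vanishes where another one does, then they agree up to a unit. -/
theorem exists_coord_eq_mul (hz : z ∈ IsManifold.maximalAtlas 𝓘(ℂ, Fin n → ℂ) ω M)
    (hz' : z' ∈ IsManifold.maximalAtlas 𝓘(ℂ, Fin n → ℂ) ω M) (hx : x₀ ∈ z.source)
    (hx' : x₀ ∈ z'.source) {l : Fin n} (h0 : z' x₀ l = 0) (L : Finset (Fin n))
    (h : ∀ᶠ x in 𝓝 x₀, z' x l = 0 → ∃ s ∈ L, z x s = 0) :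
    ∃ s ∈ L, ∃ u : (Fin n → ℂ) → ℂ, AnalyticAt ℂ u (z' x₀) ∧ u (z' x₀) ≠ 0 ∧
      ∀ᶠ x in 𝓝 x₀, z x s = z' x l * u (z' x) := by
  have hP : hyperplaneProj l (z' x₀) = z' x₀ := by
    ext r
    rw [hyperplaneProj_apply]
    split_ifs with h
    · rw [h, h0]
    · rfl
  have ht : Tendsto z'.symm (𝓝 (z' x₀)) (𝓝 x₀) := z'.tendsto_symm hx'
  have hPt : Tendsto (hyperplaneProj l) (𝓝 (z' x₀)) (𝓝 (z' x₀)) := by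
    have := (hyperplaneProj l).continuous.tendsto (z' x₀)
    rwa [hP] at this
  have htar := z'.open_target.mem_nhds (z'.map_source hx')
  -- Composing with the projection restricts the functions to the hyperplane while keeping them
  -- defined on an open set of `ℂⁿ`; on it a single `s ∈ L` then works at all nearby points.
  have hprod := exists_eventually_eq_zero_of_prod L
    (f := fun s a => z (z'.symm (hyperplaneProj l a)) s) (a := z' x₀)
    (fun s => by
      have h1 := analyticAt_transition_coord hz hz' hx hx' s
      rw [← hP] at h1
      exact h1.fun_comp ((hyperplaneProj l).analyticAt _))
    (by
      filter_upwards [(ht.comp hPt).eventually h, hPt.eventually htar] with a ha ha'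
      refine ha ?_
      simp [z'.right_inv ha', hyperplaneProj_apply])
  obtain ⟨s, hs, hs0⟩ := hprod
  obtain ⟨u, hu, hfu⟩ := exists_eq_coord_mul (analyticAt_transition_coord hz hz' hx hx' s) l h0
    (by
      filter_upwards [hs0] with a ha ha0
      have : hyperplaneProj l a = a := by
        ext r
        rw [hyperplaneProj_apply]
        split_ifs with h
        · rw [h, ha0]
        · rfl
      rwa [this] at ha)
  refine ⟨s, hs, u, hu, fun hu0 => ?_, ?_⟩
  -- If `u` vanished at the point, both factors of `z_s` would vanish there and the product rule
  -- would give `dz_s = 0`.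
  · refine fderiv_transition_coord_ne_zero hz hz' hx hx' s ?_
    have h1 : HasFDerivAt (fun b : Fin n → ℂ => b l)
      (ContinuousLinearMap.proj (R := ℂ) (φ := fun _ : Fin n => ℂ) l) (z' x₀) :=
      (ContinuousLinearMap.proj (R := ℂ) (φ := fun _ : Fin n => ℂ) l).hasFDerivAt
    have h2 := h1.mul hu.differentiableAt.hasFDerivAt
    rw [(h2.congr_of_eventuallyEq hfu).fderiv, hu0, h0]
    ext v
    simp
  · have ht' : Tendsto z' (𝓝 x₀) (𝓝 (z' x₀)) := z'.continuousAt hx'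
    filter_upwards [ht'.eventually hfu, z'.open_source.mem_nhds hx'] with x h1 h2
    rwa [z'.left_inv h2] at h1

end Charts

/-- A coordinate is nonzero on a dense set. -/
theorem frequently_coord_ne_zero {n : ℕ} {M : Type*} [TopologicalSpace M]
    {z : OpenPartialHomeomorph M (Fin n → ℂ)} {x₀ : M} (hx : x₀ ∈ z.source) : ∃ᶠ x in 𝓝 x₀, ∀ l, z x l ≠ 0 := by
  have h1 : Dense {a : Fin n → ℂ | ∀ l, a l ≠ 0} := by
    have : {a : Fin n → ℂ | ∀ l, a l ≠ 0} = Set.pi Set.univ fun _ => {0}ᶜ := by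
      ext a; simp
    rw [this]
    exact dense_pi _ fun l _ => dense_compl_singleton 0
  have h2 : ∃ᶠ a in 𝓝 (z x₀), ∀ l, a l ≠ 0 :=
    mem_closure_iff_frequently.1 (h1 (z x₀))
  have ht : Tendsto z.symm (𝓝 (z x₀)) (𝓝 x₀) := z.tendsto_symm hx
  refine ht.frequently ((h2.and_eventually (z.open_target.mem_nhds (z.map_source hx))).mono ?_)
  rintro a ⟨ha, ha'⟩
  rwa [z.right_inv ha']

/-! ### Local combinations with holomorphic coefficients, and frames of generated sheaves -/

section Germs

variable {n : ℕ} {T Y : Type*} [TopologicalSpace Y] [ChartedSpace (Fin n → ℂ) Y]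

variable (n) in
/-- The functions on the family `pr : T → Y` that near `y₀` are combinations of members of `B` with
holomorphic functions on `Y` as coefficients. -/
inductive GermSpan (pr : T → Y) (y₀ : Y) (B : Set (T → ℂ)) : (T → ℂ) → Prop
  | gen {b : T → ℂ} (hb : b ∈ B) : GermSpan pr y₀ B b
  | zero : GermSpan pr y₀ B 0
  | add {s s' : T → ℂ} (hs : GermSpan pr y₀ B s) (hs' : GermSpan pr y₀ B s') :
      GermSpan pr y₀ B (s + s')
  | smul {f : Y → ℂ} {s : T → ℂ} (hf : ContMDiffAt 𝓘(ℂ, Fin n → ℂ) 𝓘(ℂ) ω f y₀)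
      (hs : GermSpan pr y₀ B s) : GermSpan pr y₀ B (fun t => f (pr t) * s t)
  | congr {s s' : T → ℂ} (hs : GermSpan pr y₀ B s)
      (h : ∀ᶠ y in 𝓝 y₀, ∀ t, pr t = y → s t = s' t) : GermSpan pr y₀ B s'

namespace GermSpan

variable {pr : T → Y} {y₀ : Y} {B B' B'' : Set (T → ℂ)} {s s' : T → ℂ}

theorem bind (h : ∀ b ∈ B, GermSpan n pr y₀ B' b) (hs : GermSpan n pr y₀ B s) :
    GermSpan n pr y₀ B' s := by
  induction hs with
  | gen hb => exact h _ hb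
  | zero => exact zero
  | add _ _ h1 h2 => exact h1.add h2
  | smul hf _ h1 => exact h1.smul hf
  | congr _ h2 h1 => exact h1.congr h2

theorem mono (h : B ⊆ B') (hs : GermSpan n pr y₀ B s) : GermSpan n pr y₀ B' s :=
  hs.bind fun _ hb => gen (h hb)

theorem const_mul (a : ℂ) (hs : GermSpan n pr y₀ B s) : GermSpan n pr y₀ B (fun t => a * s t) :=
  hs.smul (f := fun _ => a) contMDiffAt_const

theorem neg (hs : GermSpan n pr y₀ B s) : GermSpan n pr y₀ B (-s) := by
  convert hs.const_mul (-1) using 2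
  simp

theorem sub (hs : GermSpan n pr y₀ B s) (hs' : GermSpan n pr y₀ B s') :
    GermSpan n pr y₀ B (s - s') := by
  rw [sub_eq_add_neg]; exact hs.add hs'.neg

theorem sum {κ : Type*} (L : Finset κ) {f : κ → T → ℂ} (h : ∀ i ∈ L, GermSpan n pr y₀ B (f i)) :
    GermSpan n pr y₀ B (fun t => ∑ i ∈ L, f i t) := by
  classical
  induction L using Finset.induction_on with
  | empty => exact zero
  | insert i L hi ih =>
    simp only [Finset.sum_insert hi]
    exact (h i (Finset.mem_insert_self _ _)).add
      (ih fun j hj => h j (Finset.mem_insert_of_mem hj))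

theorem mul (h : ∀ b ∈ B, ∀ b' ∈ B', b * b' ∈ B'') (hs : GermSpan n pr y₀ B s)
    (hs' : GermSpan n pr y₀ B' s') : GermSpan n pr y₀ B'' (s * s') := by
  induction hs with
  | gen hb =>
    rename_i b
    induction hs' with
    | gen hb' => exact gen (h _ hb _ hb')
    | zero => rw [mul_zero]; exact zero
    | add _ _ h1 h2 => rw [mul_add]; exact h1.add h2
    | smul hf _ h1 =>
      convert h1.smul hf using 1
      ext t
      simp only [Pi.mul_apply]
      ring
    | congr _ h2 h1 =>
      refine h1.congr (h2.mono fun y hy t ht => ?_)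
      simp only [Pi.mul_apply, hy t ht]
  | zero => rw [zero_mul]; exact zero
  | add _ _ h1 h2 => rw [add_mul]; exact h1.add h2
  | smul hf _ h1 =>
    convert h1.smul hf using 1
    ext t
    simp only [Pi.mul_apply]
    ring
  | congr _ h2 h1 =>
    refine h1.congr (h2.mono fun y hy t ht => ?_)
    simp only [Pi.mul_apply, hy t ht]

/-- Maps over `Y` do not affect coefficients. This carries relations between forms on tangent
vectors over to functions on jets. -/
theorem comp {T' : Type*} {pr' : T' → Y} {τ : T' → T} (hτ : ∀ t, pr (τ t) = pr' t)
    (hs : GermSpan n pr y₀ B s) : GermSpan n pr' y₀ ((fun b => b ∘ τ) '' B) (s ∘ τ) := by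
  induction hs with
  | gen hb => exact gen ⟨_, hb, rfl⟩
  | zero => exact zero
  | add _ _ h1 h2 => exact h1.add h2
  | smul hf _ h1 =>
    convert h1.smul hf using 1
    ext t
    simp [hτ]
  | congr _ h2 h1 => exact h1.congr (h2.mono fun y hy t ht => hy (τ t) ((hτ t).trans ht))

theorem congr_on {D : Opens Y} (hD : y₀ ∈ D) (hs : GermSpan n pr y₀ B s)
    (h : ∀ t, pr t ∈ D → s t = s' t) : GermSpan n pr y₀ B s' := by
  refine hs.congr ?_
  filter_upwards [D.isOpen.mem_nhds hD] with y hy t ht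
  exact h t (ht ▸ hy)

end GermSpan

/-- A holomorphic germ, as a holomorphic function on a neighbourhood. -/
theorem exists_hol_of_contMDiffAt [IsManifold 𝓘(ℂ, Fin n → ℂ) ω Y] {f : Y → ℂ} {y₀ : Y}
    (hf : ContMDiffAt 𝓘(ℂ, Fin n → ℂ) 𝓘(ℂ) ω f y₀) :
    ∃ V : Opens Y, y₀ ∈ V ∧ ∀ W : Opens Y, W ≤ V → ∃ g : Hol n W, ∀ y : W, g y = f y := by
  obtain ⟨V, hV, hVo, hyV⟩ := eventually_nhds_iff.1
    ((contMDiffAt_iff_contMDiffAt_nhds (by simp)).1 hf)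
  exact ⟨⟨V, hVo⟩, hyV, fun W hW => ⟨⟨fun y => f y, fun y =>
    (hV _ (hW y.2)).comp y contMDiff_subtype_val.contMDiffAt⟩, fun _ => rfl⟩⟩

/-- Finitely many germs of coefficients are involved, so they extend to a common neighbourhood. The
statement covers all smaller `W` so that neighbourhoods can be intersected in the induction. -/
theorem GermSpan.exists_mem_span [IsManifold 𝓘(ℂ, Fin n → ℂ) ω Y] {pr : T → Y} {y₀ : Y}
    {B : Set (T → ℂ)} {s : T → ℂ} (hs : GermSpan n pr y₀ B s) :
    ∃ V : Opens Y, y₀ ∈ V ∧ ∀ W : Opens Y, W ≤ V →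
      LocFun.of pr s W ∈ Submodule.span (Hol n W) ((fun b => LocFun.of pr b W) '' B) := by
  induction hs with
  | gen hb => exact ⟨⊤, trivial, fun W _ => Submodule.subset_span ⟨_, hb, rfl⟩⟩
  | zero => exact ⟨⊤, trivial, fun W _ => Submodule.zero_mem _⟩
  | add _ _ h1 h2 =>
    obtain ⟨V, hV, h⟩ := h1
    obtain ⟨V', hV', h'⟩ := h2
    exact ⟨V ⊓ V', ⟨hV, hV'⟩, fun W hW =>
      Submodule.add_mem _ (h W (hW.trans inf_le_left)) (h' W (hW.trans inf_le_right))⟩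
  | smul hf _ h1 =>
    obtain ⟨V, hV, h⟩ := h1
    obtain ⟨V', hV', h'⟩ := exists_hol_of_contMDiffAt hf
    refine ⟨V ⊓ V', ⟨hV, hV'⟩, fun W hW => ?_⟩
    obtain ⟨g, hg⟩ := h' W (hW.trans inf_le_right)
    convert Submodule.smul_mem _ g (h W (hW.trans inf_le_left)) using 1
    funext t
    exact congrArg (· * _) (hg ⟨pr t.1, t.2⟩).symm
  | congr _ h2 h1 =>
    obtain ⟨V, hV, h⟩ := h1
    obtain ⟨V', hV', hVo, hyV⟩ := eventually_nhds_iff.1 h2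
    refine ⟨V ⊓ ⟨V', hVo⟩, ⟨hV, hyV⟩, fun W hW => ?_⟩
    convert h W (hW.trans inf_le_left) using 1
    funext t
    exact (hV' _ (hW t.2).2 t.1 rfl).symm

/-- Restriction maps a span into the span of the restrictions. -/
theorem res_mem_span_image {pr : T → Y} {B : Set (T → ℂ)} {V W : Opens Y} (h : W ≤ V)
    {s : LocFun pr V}
    (hs : s ∈ Submodule.span (Hol n V) ((fun b => LocFun.of pr b V) '' B)) :
    LocFun.res h s ∈ Submodule.span (Hol n W) ((fun b => LocFun.of pr b W) '' B) := by
  induction hs using Submodule.span_induction with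
  | mem s hs =>
    obtain ⟨b, hb, rfl⟩ := hs
    exact Submodule.subset_span ⟨b, hb, rfl⟩
  | zero => exact Submodule.zero_mem _
  | add s s' _ _ ih ih' => exact Submodule.add_mem _ ih ih'
  | smul a s _ ih =>
    exact Submodule.smul_mem _
      (ContMDiffMap.restrictRingHom 𝓘(ℂ, Fin n → ℂ) 𝓘(ℂ) ℂ h a) ih

theorem sum_smul_apply {pr : T → Y} {A : Type*} [Fintype A] {U : Opens Y} (F : A → Hol n U)
    (e : A → LocFun pr U) (t : {t : T // pr t ∈ U}) :
    (∑ a, F a • e a) t = ∑ a, F a ⟨pr t.1, t.2⟩ * e a t := by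
  have : ∀ L : Finset A, (∑ a ∈ L, F a • e a) t = ∑ a ∈ L, F a ⟨pr t.1, t.2⟩ * e a t := by
    classical
    intro L
    induction L using Finset.induction_on with
    | empty => rfl
    | insert i L hi ih => rw [Finset.sum_insert hi, Finset.sum_insert hi, ← ih]; rfl
  exact this _

/-- Functions whose values at the points over a dense set have no linear relations are linearly
independent over the holomorphic functions. -/
theorem linearIndependent_of_frequently {pr : T → Y} {A : Type*} [Fintype A] {e : A → T → ℂ}
    {U : Opens Y}
    (h : ∀ y ∈ U, ∃ᶠ y' in 𝓝 y, ∀ F : A → ℂ, (∀ t, pr t = y' → ∑ a, F a * e a t = 0) → F = 0) :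
    LinearIndependent (Hol n U) (fun a => LocFun.of pr (e a) U) := by
  rw [Fintype.linearIndependent_iff]
  intro F hF a
  ext y
  change F a y = 0
  by_contra hne
  -- A nonzero coefficient remains nonzero on an open set, which meets the set of points without
  -- pointwise relations.
  have h1 : ∀ᶠ y' in 𝓝 y, F a y' ≠ 0 := (F a).contMDiff.continuous.continuousAt.eventually_ne hne
  rw [nhds_subtype, eventually_comap] at h1
  obtain ⟨y', hy', hy'', hU⟩ :=
    ((h y.1 y.2).and_eventually (h1.and (U.isOpen.mem_nhds y.2))).exists
  refine hy'' ⟨y', hU⟩ rfl (congrFun (hy' (fun a => F a ⟨y', hU⟩) ?_) a)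
  rintro t rfl
  have := congrFun hF ⟨t, hU⟩
  rwa [sum_smul_apply] at this

/-- Sections of the span of a frame are characterised locally. -/
theorem mem_span_of_local {pr : T → Y} {A : Type*} [Finite A] {e : A → T → ℂ} {U : Opens Y}
    (hli : ∀ V : Opens Y, V ≤ U → LinearIndependent (Hol n V) (fun a => LocFun.of pr (e a) V))
    {s : LocFun pr U} (hs : ∀ y ∈ U, ∃ V : Opens Y, y ∈ V ∧ ∃ h : V ≤ U,
      LocFun.res h s ∈ Submodule.span (Hol n V) (Set.range fun a => LocFun.of pr (e a) V)) :
    s ∈ Submodule.span (Hol n U) (Set.range fun a => LocFun.of pr (e a) U) := by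
  have := Fintype.ofFinite A
  simp only [Submodule.mem_span_range_iff_exists_fun] at hs ⊢
  choose V hyV hVU F hF using hs
  -- Linear independence over the intersection makes the coefficients unique, so the local ones
  -- glue.
  have key : ∀ (y₀ : Y) (h₀ : y₀ ∈ U) (y : Y) (h : y ∈ U) (hy : y ∈ V y₀ h₀) (a : A),
      F y h a ⟨y, hyV y h⟩ = F y₀ h₀ a ⟨y, hy⟩ := by
    intro y₀ h₀ y h hy a
    have hl := hli (V y h ⊓ V y₀ h₀) (inf_le_left.trans (hVU _ _))
    rw [Fintype.linearIndependent_iff] at hl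
    have := hl (fun a =>
      ContMDiffMap.restrictRingHom 𝓘(ℂ, Fin n → ℂ) 𝓘(ℂ) ℂ inf_le_left (F y h a) -
      ContMDiffMap.restrictRingHom 𝓘(ℂ, Fin n → ℂ) 𝓘(ℂ) ℂ inf_le_right (F y₀ h₀ a)) (by
        funext t
        rw [sum_smul_apply]
        have h1 := congrFun (hF y h) ⟨t.1, t.2.1⟩
        have h2 := congrFun (hF y₀ h₀) ⟨t.1, t.2.2⟩
        rw [sum_smul_apply] at h1 h2
        refine Eq.trans ?_ (sub_eq_zero.2 (h1.trans h2.symm))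
        rw [← Finset.sum_sub_distrib]
        exact Finset.sum_congr rfl fun a _ => sub_mul _ _ _) a
    have := congrArg (fun g : Hol n (V y h ⊓ V y₀ h₀ : Opens Y) => g ⟨y, hyV y h, hy⟩) this
    exact sub_eq_zero.1 this
  have hg : ∀ a, ∃ g : Hol n U, ∀ y : U, g y = F y.1 y.2 a ⟨y.1, hyV _ _⟩ := by
    classical
    intro a
    let G : Y → ℂ := fun y => if h : y ∈ U then F y h a ⟨y, hyV _ _⟩ else 0
    have hG : ∀ y₀ ∈ U, ContMDiffAt 𝓘(ℂ, Fin n → ℂ) 𝓘(ℂ) ω G y₀ := by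
      intro y₀ h₀
      refine (contMDiffAt_subtype_iff (U := V y₀ h₀) (x := ⟨y₀, hyV _ _⟩)).1 ?_
      refine ((F y₀ h₀ a).contMDiff _).congr_of_eventuallyEq (Eventually.of_forall fun y => ?_)
      simp only [G, dif_pos (hVU _ _ y.2)]
      exact key y₀ h₀ y.1 (hVU _ _ y.2) y.2 a
    exact ⟨⟨fun y => G y.1, fun y => contMDiffAt_subtype_iff.2 (hG y.1 y.2)⟩,
      fun y => dif_pos y.2⟩
  choose g hg using hg
  refine ⟨g, ?_⟩
  funext t
  rw [sum_smul_apply]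
  have h1 := congrFun (hF (pr t.1) t.2) ⟨t.1, hyV _ _⟩
  rw [sum_smul_apply] at h1
  refine Eq.trans (Finset.sum_congr rfl fun a _ => ?_) h1
  exact congrArg (· * _) (hg a ⟨pr t.1, t.2⟩)

/-- A sheaf that is generated by local generators is free on a family of generators that are
linearly independent and generate the others near each point. -/
theorem generatedSheaf_eq_span [IsManifold 𝓘(ℂ, Fin n → ℂ) ω Y] {pr : T → Y}
    {G : Set (Opens Y × (T → ℂ))} {A : Type*} [Finite A] {e : A → T → ℂ} {D U : Opens Y}
    (hU : U ≤ D) (he : ∀ a, (D, e a) ∈ G)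
    (hli : ∀ V : Opens Y, V ≤ D → LinearIndependent (Hol n V) (fun a => LocFun.of pr (e a) V))
    (hG : ∀ g ∈ G, ∀ y ∈ D, y ∈ g.1 → GermSpan n pr y (Set.range e) g.2) :
    generatedSheaf n pr G U =
      Submodule.span (Hol n U) (Set.range fun a => LocFun.of pr (e a) U) := by
  have hr : ∀ V : Opens Y, (Set.range fun a => LocFun.of pr (e a) V) =
      (fun b => LocFun.of pr b V) '' Set.range e := fun V => by
    rw [← Set.range_comp]; rfl
  refine le_antisymm (fun s hs => ?_) (Submodule.span_le.2 ?_)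
  · refine mem_span_of_local (fun V hV => hli V (hV.trans hU)) fun y hy => ?_
    obtain ⟨V, hyV, hVU, hV⟩ := hs y hy
    refine ⟨V, hyV, hVU, Submodule.span_le.2 ?_ hV⟩
    rintro _ ⟨D', f, hf, hVD', rfl⟩
    -- A second localization: a generator defined over all of `V` is known to be a combination of
    -- the frame only near each point of `V`.
    refine mem_span_of_local (fun W hW => hli W (hW.trans (hVU.trans hU))) fun y' hy' => ?_
    obtain ⟨W, hyW, hW⟩ := (hG _ hf y' (hU (hVU hy')) (hVD' hy')).exists_mem_span
    refine ⟨W ⊓ V, ⟨hyW, hy'⟩, inf_le_right, ?_⟩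
    rw [hr]
    exact hW _ inf_le_left
  · rintro _ ⟨a, rfl⟩
    exact of_mem_generatedSheaf (he a) hU

end Germs

/-! ### Taylor coefficients of composite functions -/

section Taylor

/-- The `j`th Taylor coefficient at `0`. -/
def taylorCoeff (j : ℕ) (f : ℂ → ℂ) : ℂ := iteratedDeriv j f 0 / (j.factorial : ℂ)

theorem taylorCoeff_zero (f : ℂ → ℂ) : taylorCoeff 0 f = f 0 := by simp [taylorCoeff]

theorem taylorCoeff_congr {j : ℕ} {f g : ℂ → ℂ} (h : f =ᶠ[𝓝 0] g) :
    taylorCoeff j f = taylorCoeff j g := by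
  rw [taylorCoeff, taylorCoeff, h.iteratedDeriv_eq]

theorem taylorCoeff_succ (j : ℕ) (f : ℂ → ℂ) :
    ((j : ℂ) + 1) * taylorCoeff (j + 1) f = taylorCoeff j (deriv f) := by
  have h1 : (j.factorial : ℂ) ≠ 0 := by exact_mod_cast j.factorial_ne_zero
  have h2 : (j : ℂ) + 1 ≠ 0 := by exact_mod_cast j.succ_ne_zero
  rw [taylorCoeff, taylorCoeff, iteratedDeriv_succ', Nat.factorial_succ]
  push_cast
  field_simp

theorem taylorCoeff_sum {κ : Type*} (L : Finset κ) (j : ℕ) {f : κ → ℂ → ℂ}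
    (hf : ∀ i ∈ L, AnalyticAt ℂ (f i) 0) :
    taylorCoeff j (fun t => ∑ i ∈ L, f i t) = ∑ i ∈ L, taylorCoeff j (f i) := by
  simp only [taylorCoeff]
  rw [iteratedDeriv_fun_sum fun i hi => (hf i hi).contDiffAt, Finset.sum_div]

theorem taylorCoeff_mul (j : ℕ) {f g : ℂ → ℂ} (hf : AnalyticAt ℂ f 0) (hg : AnalyticAt ℂ g 0) :
    taylorCoeff j (fun t => f t * g t) =
      ∑ i ∈ Finset.range (j + 1), taylorCoeff i f * taylorCoeff (j - i) g := by
  rw [taylorCoeff, iteratedDeriv_fun_mul hf.contDiffAt hg.contDiffAt, Finset.sum_div]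
  refine Finset.sum_congr rfl fun i hi => ?_
  have hij : i ≤ j := Nat.lt_succ_iff.1 (Finset.mem_range.1 hi)
  have h1 : (j.factorial : ℂ) ≠ 0 := by exact_mod_cast j.factorial_ne_zero
  have h2 : (i.factorial : ℂ) ≠ 0 := by exact_mod_cast i.factorial_ne_zero
  have h3 : ((j - i).factorial : ℂ) ≠ 0 := by exact_mod_cast (j - i).factorial_ne_zero
  rw [taylorCoeff, taylorCoeff, Nat.cast_choose ℂ hij]
  field_simp

variable {n : ℕ}

theorem fderiv_apply_eq_sum (g : (Fin n → ℂ) → ℂ) (x v : Fin n → ℂ) :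
    fderiv ℂ g x v = ∑ r, fderiv ℂ g x (Pi.single r 1) * v r := by
  conv_lhs => rw [pi_eq_sum_univ' v, map_sum]
  refine Finset.sum_congr rfl fun r _ => ?_
  rw [map_smul, smul_eq_mul, mul_comm]

theorem analyticAt_fderiv_single {g : (Fin n → ℂ) → ℂ} {x : Fin n → ℂ} (hg : AnalyticAt ℂ g x)
    (r : Fin n) : AnalyticAt ℂ (fun x => fderiv ℂ g x (Pi.single r 1)) x :=
  (ContinuousLinearMap.apply ℂ ℂ (Pi.single r (1 : ℂ) : Fin n → ℂ)).analyticAt _ |>.fun_comp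
    hg.fderiv

/-- The Taylor coefficients of `g ∘ γ` in terms of those of `γ` and of the partial derivatives of
`g`. -/
theorem taylorCoeff_comp_succ (j : ℕ) {g : (Fin n → ℂ) → ℂ} {γ : ℂ → Fin n → ℂ}
    (hγ : AnalyticAt ℂ γ 0) (hg : AnalyticAt ℂ g (γ 0)) :
    taylorCoeff (j + 1) (fun t => g (γ t)) =
      fderiv ℂ g (γ 0) (fun r => taylorCoeff (j + 1) fun t => γ t r) +
      ∑ r, ∑ i ∈ Finset.range j, (((j - i : ℕ) : ℂ) / ((j : ℂ) + 1)) *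
        (taylorCoeff (i + 1) (fun t => fderiv ℂ g (γ t) (Pi.single r 1)) *
          taylorCoeff (j - i) fun t => γ t r) := by
  have h2 : (j : ℂ) + 1 ≠ 0 := by exact_mod_cast j.succ_ne_zero
  have hγr : ∀ r, AnalyticAt ℂ (fun t => γ t r) 0 := fun r =>
    ((ContinuousLinearMap.proj (R := ℂ) (φ := fun _ : Fin n => ℂ) r).analyticAt _).fun_comp hγ
  have hd : deriv (fun t => g (γ t)) =ᶠ[𝓝 0]
      fun t => ∑ r, fderiv ℂ g (γ t) (Pi.single r 1) * deriv (fun t => γ t r) t := by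
    filter_upwards [hγ.eventually_analyticAt,
      hγ.continuousAt.eventually hg.eventually_analyticAt] with t h1 h2
    have h3 := h2.differentiableAt.hasFDerivAt.comp_hasDerivAt t h1.differentiableAt.hasDerivAt
    rw [show (fun t => g (γ t)) = g ∘ γ from rfl, h3.deriv, fderiv_apply_eq_sum]
    refine Finset.sum_congr rfl fun r _ => ?_
    rw [(hasDerivAt_pi.1 h1.differentiableAt.hasDerivAt r).deriv]
  have ha : ∀ r, AnalyticAt ℂ (fun t => fderiv ℂ g (γ t) (Pi.single r 1)) 0 := fun r =>
    (analyticAt_fderiv_single hg r).fun_comp hγ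
  refine mul_left_cancel₀ h2 ?_
  rw [taylorCoeff_succ, taylorCoeff_congr hd,
    taylorCoeff_sum _ _ fun r _ => (ha r).fun_mul (hγr r).deriv, mul_add, fderiv_apply_eq_sum,
    Finset.mul_sum, Finset.mul_sum, ← Finset.sum_add_distrib]
  refine Finset.sum_congr rfl fun r _ => ?_
  -- In the Leibniz expansion of `∂_r g(γ) · γ_r'`, the term with the undifferentiated `∂_r g(γ)` is
  -- the differential of `g`; every other term pairs positive orders `i + 1` and `j - i`.
  rw [taylorCoeff_mul _ (ha r) (hγr r).deriv, Finset.sum_range_succ', add_comm, taylorCoeff_zero,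
    Nat.sub_zero, ← taylorCoeff_succ, Finset.mul_sum]
  congr 1
  · ring
  · refine Finset.sum_congr rfl fun i hi => ?_
    have hij : i + 1 ≤ j := Finset.mem_range.1 hi
    obtain ⟨m, rfl⟩ := Nat.exists_eq_add_of_le hij
    rw [show i + 1 + m - (i + 1) = m by omega, show i + 1 + m - i = m + 1 by omega,
      ← taylorCoeff_succ]
    push_cast at h2 ⊢
    field_simp

end Taylor

/-! ### Profiles of exponents -/

section Profiles

variable {n k : ℕ}

theorem partialWeight_add (q : ℕ) (α β : MultiIndex n k) :
    partialWeight q (α + β) = partialWeight q α + partialWeight q β := by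
  simp only [partialWeight, ← Finset.sum_add_distrib]
  refine Finset.sum_congr rfl fun j _ => ?_
  split_ifs
  · rw [← Finset.sum_add_distrib]
    exact Finset.sum_congr rfl fun l _ => by simp [mul_add]
  · rfl

/-- The function `q ↦ ‖α‖_q`. -/
def profile (α : MultiIndex n k) : ℕ → ℕ := fun q => partialWeight q α

theorem profile_add (α β : MultiIndex n k) : profile (α + β) = profile α + profile β :=
  funext fun q => partialWeight_add q α β

theorem profile_zero : profile (0 : MultiIndex n k) = 0 := by
  funext q; simp [profile, partialWeight]

/-- The exponents of the monomial `jetCoord l (j + 1)`. -/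
def unitIndex (l : Fin n) (j : Fin k) : MultiIndex n k := Pi.single l (Pi.single j 1)

theorem unitIndex_apply (l l' : Fin n) (j j' : Fin k) :
    unitIndex l j l' j' = if l' = l then if j' = j then 1 else 0 else 0 := by
  by_cases h : l' = l
  · subst h; simp [unitIndex, Pi.single_apply]
  · simp [unitIndex, h]

/-- The profile of the jet coordinates of order `j`. -/
def jetProfile (j : ℕ) : ℕ → ℕ := fun q => if j ≤ q then j else 0

theorem jetProfile_zero : jetProfile 0 = 0 := by
  funext q; simp [jetProfile]

theorem profile_unitIndex (l : Fin n) (j : Fin k) :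
    profile (unitIndex l j) = jetProfile ((j : ℕ) + 1) := by
  funext q
  rw [profile, partialWeight, jetProfile, Finset.sum_eq_single j]
  · simp [unitIndex_apply]
  · intro j' _ hj
    simp [unitIndex_apply, hj]
  · simp

/-- A coordinate of order `i + j` counts only for `q ≥ i + j`, whereas factors of orders `i` and `j`
already count from `i` and `j` on. At `q = max i j < i + j` the product has full weight and the
single coordinate has none. -/
theorem jetProfile_add_lt {i j : ℕ} (hi : 0 < i) (hj : 0 < j) :
    jetProfile (i + j) < jetProfile i + jetProfile j := by
  refine Pi.lt_def.2 ⟨fun q => ?_, max i j, ?_⟩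
  · simp only [jetProfile, Pi.add_apply]
    split_ifs <;> omega
  · simp only [jetProfile, Pi.add_apply]
    split_ifs <;> omega

end Profiles

/-! ### Monomials in jet coordinates and Taylor coefficients along curves -/

section Monomials

variable {n : ℕ} {ι X Y : Type*}
  [TopologicalSpace X] [ChartedSpace (Fin n → ℂ) X]
  [TopologicalSpace Y] [ChartedSpace (Fin n → ℂ) Y]
  {Δ : OrbifoldDivisor n ι X} {π : Y → X} {k : ℕ}

namespace AdaptedChart

theorem monomial_add (c : AdaptedChart Δ π) (α β : MultiIndex n k) :
    c.monomial (α + β) = c.monomial α * c.monomial β := by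
  funext q
  simp only [monomial, Pi.mul_apply, ← Finset.prod_mul_distrib, Pi.add_apply, pow_add]

theorem monomial_zero (c : AdaptedChart Δ π) : c.monomial (0 : MultiIndex n k) = 1 := by
  funext q
  simp [monomial]

theorem monomial_unitIndex (c : AdaptedChart Δ π) (l : Fin n) (j : Fin k) :
    c.monomial (unitIndex l j) = c.jetCoord l ((j : ℕ) + 1) := by
  funext q
  rw [monomial, Finset.prod_eq_single l, Finset.prod_eq_single j]
  · simp [unitIndex_apply]
  · intro j' _ hj
    simp [unitIndex_apply, hj]
  · simp
  · intro l' _ hl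
    simp [unitIndex_apply, hl]
  · simp

/-- Monomials with profile at least `v` and total weight `v k`. -/
def monosGE (c : AdaptedChart Δ π) (k : ℕ) (v : ℕ → ℕ) : Set (JetPoint Δ π → ℂ) :=
  {f | ∃ α : MultiIndex n k, v ≤ profile α ∧ totalWeight α = v k ∧ f = c.monomial α}

/-- Monomials with profile greater than `v` and total weight `v k`. -/
def monosGT (c : AdaptedChart Δ π) (k : ℕ) (v : ℕ → ℕ) : Set (JetPoint Δ π → ℂ) :=
  {f | ∃ α : MultiIndex n k, v < profile α ∧ totalWeight α = v k ∧ f = c.monomial α}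

variable (c : AdaptedChart Δ π) {v v' : ℕ → ℕ}

theorem monosGT_subset_monosGE : c.monosGT k v ⊆ c.monosGE k v :=
  fun _ ⟨α, h, h', hf⟩ => ⟨α, h.le, h', hf⟩

theorem monosGE_subset_monosGT (h : v < v') (hk : v k = v' k) : c.monosGE k v' ⊆ c.monosGT k v :=
  fun _ ⟨α, h1, h2, hf⟩ => ⟨α, h.trans_le h1, h2.trans hk.symm, hf⟩

theorem totalWeight_add (α β : MultiIndex n k) :
    totalWeight (α + β) = totalWeight α + totalWeight β := partialWeight_add k α β

theorem mul_mem_monosGE {f f' : JetPoint Δ π → ℂ} (hf : f ∈ c.monosGE k v)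
    (hf' : f' ∈ c.monosGE k v') : f * f' ∈ c.monosGE k (v + v') := by
  obtain ⟨α, h1, h2, rfl⟩ := hf
  obtain ⟨β, h3, h4, rfl⟩ := hf'
  exact ⟨α + β, by rw [profile_add]; exact add_le_add h1 h3,
    by rw [totalWeight_add, h2, h4]; rfl, (c.monomial_add α β).symm⟩

theorem mul_mem_monosGT {f f' : JetPoint Δ π → ℂ} (hf : f ∈ c.monosGT k v)
    (hf' : f' ∈ c.monosGE k v') : f * f' ∈ c.monosGT k (v + v') := by
  obtain ⟨α, h1, h2, rfl⟩ := hf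
  obtain ⟨β, h3, h4, rfl⟩ := hf'
  exact ⟨α + β, by rw [profile_add]; exact add_lt_add_of_lt_of_le h1 h3,
    by rw [totalWeight_add, h2, h4]; rfl, (c.monomial_add α β).symm⟩

theorem jetCoord_mem_monosGE (l : Fin n) {j : ℕ} (h0 : 0 < j) (hj : j ≤ k) :
    c.jetCoord l j ∈ c.monosGE k (jetProfile j) := by
  obtain ⟨j, rfl⟩ := Nat.exists_eq_succ_of_ne_zero h0.ne'
  have h := profile_unitIndex l (⟨j, hj⟩ : Fin k)
  exact ⟨unitIndex l ⟨j, hj⟩, h.ge, congrFun h k, (c.monomial_unitIndex l ⟨j, hj⟩).symm⟩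

theorem one_mem_monosGE : (1 : JetPoint Δ π → ℂ) ∈ c.monosGE k 0 :=
  ⟨0, profile_zero.ge, congrFun profile_zero k, c.monomial_zero.symm⟩

/-! ### Coordinates of curves -/

/-- Off the divisor, `w_l = 0` forces `z_l = 0`, so this hyperplane carries no label and its
generator has no pole. -/
theorem w_eq_zero_of_poleOrder (l : Fin n) {y : Y} (hy : y ∈ c.domain)
    (hoff : ∀ i, π y ∉ Δ.comp i) (h : c.w y l = 0) : c.poleOrder l = 0 := by
  cases hl : c.label l with
  | none => simp [poleOrder, hl]
  | some i =>
    refine absurd ?_ (hoff i)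
    rw [c.isLabelling i _ (c.mapsTo hy)]
    refine ⟨l, hl, ?_⟩
    rw [c.z_eq y hy, h, zero_pow (c.p_pos l).ne']

/-- On unlabelled hyperplanes the power is `0 ^ 0 = 1`. Hence the normalizing factors can be
cancelled at every tangent vector or jet off the divisor, even where a coordinate vanishes. -/
theorem w_pow_poleOrder_ne_zero (l : Fin n) {y : Y} (hy : y ∈ c.domain)
    (hoff : ∀ i, π y ∉ Δ.comp i) : c.w y l ^ c.poleOrder l ≠ 0 := by
  by_cases h : c.w y l = 0
  · simp [c.w_eq_zero_of_poleOrder l hy hoff h]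
  · exact pow_ne_zero _ h

theorem contMDiffAt_w (l : Fin n) {y : Y} (hy : y ∈ c.domain) :
    ContMDiffAt 𝓘(ℂ, Fin n → ℂ) 𝓘(ℂ) ω (fun y => c.w y l) y :=
  contMDiffAt_pi_space.1 (contMDiffAt_of_mem_maximalAtlas c.w_mem hy) l

/-- Regularity of `π` is not assumed; it is read off from `z_l = w_l ^ p_l`. -/
theorem contMDiffAt_z_comp {y : Y} (hy : y ∈ c.domain) :
    ContMDiffAt 𝓘(ℂ, Fin n → ℂ) 𝓘(ℂ, Fin n → ℂ) ω (fun y => c.z (π y)) y := by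
  refine contMDiffAt_pi_space.2 fun l => ?_
  have h1 : ContMDiffAt 𝓘(ℂ, Fin n → ℂ) 𝓘(ℂ) ω (fun y => c.w y l ^ c.p l) y :=
    ((contDiff_id.pow (c.p l)).contMDiff.contMDiffAt (x := c.w y l)).comp y (c.contMDiffAt_w l hy)
  refine h1.congr_of_eventuallyEq ?_
  filter_upwards [c.w.open_source.mem_nhds hy] with y' hy' using c.z_eq y' hy' l

theorem contMDiffAt_comp_z {g : (Fin n → ℂ) → ℂ} {y : Y} (hy : y ∈ c.domain)
    (hg : AnalyticAt ℂ g (c.z (π y))) :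
    ContMDiffAt 𝓘(ℂ, Fin n → ℂ) 𝓘(ℂ) ω (fun y => g (c.z (π y))) y :=
  (hg.contDiffAt.contMDiffAt).comp y (c.contMDiffAt_z_comp hy)

theorem analyticAt_curve {q : JetPoint Δ π} (hq : q.pt ∈ c.domain) :
    AnalyticAt ℂ (fun t => c.z (q.curve t)) 0 := by
  have h1 : ContMDiffAt 𝓘(ℂ, Fin n → ℂ) 𝓘(ℂ, Fin n → ℂ) ω c.z (q.curve 0) := by
    rw [q.base]; exact contMDiffAt_of_mem_maximalAtlas c.z_mem (c.mapsTo hq)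
  exact (h1.comp 0 q.holomorphic).contDiffAt.analyticAt

/-- The vector of the `j`th Taylor coefficients of the coordinates `z_l` along a curve. -/
def coordTaylor (j : ℕ) (q : JetPoint Δ π) : Fin n → ℂ :=
  fun r => taylorCoeff j fun t => c.z (q.curve t) r

theorem jetCoord_eq (l : Fin n) (j : ℕ) (q : JetPoint Δ π) :
    c.jetCoord l j q = (c.w q.pt l ^ (c.trunc j).poleOrder l)⁻¹ * c.coordTaylor j q l := rfl

theorem coordTaylor_eq (l : Fin n) (j : ℕ) {q : JetPoint Δ π} (hq : q.pt ∈ c.domain) :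
    c.coordTaylor j q l = c.w q.pt l ^ (c.trunc j).poleOrder l * c.jetCoord l j q := by
  rw [jetCoord_eq, mul_inv_cancel_left₀]
  exact (c.trunc j).w_pow_poleOrder_ne_zero l hq q.off

theorem contMDiffAt_w_pow (l : Fin n) (m : ℕ) {y : Y} (hy : y ∈ c.domain) :
    ContMDiffAt 𝓘(ℂ, Fin n → ℂ) 𝓘(ℂ) ω (fun y => c.w y l ^ m) y :=
  ((contDiff_id.pow m).contMDiff.contMDiffAt (x := c.w y l)).comp y (c.contMDiffAt_w l hy)

variable {y₀ : Y}

theorem germSpan_jetCoord (l : Fin n) {j : ℕ} (h0 : 0 < j) (hj : j ≤ k) :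
    GermSpan n JetPoint.pt y₀ (c.monosGE k (jetProfile j)) (c.jetCoord l j) :=
  .gen (c.jetCoord_mem_monosGE l h0 hj)

theorem germSpan_coordTaylor (hy : y₀ ∈ c.domain) (l : Fin n) {j : ℕ} (h0 : 0 < j) (hj : j ≤ k) :
    GermSpan n JetPoint.pt y₀ (c.monosGE k (jetProfile j)) (fun q => c.coordTaylor j q l) :=
  ((c.germSpan_jetCoord l h0 hj).smul (c.contMDiffAt_w_pow l _ hy)).congr_on hy
    fun _ hq => (c.coordTaylor_eq l j hq).symm

theorem germSpan_fderiv (hy : y₀ ∈ c.domain) {g : (Fin n → ℂ) → ℂ}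
    (hg : AnalyticAt ℂ g (c.z (π y₀))) {j : ℕ} (h0 : 0 < j) (hj : j ≤ k) :
    GermSpan n JetPoint.pt y₀ (c.monosGE k (jetProfile j))
      (fun q => fderiv ℂ g (c.z (π q.pt)) (c.coordTaylor j q)) := by
  have : (fun q : JetPoint Δ π => fderiv ℂ g (c.z (π q.pt)) (c.coordTaylor j q)) = fun q =>
      ∑ r, fderiv ℂ g (c.z (π q.pt)) (Pi.single r 1) * c.coordTaylor j q r :=
    funext fun q => fderiv_apply_eq_sum _ _ _
  rw [this]
  exact GermSpan.sum _ fun r _ => (c.germSpan_coordTaylor hy r h0 hj).smul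
    (f := fun y => fderiv ℂ g (c.z (π y)) (Pi.single r 1))
    (c.contMDiffAt_comp_z hy (analyticAt_fderiv_single hg r))

theorem eventually_analyticAt (hy : y₀ ∈ c.domain) {g : (Fin n → ℂ) → ℂ}
    (hg : AnalyticAt ℂ g (c.z (π y₀))) :
    ∀ᶠ y in 𝓝 y₀, y ∈ c.domain ∧ AnalyticAt ℂ g (c.z (π y)) :=
  Filter.Eventually.and (c.w.open_source.mem_nhds hy)
    ((c.contMDiffAt_z_comp hy).continuousAt.eventually hg.eventually_analyticAt)

/-- The profile of the product exceeds that of a coordinate of order `i + j`, while `i + j ≤ k`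
keeps the total weights at `q = k` equal. -/
theorem germSpan_mul_of_pos {i j : ℕ} (hi : 0 < i) (hj : 0 < j) (hij : i + j ≤ k)
    {s s' : JetPoint Δ π → ℂ} (hs : GermSpan n JetPoint.pt y₀ (c.monosGE k (jetProfile i)) s)
    (hs' : GermSpan n JetPoint.pt y₀ (c.monosGE k (jetProfile j)) s') :
    GermSpan n JetPoint.pt y₀ (c.monosGT k (jetProfile (i + j))) (s * s') := by
  refine (hs.mul (fun _ h _ h' => c.mul_mem_monosGE h h') hs').mono
    (c.monosGE_subset_monosGT (jetProfile_add_lt hi hj) ?_)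
  simp only [jetProfile, Pi.add_apply]
  split_ifs <;> omega

/-- The Taylor coefficients of `g` along curves are, up to products of jet coordinates of lower
order, given by the differential of `g`. -/
theorem germSpan_taylorCoeff (hy : y₀ ∈ c.domain) (j : ℕ) (hj : j ≤ k) (g : (Fin n → ℂ) → ℂ)
    (hg : AnalyticAt ℂ g (c.z (π y₀))) :
    GermSpan n JetPoint.pt y₀ (c.monosGE k (jetProfile j))
      (fun q : JetPoint Δ π => taylorCoeff j fun t => g (c.z (q.curve t))) ∧
    (0 < j → GermSpan n JetPoint.pt y₀ (c.monosGT k (jetProfile j))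
      (fun q : JetPoint Δ π => taylorCoeff j (fun t => g (c.z (q.curve t))) -
        fderiv ℂ g (c.z (π q.pt)) (c.coordTaylor j q))) := by
  -- The function `g` must vary, since the recursion for order `j + 1` uses lower Taylor
  -- coefficients of the partial derivatives of `g`.
  induction j using Nat.strong_induction_on generalizing g with
  | _ j ih =>
  cases j with
  | zero =>
    refine ⟨?_, fun h => absurd h (lt_irrefl 0)⟩
    rw [jetProfile_zero]
    refine ((GermSpan.gen c.one_mem_monosGE).smul (c.contMDiffAt_comp_z hy hg)).congr
      (Eventually.of_forall fun y q _ => ?_)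
    simp [taylorCoeff_zero, q.base]
  | succ j =>
    have key : GermSpan n JetPoint.pt y₀ (c.monosGT k (jetProfile (j + 1)))
      (fun q : JetPoint Δ π => taylorCoeff (j + 1) (fun t => g (c.z (q.curve t))) -
        fderiv ℂ g (c.z (π q.pt)) (c.coordTaylor (j + 1) q)) := by
      have h1 : GermSpan n JetPoint.pt y₀ (c.monosGT k (jetProfile (j + 1)))
          (fun q : JetPoint Δ π =>
            ∑ r, ∑ i ∈ Finset.range j, (((j - i : ℕ) : ℂ) / ((j : ℂ) + 1)) *
              (taylorCoeff (i + 1) (fun t => fderiv ℂ g (c.z (q.curve t)) (Pi.single r 1)) *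
                c.coordTaylor (j - i) q r)) := by
        refine GermSpan.sum _ fun r _ => GermSpan.sum _ fun i hi => GermSpan.const_mul _ ?_
        have hi' := Finset.mem_range.1 hi
        have := c.germSpan_mul_of_pos (i := i + 1) (j := j - i) (by omega) (by omega) (by omega)
          (ih (i + 1) (by omega) (by omega) _ (analyticAt_fderiv_single hg r)).1
          (c.germSpan_coordTaylor hy r (by omega) (by omega))
        rwa [show i + 1 + (j - i) = j + 1 by omega] at this
      refine h1.congr ?_
      filter_upwards [c.eventually_analyticAt hy hg] with y hy' q hq
      subst hq
      have hγ := c.analyticAt_curve hy'.1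
      have h0 : c.z (q.curve 0) = c.z (π q.pt) := by rw [q.base]
      rw [taylorCoeff_comp_succ j hγ (by rw [h0]; exact hy'.2), h0]
      exact (add_sub_cancel_left _ _).symm
    refine ⟨?_, fun _ => key⟩
    convert (key.mono c.monosGT_subset_monosGE).add
      (c.germSpan_fderiv hy hg (Nat.succ_pos j) hj) using 1
    funext q
    simp

end AdaptedChart

end Monomials

/-! ### Change of adapted coordinates for forms and jets -/

section Transition

variable {n : ℕ} {ι X Y : Type*}
  [TopologicalSpace X] [ChartedSpace (Fin n → ℂ) X]
  [TopologicalSpace Y] [ChartedSpace (Fin n → ℂ) Y]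
  {Δ : OrbifoldDivisor n ι X} {π : Y → X} {k : ℕ}

theorem mfderiv_transition {M : Type*} [TopologicalSpace M] [ChartedSpace (Fin n → ℂ) M]
    {z z' : OpenPartialHomeomorph M (Fin n → ℂ)}
    (hz : z ∈ IsManifold.maximalAtlas 𝓘(ℂ, Fin n → ℂ) ω M)
    (hz' : z' ∈ IsManifold.maximalAtlas 𝓘(ℂ, Fin n → ℂ) ω M) {x : M} (hx : x ∈ z.source)
    (hx' : x ∈ z'.source) (ξ : TangentSpace 𝓘(ℂ, Fin n → ℂ) x) (l : Fin n) :
    (mfderiv 𝓘(ℂ, Fin n → ℂ) 𝓘(ℂ, Fin n → ℂ) z' x ξ : Fin n → ℂ) l =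
      fderiv ℂ (fun a => z' (z.symm a) l) (z x)
        (mfderiv 𝓘(ℂ, Fin n → ℂ) 𝓘(ℂ, Fin n → ℂ) z x ξ : Fin n → ℂ) := by
  have h1 : HasMFDerivAt 𝓘(ℂ, Fin n → ℂ) 𝓘(ℂ, Fin n → ℂ) z x
      (mfderiv 𝓘(ℂ, Fin n → ℂ) 𝓘(ℂ, Fin n → ℂ) z x) :=
    ((contMDiffAt_of_mem_maximalAtlas hz hx).mdifferentiableAt (by simp)).hasMFDerivAt
  have h2 : HasFDerivAt (fun a => z' (z.symm a)) (fderiv ℂ (fun a => z' (z.symm a)) (z x)) (z x) :=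
    (analyticAt_transition hz' hz hx' hx).differentiableAt.hasFDerivAt
  have h3 := h2.hasMFDerivAt.comp x h1
  have h4 : z' =ᶠ[𝓝 x] (fun a => z' (z.symm a)) ∘ z := by
    filter_upwards [z.open_source.mem_nhds hx] with y hy
    simp [z.left_inv hy]
  have h5 := (h3.congr_of_eventuallyEq h4).mfderiv
  rw [h5, (hasFDerivAt_pi'.1 h2 l).fderiv]
  rfl

theorem mfderiv_symm_apply {M : Type*} [TopologicalSpace M] [ChartedSpace (Fin n → ℂ) M]
    {z : OpenPartialHomeomorph M (Fin n → ℂ)}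
    (hz : z ∈ IsManifold.maximalAtlas 𝓘(ℂ, Fin n → ℂ) ω M) {x : M} (hx : x ∈ z.source)
    (v : Fin n → ℂ) :
    (mfderiv 𝓘(ℂ, Fin n → ℂ) 𝓘(ℂ, Fin n → ℂ) z x
      (mfderiv 𝓘(ℂ, Fin n → ℂ) 𝓘(ℂ, Fin n → ℂ) z.symm (z x) v : Fin n → ℂ) : Fin n → ℂ) = v := by
  have h1 : HasMFDerivAt 𝓘(ℂ, Fin n → ℂ) 𝓘(ℂ, Fin n → ℂ) z (z.symm (z x))
      (mfderiv 𝓘(ℂ, Fin n → ℂ) 𝓘(ℂ, Fin n → ℂ) z (z.symm (z x))) :=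
    ((contMDiffAt_of_mem_maximalAtlas hz (by rwa [z.left_inv hx])).mdifferentiableAt
      (by simp)).hasMFDerivAt
  have h2 : HasMFDerivAt 𝓘(ℂ, Fin n → ℂ) 𝓘(ℂ, Fin n → ℂ) z.symm (z x)
      (mfderiv 𝓘(ℂ, Fin n → ℂ) 𝓘(ℂ, Fin n → ℂ) z.symm (z x)) :=
    ((contMDiffAt_symm_of_mem_maximalAtlas hz (z.map_source hx)).mdifferentiableAt
      (by simp)).hasMFDerivAt
  have h3 := h1.comp (z x) h2
  have h4 : z ∘ z.symm =ᶠ[𝓝 (z x)] id := by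
    filter_upwards [z.open_target.mem_nhds (z.map_source hx)] with y hy
    simp [z.right_inv hy]
  have h5 := (h3.congr_of_eventuallyEq h4.symm).mfderiv
  rw [mfderiv_id] at h5
  have h6 := DFunLike.congr_fun h5 v
  rw [z.left_inv hx] at h6
  exact h6.symm

namespace AdaptedChart

variable (c c' : AdaptedChart Δ π) {y₀ : Y}

theorem continuousAt_π (hy : y₀ ∈ c.domain) : ContinuousAt π y₀ := by
  have h1 : ContinuousAt (fun y => c.z.symm (c.z (π y))) y₀ :=
    ContinuousAt.comp (g := c.z.symm) (c.z.continuousAt_symm (c.z.map_source (c.mapsTo hy)))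
      (c.contMDiffAt_z_comp hy).continuousAt
  refine h1.congr ?_
  filter_upwards [c.w.open_source.mem_nhds hy] with y hy' using c.z.left_inv (c.mapsTo hy')

/-- The coordinates that vanish along components of the divisor agree up to units in any two
adapted charts. -/
theorem exists_unit_of_label (hy : y₀ ∈ c.domain) (hy' : y₀ ∈ c'.domain) {l : Fin n} {i : ι}
    (hl : c'.label l = some i) (h0 : c'.w y₀ l = 0) :
    ∃ s, c.label s = some i ∧ c.p s = c'.p l ∧
      (∃ u : (Fin n → ℂ) → ℂ, AnalyticAt ℂ u (c.z (π y₀)) ∧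
        ∀ᶠ a in 𝓝 (c.z (π y₀)), c'.z (c.z.symm a) l = a s * u a) ∧
      ∃ v : Y → ℂ, ContMDiffAt 𝓘(ℂ, Fin n → ℂ) 𝓘(ℂ) ω v y₀ ∧ v y₀ ≠ 0 ∧
        ∀ᶠ y in 𝓝 y₀, c.w y s = c'.w y l * v y := by
  classical
  have hx := c.mapsTo hy
  have hx' := c'.mapsTo hy'
  have hz0 : c'.z (π y₀) l = 0 := by rw [c'.z_eq y₀ hy', h0, zero_pow (c'.p_pos l).ne']
  -- Near `π y₀` the hyperplane `z'_l = 0` lies in `Δ_i`, which in the other chart is the union of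
  -- the hyperplanes labelled `i`; it must lie in one of them.
  obtain ⟨s, hs, U, hU, hU0, hzU⟩ := exists_coord_eq_mul c.z_mem c'.z_mem hx hx' hz0
    (Finset.univ.filter fun s => c.label s = some i) (by
      filter_upwards [c.z.open_source.mem_nhds hx, c'.z.open_source.mem_nhds hx'] with x h1 h2 h3
      obtain ⟨s, hs, hs0⟩ := (c.isLabelling i x h1).1 ((c'.isLabelling i x h2).2 ⟨l, hl, h3⟩)
      exact ⟨s, by simpa using hs, hs0⟩)
  have hs : c.label s = some i := by simpa using hs
  have hπ := c.continuousAt_π hy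
  have hwU : ∀ᶠ y in 𝓝 y₀, c.w y s ^ c.p s = c'.w y l ^ c'.p l * U (c'.z (π y)) := by
    filter_upwards [hπ.eventually hzU, c.w.open_source.mem_nhds hy,
      c'.w.open_source.mem_nhds hy'] with y h1 h2 h3
    rwa [c.z_eq y h2, c'.z_eq y h3] at h1
  -- The relation between the powers shows that `w_s` vanishes where `w'_l` does. The same argument
  -- upstairs, with `s` as the only candidate, compares `w_s` and `w'_l` without extracting roots.
  obtain ⟨s', hs', V, hV, hV0, hwV⟩ := exists_coord_eq_mul c.w_mem c'.w_mem hy hy' h0 {s} (by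
    filter_upwards [hwU] with y h1 h2
    refine ⟨s, by simp, ?_⟩
    rw [h2, zero_pow (c'.p_pos l).ne', zero_mul] at h1
    exact pow_eq_zero_iff (c.p_pos s).ne' |>.1 h1)
  rw [Finset.mem_singleton] at hs'
  subst hs'
  have hv : ContMDiffAt 𝓘(ℂ, Fin n → ℂ) 𝓘(ℂ) ω (fun y => V (c'.w y)) y₀ :=
    hV.contDiffAt.contMDiffAt.comp y₀ (contMDiffAt_of_mem_maximalAtlas c'.w_mem hy')
  have hUc : ContinuousAt (fun y => U (c'.z (π y))) y₀ :=
    (c'.contMDiffAt_comp_z hy' hU).continuousAt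
  have hwc : ContinuousAt (fun y => c'.w y l) y₀ := (c'.contMDiffAt_w l hy').continuousAt
  have hfr : ∃ᶠ y in 𝓝 y₀, c'.w y l ≠ 0 ∧
      c'.w y l ^ c.p s' * V (c'.w y) ^ c.p s' = c'.w y l ^ c'.p l * U (c'.z (π y)) := by
    refine ((frequently_coord_ne_zero hy').and_eventually (hwU.and hwV)).mono ?_
    rintro y ⟨h1, h2, h3⟩
    refine ⟨h1 l, ?_⟩
    rw [← h2, h3, mul_pow]
  refine ⟨s', hs, ?_, ⟨fun a => (U (c'.z (c.z.symm a)))⁻¹, ?_, ?_⟩, fun y => V (c'.w y), hv, hV0, hwV⟩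
  -- If the exponents differed, cancelling the smaller power of `w'_l` at the dense set of points
  -- where it is nonzero and passing to `y₀` would make a unit vanish there.
  · rcases lt_trichotomy (c.p s') (c'.p l) with h | h | h
    · exfalso
      obtain ⟨m, hm⟩ := Nat.exists_eq_add_of_lt h
      have h1 : ContinuousAt (fun y => V (c'.w y) ^ c.p s' -
          c'.w y l ^ (m + 1) * U (c'.z (π y))) y₀ :=
        (hv.continuousAt.pow _).sub ((hwc.pow _).mul hUc)
      have h2 := h1.eventually_ne (y := 0) (by simp [h0, hV0])
      obtain ⟨y, ⟨h3, h4⟩, h5⟩ := (hfr.and_eventually h2).exists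
      refine h5 (sub_eq_zero.2 (mul_left_cancel₀ (pow_ne_zero (c.p s') h3) ?_))
      rw [h4, hm]; ring
    · exact h
    · exfalso
      obtain ⟨m, hm⟩ := Nat.exists_eq_add_of_lt h
      have h1 : ContinuousAt (fun y => c'.w y l ^ (m + 1) * V (c'.w y) ^ c.p s' -
          U (c'.z (π y))) y₀ :=
        ((hwc.pow _).mul (hv.continuousAt.pow _)).sub hUc
      have h2 := h1.eventually_ne (y := 0) (by simp [h0, hU0])
      obtain ⟨y, ⟨h3, h4⟩, h5⟩ := (hfr.and_eventually h2).exists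
      refine h5 (sub_eq_zero.2 (mul_left_cancel₀ (pow_ne_zero (c'.p l) h3) ?_))
      rw [← h4, hm]; ring
  · have h1 := analyticAt_transition c'.z_mem c.z_mem hx' hx
    have h2 : AnalyticAt ℂ U (c'.z (c.z.symm (c.z (π y₀)))) := by rwa [c.z.left_inv hx]
    exact (AnalyticAt.fun_comp (f := fun a => c'.z (c.z.symm a)) h2 h1).fun_inv (by rwa [c.z.left_inv hx])
  · have ht : Tendsto c.z.symm (𝓝 (c.z (π y₀))) (𝓝 (π y₀)) := c.z.tendsto_symm hx
    have hUx : ContinuousAt (fun x => U (c'.z x)) (π y₀) :=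
      ContinuousAt.comp (f := c'.z) hU.continuousAt (c'.z.continuousAt hx')
    filter_upwards [ht.eventually hzU, ht.eventually (hUx.eventually_ne hU0),
      c.z.open_target.mem_nhds (c.z.map_source hx)] with a h1 h2 h3
    rw [c.z.right_inv h3] at h1
    rw [h1, mul_inv_cancel_right₀ h2]

theorem poleOrder_eq_of_label {l s : Fin n} {i : ι} (hl : c'.label l = some i)
    (hs : c.label s = some i) (hp : c.p s = c'.p l) : c'.poleOrder l = c.poleOrder s := by
  simp [poleOrder, hl, hs, hp]

/-- This makes `z_s = w_s ^ p_s` divisible by the normalizing factor, so terms with the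
undifferentiated `z_s` acquire no poles. -/
theorem poleOrder_le_p (l : Fin n) : c.poleOrder l ≤ c.p l := by
  cases hl : c.label l with
  | none => simp [poleOrder, hl]
  | some i =>
    simp only [poleOrder, hl]
    exact (Nat.mul_le_mul_left _ (Nat.sub_le _ _)).trans (Nat.div_mul_le_self _ _)

/-- The coefficient of `Δ^(j)` decreases with `j`. This is why lower-order terms stay holomorphic:
dividing an unnormalized coordinate of order `i ≤ j` by the factor for order `j` leaves a
nonnegative power of `w_l`. -/
theorem poleOrder_trunc_antitone (l : Fin n) {i j : ℕ} (h : i ≤ j) :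
    (c.trunc j).poleOrder l ≤ (c.trunc i).poleOrder l := by
  cases hl : c.label l with
  | none => simp [poleOrder, trunc, hl]
  | some m =>
    simp only [poleOrder, trunc, hl, OrbifoldDivisor.trunc]
    exact Nat.mul_le_mul_left _ (Nat.sub_le_sub_left
      (min_le_min_right _ (Nat.mul_le_mul_right _ h)) _)

/-- The coordinate `z'_l` in terms of the coordinates `z`. -/
def zCoord (l : Fin n) (a : Fin n → ℂ) : ℂ := c'.z (c.z.symm a) l

theorem analyticAt_zCoord (hy : y₀ ∈ c.domain) (hy' : y₀ ∈ c'.domain) (l : Fin n) :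
    AnalyticAt ℂ (c.zCoord c' l) (c.z (π y₀)) :=
  analyticAt_transition_coord c'.z_mem c.z_mem (c'.mapsTo hy') (c.mapsTo hy) l

/-- Near a point, either the normalizing factor of `z'_l` is holomorphic, or `z'_l` agrees with one
of the coordinates `z_s` up to units. -/
theorem normalForm (hy : y₀ ∈ c.domain) (hy' : y₀ ∈ c'.domain) (l : Fin n) :
    (∀ j, ContMDiffAt 𝓘(ℂ, Fin n → ℂ) 𝓘(ℂ) ω
      (fun y => (c'.w y l ^ (c'.trunc j).poleOrder l)⁻¹) y₀ ∧
      ContMDiffAt 𝓘(ℂ, Fin n → ℂ) 𝓘(ℂ) ω (fun y => (c'.w y l ^ c'.poleOrder l)⁻¹) y₀) ∨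
    ∃ s, c'.poleOrder l = c.poleOrder s ∧
      (∀ j, (c'.trunc j).poleOrder l = (c.trunc j).poleOrder s) ∧
      (∃ u : (Fin n → ℂ) → ℂ, AnalyticAt ℂ u (c.z (π y₀)) ∧
        ∀ᶠ a in 𝓝 (c.z (π y₀)), c.zCoord c' l a = a s * u a) ∧
      ∃ v : Y → ℂ, ContMDiffAt 𝓘(ℂ, Fin n → ℂ) 𝓘(ℂ) ω v y₀ ∧
        ∀ᶠ y in 𝓝 y₀, ∀ e : ℕ, (c'.w y l ^ e)⁻¹ = v y ^ e * (c.w y s ^ e)⁻¹ := by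
  by_cases h : ∃ i, c'.label l = some i ∧ c'.w y₀ l = 0
  · right
    obtain ⟨i, hl, h0⟩ := h
    obtain ⟨s, hs, hp, hu, v, hv, hv0, hwv⟩ := c.exists_unit_of_label c' hy hy' hl h0
    refine ⟨s, c.poleOrder_eq_of_label c' hl hs hp,
      fun j => (c.trunc j).poleOrder_eq_of_label (c'.trunc j) hl hs hp, hu, v, hv, ?_⟩
    filter_upwards [hwv, hv.continuousAt.eventually_ne hv0] with y h1 h2 e
    rw [h1, mul_pow, mul_inv, mul_comm (c'.w y l ^ e)⁻¹, ← mul_assoc,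
      mul_inv_cancel₀ (pow_ne_zero _ h2), one_mul]
  · left
    have key : ∀ e : ℕ, (c'.w y₀ l ^ e ≠ 0) → ContMDiffAt 𝓘(ℂ, Fin n → ℂ) 𝓘(ℂ) ω
        (fun y => (c'.w y l ^ e)⁻¹) y₀ := fun e he =>
      ((contDiffAt_inv ℂ he).contMDiffAt).comp y₀ (c'.contMDiffAt_w_pow l e hy')
    -- Without a label the exponent is zero; with a label, `h` forces `w'_l ≠ 0` at `y₀`.
    have hne : ∀ (Δ' : OrbifoldDivisor n ι X) (d : AdaptedChart Δ' π), d.label = c'.label →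
        c'.w y₀ l ^ d.poleOrder l ≠ 0 := by
      intro Δ' d hd
      cases hl : c'.label l with
      | none => simp [poleOrder, hd, hl]
      | some i => exact pow_ne_zero _ fun h0 => h ⟨i, hl, h0⟩
    exact fun j => ⟨key _ (hne _ (c'.trunc j) rfl), key _ (hne _ c' rfl)⟩

/-! ### Change of adapted coordinates for forms -/

/-- The coordinates of a tangent vector. -/
def vecCoord (v : TangentPoint Δ π) : Fin n → ℂ :=
  mfderiv 𝓘(ℂ, Fin n → ℂ) 𝓘(ℂ, Fin n → ℂ) c.z (π v.pt) v.vec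

theorem form_eq (l : Fin n) (v : TangentPoint Δ π) :
    c.form l v = (c.w v.pt l ^ c.poleOrder l)⁻¹ * c.vecCoord v l := rfl

theorem vecCoord_eq (l : Fin n) {v : TangentPoint Δ π} (hv : v.pt ∈ c.domain) :
    c.vecCoord v l = c.w v.pt l ^ c.poleOrder l * c.form l v := by
  rw [form_eq, mul_inv_cancel_left₀]
  exact c.w_pow_poleOrder_ne_zero l hv v.off

theorem form_eq_fderiv (l : Fin n) {v : TangentPoint Δ π} (hv : v.pt ∈ c.domain)
    (hv' : v.pt ∈ c'.domain) :
    c'.form l v = (c'.w v.pt l ^ c'.poleOrder l)⁻¹ *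
      fderiv ℂ (c.zCoord c' l) (c.z (π v.pt)) (c.vecCoord v) := by
  rw [form_eq]
  congr 1
  exact mfderiv_transition c.z_mem c'.z_mem (c.mapsTo hv) (c'.mapsTo hv') v.vec l

theorem germSpan_form_fderiv (hy : y₀ ∈ c.domain) {g : (Fin n → ℂ) → ℂ}
    (hg : AnalyticAt ℂ g (c.z (π y₀))) :
    GermSpan n TangentPoint.pt y₀ (Set.range c.form)
      (fun v => fderiv ℂ g (c.z (π v.pt)) (c.vecCoord v)) := by
  have : (fun v : TangentPoint Δ π => fderiv ℂ g (c.z (π v.pt)) (c.vecCoord v)) = fun v =>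
      ∑ r, fderiv ℂ g (c.z (π v.pt)) (Pi.single r 1) * c.vecCoord v r :=
    funext fun v => fderiv_apply_eq_sum _ _ _
  rw [this]
  refine GermSpan.sum _ fun r _ => .smul
    (f := fun y => fderiv ℂ g (c.z (π y)) (Pi.single r 1))
    (c.contMDiffAt_comp_z hy (analyticAt_fderiv_single hg r)) ?_
  exact ((GermSpan.gen (Set.mem_range_self r)).smul (c.contMDiffAt_w_pow r _ hy)).congr_on hy
    fun _ hv => (c.vecCoord_eq r hv).symm

theorem fderiv_coord_mul {s : Fin n} {u : (Fin n → ℂ) → ℂ} {a : Fin n → ℂ}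
    (hu : AnalyticAt ℂ u a) {g : (Fin n → ℂ) → ℂ} (hg : g =ᶠ[𝓝 a] fun a => a s * u a)
    (v : Fin n → ℂ) : fderiv ℂ g a v = a s * fderiv ℂ u a v + u a * v s := by
  have h1 : HasFDerivAt (fun b : Fin n → ℂ => b s)
    (ContinuousLinearMap.proj (R := ℂ) (φ := fun _ : Fin n => ℂ) s) a :=
    (ContinuousLinearMap.proj (R := ℂ) (φ := fun _ : Fin n => ℂ) s).hasFDerivAt
  have h2 := h1.mul hu.differentiableAt.hasFDerivAt
  rw [(h2.congr_of_eventuallyEq hg).fderiv]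
  simp

/-- In two adapted charts, the generators of the orbifold cotangent sheaf are combinations of each
other. -/
theorem germSpan_form (hy : y₀ ∈ c.domain) (hy' : y₀ ∈ c'.domain) (l : Fin n) :
    GermSpan n TangentPoint.pt y₀ (Set.range c.form) (c'.form l) := by
  have hdom : ∀ᶠ y in 𝓝 y₀, y ∈ c.domain ∧ y ∈ c'.domain :=
    (c.domain ⊓ c'.domain).isOpen.mem_nhds ⟨hy, hy'⟩
  rcases c.normalForm c' hy hy' l with h | ⟨s, he, -, ⟨u, hu, hzu⟩, v, hv, hwv⟩
  · exact ((c.germSpan_form_fderiv hy (c.analyticAt_zCoord c' hy hy' l)).smul (h 0).2).congr_on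
      (D := c.domain ⊓ c'.domain) ⟨hy, hy'⟩ fun t ht => (c.form_eq_fderiv c' l ht.1 ht.2).symm
  · obtain ⟨m, hm⟩ := Nat.exists_eq_add_of_le (c.poleOrder_le_p s)
    -- With `e` the pole order and `p_s = e + m`, dividing `dz'_l = z_s du + u dz_s` by `w_s ^ e`
    -- gives `w_s ^ m du` plus `u` times the normalized generator. The remaining factor `v ^ e`
    -- comes from exchanging `w'_l` for `w_s`.
    have h1 := ((c.germSpan_form_fderiv hy hu).smul (c.contMDiffAt_w_pow s m hy)).add
      ((GermSpan.gen (Set.mem_range_self s)).smul (c.contMDiffAt_comp_z hy hu))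
    refine (h1.smul (((contDiff_id.pow (c.poleOrder s)).contMDiff.contMDiffAt (x := v y₀)).comp y₀
      hv)).congr ?_
    filter_upwards [hwv, c.eventually_analyticAt hy hu, hdom,
      (c.contMDiffAt_z_comp hy).continuousAt.eventually hzu.eventually_nhds] with y h2 h3 h4 h5 t ht
    subst ht
    have hne := c.w_pow_poleOrder_ne_zero s h4.1 t.off
    rw [c.form_eq_fderiv c' l h4.1 h4.2, he, h2, fderiv_coord_mul h3.2 h5, c.z_eq _ h4.1,
      c.vecCoord_eq s h4.1, hm, pow_add]
    simp only [Function.comp_apply, Pi.add_apply]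
    change v t.pt ^ _ * _ = _
    field_simp

/-! ### Change of adapted coordinates for jets -/

/-- The tangent vector whose coordinates are the `j`th Taylor coefficients of a curve. -/
def tangentLift (j : ℕ) (q : JetPoint Δ π) : TangentPoint (Δ.trunc j) π where
  pt := q.pt
  off := q.off
  vec := (mfderiv 𝓘(ℂ, Fin n → ℂ) 𝓘(ℂ, Fin n → ℂ) c.z.symm (c.z (π q.pt)) (c.coordTaylor j q) :
    Fin n → ℂ)

theorem vecCoord_tangentLift (j : ℕ) {q : JetPoint Δ π} (hq : q.pt ∈ c.domain) :
    (c.trunc j).vecCoord (c.tangentLift j q) = c.coordTaylor j q :=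
  mfderiv_symm_apply c.z_mem (c.mapsTo hq) _

theorem form_tangentLift (j : ℕ) (l : Fin n) {q : JetPoint Δ π} (hq : q.pt ∈ c.domain) :
    (c.trunc j).form l (c.tangentLift j q) = c.jetCoord l j q := by
  rw [form_eq, vecCoord_tangentLift _ _ hq]; rfl

/-- Along the lift, the generators of `Ω_{π,Δ^(j)}` in the chart `c` become its jet coordinates of
order `j`, so the transition formula for forms pulls back to one for jets. -/
theorem germSpan_form_tangentLift (hy : y₀ ∈ c.domain) (hy' : y₀ ∈ c'.domain) (l : Fin n) {j : ℕ}
    (h0 : 0 < j) (hj : j ≤ k) :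
    GermSpan n JetPoint.pt y₀ (c.monosGE k (jetProfile j))
      (fun q => (c'.trunc j).form l (c.tangentLift j q)) := by
  have h1 := ((c.trunc j).germSpan_form (c'.trunc j) hy hy' l).comp (pr' := JetPoint.pt)
    (τ := c.tangentLift j) fun _ => rfl
  refine h1.bind ?_
  rintro _ ⟨_, ⟨r, rfl⟩, rfl⟩
  exact (c.germSpan_jetCoord r h0 hj).congr_on hy fun q hq => (c.form_tangentLift j r hq).symm

theorem jetCoord_eq_taylorCoeff (l : Fin n) (j : ℕ) {q : JetPoint Δ π} (hq : q.pt ∈ c.domain) :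
    c'.jetCoord l j q = (c'.w q.pt l ^ (c'.trunc j).poleOrder l)⁻¹ *
      taylorCoeff j (fun t => c.zCoord c' l (c.z (q.curve t))) := by
  rw [jetCoord_eq]
  congr 1
  refine taylorCoeff_congr ?_
  have hc : c.z.source ∈ 𝓝 (q.curve 0) := by
    rw [q.base]; exact c.z.open_source.mem_nhds (c.mapsTo hq)
  filter_upwards [q.holomorphic.continuousAt.eventually hc] with t ht
  rw [zCoord, c.z.left_inv ht]

/-- Up to products of jet coordinates of lower order, jet coordinates transform like the
corresponding forms. -/
theorem germSpan_jetCoord_sub (hy : y₀ ∈ c.domain) (hy' : y₀ ∈ c'.domain) (l : Fin n) {j : ℕ}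
    (h0 : 0 < j) (hj : j ≤ k) :
    GermSpan n JetPoint.pt y₀ (c.monosGT k (jetProfile j))
      (c'.jetCoord l j - fun q => (c'.trunc j).form l (c.tangentLift j q)) := by
  have hdom : ∀ᶠ y in 𝓝 y₀, y ∈ c.domain ∧ y ∈ c'.domain :=
    (c.domain ⊓ c'.domain).isOpen.mem_nhds ⟨hy, hy'⟩
  have hlift : ∀ q : JetPoint Δ π, q.pt ∈ c.domain → q.pt ∈ c'.domain →
      (c'.trunc j).form l (c.tangentLift j q) = (c'.w q.pt l ^ (c'.trunc j).poleOrder l)⁻¹ *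
        fderiv ℂ (c.zCoord c' l) (c.z (π q.pt)) (c.coordTaylor j q) := by
    intro q hq hq'
    rw [(c.trunc j).form_eq_fderiv (c'.trunc j) l (v := c.tangentLift j q) hq hq', vecCoord_tangentLift _ _ hq]
    rfl
  rcases c.normalForm c' hy hy' l with h | ⟨s, -, he, ⟨u, hu, hzu⟩, v, hv, hwv⟩
  · refine (((c.germSpan_taylorCoeff hy j hj _ (c.analyticAt_zCoord c' hy hy' l)).2 h0).smul
      (h j).1).congr_on (D := c.domain ⊓ c'.domain) ⟨hy, hy'⟩ fun q hq => ?_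
    rw [Pi.sub_apply, hlift q hq.1 hq.2, c.jetCoord_eq_taylorCoeff c' l j hq.1, mul_sub]
  · obtain ⟨j, rfl⟩ := Nat.exists_eq_succ_of_ne_zero h0.ne'
    obtain ⟨m, hm⟩ := Nat.exists_eq_add_of_le ((c.trunc (j + 1)).poleOrder_le_p s)
    have h1 := ((c.germSpan_taylorCoeff hy (j + 1) hj u hu).2 h0).smul
      (c.contMDiffAt_w_pow s m hy)
    -- These are the interior Leibniz terms, where both factors have positive order. The natural
    -- subtraction in the exponent is genuine because pole orders are antitone in the jet order.
    have h2 : GermSpan n JetPoint.pt y₀ (c.monosGT k (jetProfile (j + 1))) (fun q =>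
        ∑ i ∈ Finset.range j,
          c.w q.pt s ^ ((c.trunc (i + 1)).poleOrder s - (c.trunc (j + 1)).poleOrder s) *
          (c.jetCoord s (i + 1) q * taylorCoeff (j - i) fun t => u (c.z (q.curve t)))) := by
      refine GermSpan.sum _ fun i hi => .smul
        (f := fun y => c.w y s ^ ((c.trunc (i + 1)).poleOrder s - (c.trunc (j + 1)).poleOrder s))
        (c.contMDiffAt_w_pow s _ hy) ?_
      have hi' := Finset.mem_range.1 hi
      have := c.germSpan_mul_of_pos (i := i + 1) (j := j - i) (k := k) (by omega) (by omega) (by omega)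
        (c.germSpan_jetCoord (y₀ := y₀) s (by omega) (by omega))
        (c.germSpan_taylorCoeff hy (j - i) (by omega) u hu).1
      rwa [show i + 1 + (j - i) = j + 1 by omega] at this
    refine ((h1.add h2).smul (((contDiff_id.pow ((c.trunc (j + 1)).poleOrder s)).contMDiff.contMDiffAt
      (x := v y₀)).comp y₀ hv)).congr ?_
    filter_upwards [hwv, c.eventually_analyticAt hy hu, hdom,
      (c.contMDiffAt_z_comp hy).continuousAt.eventually hzu.eventually_nhds] with y h3 h4 h5 h6 q hq
    subst hq
    have hne := (c.trunc (j + 1)).w_pow_poleOrder_ne_zero s h5.1 q.off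
    change c.w q.pt s ^ _ ≠ 0 at hne
    have hγ := c.analyticAt_curve h5.1
    have hγ0 : c.z (q.curve 0) = c.z (π q.pt) := by rw [q.base]
    have hγs : AnalyticAt ℂ (fun t => c.z (q.curve t) s) 0 :=
      ((ContinuousLinearMap.proj (R := ℂ) (φ := fun _ : Fin n => ℂ) s).analyticAt _).fun_comp hγ
    have huγ : AnalyticAt ℂ (fun t => u (c.z (q.curve t))) 0 := by
      refine AnalyticAt.fun_comp (g := u) ?_ hγ
      rw [hγ0]; exact h4.2
    have h7 : (fun t => c.zCoord c' l (c.z (q.curve t))) =ᶠ[𝓝 0]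
        fun t => c.z (q.curve t) s * u (c.z (q.curve t)) := by
      have := hγ.continuousAt.tendsto
      rw [hγ0] at this
      exact this.eventually h6
    -- Both ends are split off the Leibniz sum for `z_s u`. The end with the top coefficient of
    -- `z_s` cancels against `u dz_s`; the other, minus `z_s du`, is `z_s` times the nonlinear part
    -- of the Taylor coefficient of `u`.
    rw [Pi.sub_apply, hlift q h5.1 h5.2, c.jetCoord_eq_taylorCoeff c' l _ h5.1, he, h3,
      fderiv_coord_mul h4.2 h6, taylorCoeff_congr h7, taylorCoeff_mul _ hγs huγ,
      Finset.sum_range_succ, Finset.sum_range_succ']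
    simp only [Nat.sub_self, Nat.sub_zero, taylorCoeff_zero, hγ0]
    have h8 : ∑ i ∈ Finset.range j, taylorCoeff (i + 1) (fun t => c.z (q.curve t) s) *
        taylorCoeff (j + 1 - (i + 1)) (fun t => u (c.z (q.curve t))) =
        c.w q.pt s ^ (c.trunc (j + 1)).poleOrder s * ∑ i ∈ Finset.range j,
          c.w q.pt s ^ ((c.trunc (i + 1)).poleOrder s - (c.trunc (j + 1)).poleOrder s) *
          (c.jetCoord s (i + 1) q * taylorCoeff (j - i) fun t => u (c.z (q.curve t))) := by
      rw [Finset.mul_sum]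
      refine Finset.sum_congr rfl fun i hi => ?_
      have hi' := Finset.mem_range.1 hi
      rw [← mul_assoc, ← pow_add, Nat.add_sub_of_le (c.poleOrder_trunc_antitone s (by omega)),
        ← mul_assoc, ← c.coordTaylor_eq s (i + 1) h5.1, Nat.add_sub_add_right]
      rfl
    have h9 : c.z (π q.pt) s = c.w q.pt s ^ (c.trunc (j + 1)).poleOrder s * c.w q.pt s ^ m := by
      rw [c.z_eq _ h5.1, ← pow_add, ← hm]; rfl
    have h10 : taylorCoeff (j + 1) (fun t => c.z (q.curve t) s) = c.coordTaylor (j + 1) q s := rfl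
    rw [h8, h9, h10]
    simp only [Pi.add_apply]
    change v q.pt ^ _ * _ = _
    field_simp
    ring

theorem germSpan_jetCoord_transition (hy : y₀ ∈ c.domain) (hy' : y₀ ∈ c'.domain) (l : Fin n) {j : ℕ}
    (h0 : 0 < j) (hj : j ≤ k) :
    GermSpan n JetPoint.pt y₀ (c.monosGE k (jetProfile j)) (c'.jetCoord l j) := by
  have := ((c.germSpan_jetCoord_sub c' hy hy' l h0 hj).mono c.monosGT_subset_monosGE).add
    (c.germSpan_form_tangentLift c' hy hy' l h0 hj)
  rwa [sub_add_cancel] at this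

end AdaptedChart

end Transition

/-! ### Linear independence, local freeness and independence of the filtration from the chart -/

section Frames

variable {n : ℕ} {ι X Y : Type*}
  [TopologicalSpace X] [ChartedSpace (Fin n → ℂ) X]
  [TopologicalSpace Y] [ChartedSpace (Fin n → ℂ) Y]
  {Δ : OrbifoldDivisor n ι X} {π : Y → X} {k N : ℕ}

theorem le_totalWeight (α : MultiIndex n k) (l : Fin n) (j : Fin k) : α l j ≤ totalWeight α := by
  have h1 : ((j : ℕ) + 1) * α l j ≤ ∑ l, ((j : ℕ) + 1) * α l j :=
    Finset.single_le_sum (f := fun l => ((j : ℕ) + 1) * α l j) (fun _ _ => Nat.zero_le _)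
      (Finset.mem_univ l)
  have h2 : (if (j : ℕ) + 1 ≤ k then ∑ l, ((j : ℕ) + 1) * α l j else 0) ≤ totalWeight α :=
    Finset.single_le_sum (f := fun j : Fin k => if (j : ℕ) + 1 ≤ k then
      ∑ l, ((j : ℕ) + 1) * α l j else 0) (fun _ _ => Nat.zero_le _) (Finset.mem_univ j)
  rw [if_pos (show (j : ℕ) + 1 ≤ k from j.2)] at h2
  nlinarith

instance finite_totalWeight : Finite {α : MultiIndex n k // totalWeight α = N} :=
  ((Set.finite_Iic (fun (_ : Fin n) (_ : Fin k) => N)).subset fun α (h : totalWeight α = N) l j =>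
    (le_totalWeight α l j).trans h.le).to_subtype

/-- The inclusion of the exponents in `S` into all exponents of weighted degree `N`. -/
def forgetMem (S : Set (MultiIndex n k)) (α : {α : MultiIndex n k // totalWeight α = N ∧ α ∈ S}) :
    {α : MultiIndex n k // totalWeight α = N} := ⟨α.1, α.2.1⟩

theorem forgetMem_injective (S : Set (MultiIndex n k)) :
    Function.Injective (forgetMem (N := N) S) := fun α β h =>
  Subtype.ext (show (forgetMem S α).1 = (forgetMem S β).1 by rw [h])

instance finite_totalWeight_and (S : Set (MultiIndex n k)) :
    Finite {α : MultiIndex n k // totalWeight α = N ∧ α ∈ S} :=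
  Finite.of_injective _ (forgetMem_injective S)

theorem profile_eq_sum (α : MultiIndex n k) :
    profile α = ∑ l, ∑ j : Fin k, α l j • jetProfile ((j : ℕ) + 1) := by
  funext q
  simp only [profile, partialWeight, Finset.sum_apply, Pi.smul_apply, jetProfile]
  rw [Finset.sum_comm]
  refine Finset.sum_congr rfl fun j _ => ?_
  split_ifs
  · exact Finset.sum_congr rfl fun l _ => mul_comm _ _
  · simp

theorem taylorCoeff_const_mul_pow (j m : ℕ) (a : ℂ) :
    taylorCoeff j (fun t => a * t ^ m) = if j = m then a else 0 := by
  have h : iteratedDeriv j (fun t : ℂ => a * t ^ m) 0 = a * iteratedDeriv j (fun t : ℂ => t ^ m) 0 :=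
    iteratedDeriv_const_mul_field a _
  rw [taylorCoeff, h, iteratedDeriv_fun_pow_zero]
  split_ifs with hjm
  · subst hjm
    have : (j.factorial : ℂ) ≠ 0 := by exact_mod_cast j.factorial_ne_zero
    field_simp
  · simp

namespace AdaptedChart

variable (c c' : AdaptedChart Δ π) {y₀ : Y}

theorem off_of_w_ne_zero {y : Y} (hy : y ∈ c.domain) (hw : ∀ l, c.w y l ≠ 0) (i : ι) :
    π y ∉ Δ.comp i := by
  rw [c.isLabelling i _ (c.mapsTo hy)]
  rintro ⟨l, -, hl⟩
  rw [c.z_eq y hy] at hl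
  exact hw l (pow_eq_zero_iff (c.p_pos l).ne' |>.1 hl)

theorem exists_vecCoord_eq {y : Y} (hy : y ∈ c.domain) (hoff : ∀ i, π y ∉ Δ.comp i)
    (x : Fin n → ℂ) : ∃ v : TangentPoint Δ π, v.pt = y ∧ c.vecCoord v = x :=
  ⟨⟨y, hoff, (mfderiv 𝓘(ℂ, Fin n → ℂ) 𝓘(ℂ, Fin n → ℂ) c.z.symm (c.z (π y)) x : Fin n → ℂ)⟩, rfl,
    mfderiv_symm_apply c.z_mem (c.mapsTo hy) x⟩

/-- A polynomial curve in the coordinates realizes any prescribed Taylor coefficients of orders `1`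
to `k`. -/
theorem exists_coordTaylor_eq {y : Y} (hy : y ∈ c.domain) (hoff : ∀ i, π y ∉ Δ.comp i)
    (x : Fin n → Fin k → ℂ) : ∃ q : JetPoint Δ π, q.pt = y ∧
      ∀ l (j : Fin k), c.coordTaylor ((j : ℕ) + 1) q l = x l j := by
  have hx := c.mapsTo hy
  let γ : ℂ → Fin n → ℂ := fun t l => c.z (π y) l + ∑ j : Fin k, x l j * t ^ ((j : ℕ) + 1)
  have hγ0 : γ 0 = c.z (π y) := by
    funext l; simp [γ]
  have hγ : ContDiff ℂ ω γ := by
    refine contDiff_pi.2 fun l => contDiff_const.add (ContDiff.sum fun j _ => ?_)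
    exact contDiff_const.mul (contDiff_id.pow _)
  have hhol : ContMDiffAt 𝓘(ℂ) 𝓘(ℂ, Fin n → ℂ) ω (fun t => c.z.symm (γ t)) 0 := by
    refine ContMDiffAt.comp (0 : ℂ) ?_ hγ.contMDiff.contMDiffAt
    rw [hγ0]
    exact contMDiffAt_symm_of_mem_maximalAtlas c.z_mem (c.z.map_source hx)
  refine ⟨⟨y, hoff, fun t => c.z.symm (γ t), by simp only [hγ0, c.z.left_inv hx], hhol⟩, rfl,
    fun l j => ?_⟩
  -- The index `none` stands for the constant term, so that the whole polynomial is a single sum of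
  -- powers.
  have h1 : (fun t => c.z (c.z.symm (γ t)) l) =ᶠ[𝓝 0]
      fun t => ∑ i : Option (Fin k),
        (i.elim (c.z (π y) l) (x l)) * t ^ (i.elim 0 fun i => (i : ℕ) + 1) := by
    have : Tendsto γ (𝓝 0) (𝓝 (c.z (π y))) := by
      rw [← hγ0]; exact hγ.continuous.tendsto 0
    filter_upwards [this.eventually (c.z.open_target.mem_nhds (c.z.map_source hx))] with t ht
    rw [c.z.right_inv ht, Fintype.sum_option]
    simp [γ]
  rw [coordTaylor, taylorCoeff_congr h1, taylorCoeff_sum _ _ fun i _ => by fun_prop]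
  simp only [taylorCoeff_const_mul_pow]
  rw [Finset.sum_eq_single (some j)]
  · simp
  · rintro (_ | i) _ hi
    · simp
    · have : ¬ (j : ℕ) + 1 = (i : ℕ) + 1 := fun h => hi (by
        congr 1; exact Fin.ext (by omega))
      simp only [Option.elim_some]
      exact if_neg this
  · simp

theorem linearIndependent_form {U : Opens Y} (hU : U ≤ c.domain) :
    LinearIndependent (Hol n U) (fun l => LocFun.of (TangentPoint.pt (Δ := Δ) (π := π))
      (c.form l) U) := by
  refine linearIndependent_of_frequently fun y hy => ?_
  have hD := c.domain.isOpen.mem_nhds (hU hy)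
  refine ((frequently_coord_ne_zero (hU hy)).and_eventually hD).mono ?_
  rintro y' ⟨hw, hy'⟩ F hF
  funext l
  obtain ⟨v, rfl, hv⟩ := c.exists_vecCoord_eq hy' (c.off_of_w_ne_zero hy' hw) (Pi.single l 1)
  have h1 := hF v rfl
  rw [Finset.sum_eq_single l] at h1
  · have hne := c.w_pow_poleOrder_ne_zero l hy' v.off
    simpa [form_eq, hv, hne] using h1
  · intro l' _ hl
    simp [form_eq, hv, hl]
  · simp

/-- Over a point with all `w_l ≠ 0` the jet coordinates take arbitrary values. A relation there is a
polynomial over `ℂ` that vanishes at all points, hence is zero. -/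
theorem linearIndependent_monomial {U : Opens Y} (hU : U ≤ c.domain) :
    LinearIndependent (Hol n U) (fun α : {α : MultiIndex n k // totalWeight α = N} =>
      LocFun.of (JetPoint.pt (Δ := Δ) (π := π)) (c.monomial α.1) U) := by
  have := Fintype.ofFinite {α : MultiIndex n k // totalWeight α = N}
  refine linearIndependent_of_frequently (e := fun α : {α : MultiIndex n k // totalWeight α = N} =>
    c.monomial α.1) fun y hy => ?_
  have hD := c.domain.isOpen.mem_nhds (hU hy)
  refine ((frequently_coord_ne_zero (hU hy)).and_eventually hD).mono ?_
  rintro y' ⟨hw, hy'⟩ F hF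
  let m : MultiIndex n k → (Fin n × Fin k →₀ ℕ) := fun α =>
    Finsupp.equivFunOnFinite.symm fun i => α i.1 i.2
  have hm : Function.Injective m := fun α β h => by
    funext l j
    exact DFunLike.congr_fun h (l, j)
  have hP : ∑ α : {α : MultiIndex n k // totalWeight α = N},
      MvPolynomial.monomial (m α.1) (F α) = 0 := by
    refine MvPolynomial.funext fun x => ?_
    -- The values are rescaled by the normalizing factors so that the jet coordinates themselves
    -- equal `x`.
    obtain ⟨q, rfl, hq⟩ := c.exists_coordTaylor_eq hy' (c.off_of_w_ne_zero hy' hw)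
      (fun l j => c.w y' l ^ (c.trunc ((j : ℕ) + 1)).poleOrder l * x (l, j))
    have h1 := hF q rfl
    rw [map_sum, map_zero, ← h1]
    refine Finset.sum_congr rfl fun α _ => ?_
    rw [MvPolynomial.eval_monomial, monomial, Finsupp.prod_fintype _ _ fun _ => pow_zero _,
      Fintype.prod_prod_type]
    congr 1
    refine Finset.prod_congr rfl fun l _ => Finset.prod_congr rfl fun j _ => ?_
    rw [jetCoord_eq, hq, inv_mul_cancel_left₀]
    · rfl
    · exact (c.trunc ((j : ℕ) + 1)).w_pow_poleOrder_ne_zero l hy' q.off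
  funext α
  have h2 := congrArg (MvPolynomial.coeff (m α.1)) hP
  rw [MvPolynomial.coeff_sum, Finset.sum_eq_single α] at h2
  · simpa using h2
  · intro β _ hβ
    rw [MvPolynomial.coeff_monomial, if_neg fun h => hβ (Subtype.ext (hm h))]
  · simp

theorem linearIndependent_monomial_of_mem (S : Set (MultiIndex n k)) {U : Opens Y}
    (hU : U ≤ c.domain) :
    LinearIndependent (Hol n U) (fun α : {α : MultiIndex n k // totalWeight α = N ∧ α ∈ S} =>
      LocFun.of (JetPoint.pt (Δ := Δ) (π := π)) (c.monomial α.1) U) :=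
  (c.linearIndependent_monomial (N := N) hU).comp (forgetMem S) (forgetMem_injective S)

theorem monomialSpan_eq (S : Set (MultiIndex n k)) (U : Opens Y) :
    c.monomialSpan k N S U = Submodule.span (Hol n U) (Set.range
      fun α : {α : MultiIndex n k // totalWeight α = N ∧ α ∈ S} =>
        LocFun.of (JetPoint.pt (Δ := Δ) (π := π)) (c.monomial α.1) U) := by
  rw [monomialSpan]
  congr 1
  ext s
  constructor
  · rintro ⟨α, h1, h2, rfl⟩
    exact ⟨⟨α, h2, h1⟩, rfl⟩
  · rintro ⟨α, rfl⟩
    exact ⟨α.1, α.2.2, α.2.1, rfl⟩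

theorem mem_monomialSpan_of_local {S : Set (MultiIndex n k)} {U : Opens Y} (hU : U ≤ c.domain)
    {s : LocFun (JetPoint.pt (Δ := Δ) (π := π)) U}
    (hs : ∀ y ∈ U, ∃ V : Opens Y, y ∈ V ∧ ∃ h : V ≤ U, LocFun.res h s ∈ c.monomialSpan k N S V) :
    s ∈ c.monomialSpan k N S U := by
  simp only [monomialSpan_eq] at hs ⊢
  exact mem_span_of_local (e := fun α : {α : MultiIndex n k // totalWeight α = N ∧ α ∈ S} =>
    c.monomial α.1) (fun V hV => c.linearIndependent_monomial_of_mem S (hV.trans hU)) hs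

theorem mem_monomialSpan_of_germSpan {S : Set (MultiIndex n k)} {U : Opens Y}
    [IsManifold 𝓘(ℂ, Fin n → ℂ) ω Y] (hU : U ≤ c.domain) {s : JetPoint Δ π → ℂ}
    (hs : ∀ y ∈ U, GermSpan n JetPoint.pt y {f | ∃ α ∈ S, totalWeight α = N ∧ f = c.monomial α} s) :
    LocFun.of _ s U ∈ c.monomialSpan k N S U := by
  refine c.mem_monomialSpan_of_local hU fun y hy => ?_
  obtain ⟨V, hyV, hV⟩ := (hs y hy).exists_mem_span
  refine ⟨V ⊓ U, ⟨hyV, hy⟩, inf_le_right, Submodule.span_mono ?_ (hV (V ⊓ U) inf_le_left)⟩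
  rintro _ ⟨_, ⟨α, h1, h2, rfl⟩, rfl⟩
  exact ⟨α, h1, h2, rfl⟩

theorem res_mem_monomialSpan {S : Set (MultiIndex n k)} {U V : Opens Y} (h : V ≤ U)
    {s : LocFun (JetPoint.pt (Δ := Δ) (π := π)) U} (hs : s ∈ c.monomialSpan k N S U) :
    LocFun.res h s ∈ c.monomialSpan k N S V := by
  have hr : ∀ U : Opens Y, {s | ∃ α ∈ S, totalWeight α = N ∧ s = LocFun.of _ (c.monomial α) U} =
      (fun b => LocFun.of (JetPoint.pt (Δ := Δ) (π := π)) b U) ''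
        {f | ∃ α ∈ S, totalWeight α = N ∧ f = c.monomial α} := by
    intro U
    ext s
    constructor
    · rintro ⟨α, h1, h2, rfl⟩
      exact ⟨_, ⟨α, h1, h2, rfl⟩, rfl⟩
    · rintro ⟨_, ⟨α, h1, h2, rfl⟩, rfl⟩
      exact ⟨α, h1, h2, rfl⟩
  rw [monomialSpan, hr] at hs ⊢
  exact res_mem_span_image h hs

theorem monomialSpan_mono {S S' : Set (MultiIndex n k)} (h : S ⊆ S') (U : Opens Y) :
    c.monomialSpan k N S U ≤ c.monomialSpan k N S' U :=
  Submodule.span_mono fun _ ⟨α, h1, h2⟩ => ⟨α, h h1, h2⟩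

theorem germSpan_prod {κ : Type*} (L : Finset κ) {f : κ → JetPoint Δ π → ℂ} {v : κ → ℕ → ℕ}
    (h : ∀ i ∈ L, GermSpan n JetPoint.pt y₀ (c.monosGE k (v i)) (f i)) :
    GermSpan n JetPoint.pt y₀ (c.monosGE k (∑ i ∈ L, v i)) (∏ i ∈ L, f i) := by
  classical
  induction L using Finset.induction_on with
  | empty => exact .gen c.one_mem_monosGE
  | insert i L hi ih =>
    rw [Finset.sum_insert hi, Finset.prod_insert hi]
    exact (h i (Finset.mem_insert_self _ _)).mul (fun _ h1 _ h2 => c.mul_mem_monosGE h1 h2)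
      (ih fun j hj => h j (Finset.mem_insert_of_mem hj))

/-- Factors are exchanged one at a time: `f F - g G = (f - g) F + g (F - G)`, where each summand has
one factor of larger profile. -/
theorem germSpan_prod_sub {κ : Type*} (L : Finset κ) {f g : κ → JetPoint Δ π → ℂ} {v : κ → ℕ → ℕ}
    (hf : ∀ i ∈ L, GermSpan n JetPoint.pt y₀ (c.monosGE k (v i)) (f i))
    (hfg : ∀ i ∈ L, GermSpan n JetPoint.pt y₀ (c.monosGT k (v i)) (f i - g i)) :
    GermSpan n JetPoint.pt y₀ (c.monosGT k (∑ i ∈ L, v i)) (∏ i ∈ L, f i - ∏ i ∈ L, g i) := by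
  classical
  have hg : ∀ i ∈ L, GermSpan n JetPoint.pt y₀ (c.monosGE k (v i)) (g i) := fun i hi => by
    have := (hf i hi).sub ((hfg i hi).mono c.monosGT_subset_monosGE)
    rwa [sub_sub_cancel] at this
  induction L using Finset.induction_on with
  | empty => simpa using .zero
  | insert i L hi ih =>
    have hL : ∀ j ∈ L, j ∈ insert i L := fun j hj => Finset.mem_insert_of_mem hj
    have hi' := Finset.mem_insert_self i L
    rw [Finset.sum_insert hi, Finset.prod_insert hi, Finset.prod_insert hi]
    have h1 := (hfg i hi').mul (fun _ h1 _ h2 => c.mul_mem_monosGT h1 h2)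
      (c.germSpan_prod L fun j hj => hf j (hL j hj))
    have h2 := (ih (fun j hj => hf j (hL j hj)) (fun j hj => hfg j (hL j hj))
      fun j hj => hg j (hL j hj)).mul (fun _ h1 _ h2 => c.mul_mem_monosGT h1 h2) (hg i hi')
    rw [add_comm (∑ j ∈ L, v j)] at h2
    convert h1.add h2 using 1
    ring

theorem germSpan_pow {f : JetPoint Δ π → ℂ} {v : ℕ → ℕ} (m : ℕ)
    (h : GermSpan n JetPoint.pt y₀ (c.monosGE k v) f) :
    GermSpan n JetPoint.pt y₀ (c.monosGE k (m • v)) (f ^ m) := by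
  have := c.germSpan_prod (Finset.range m) (f := fun _ => f) (v := fun _ => v) fun _ _ => h
  simpa using this

/-- In another adapted chart, a monomial involves only monomials of at least the same profile. -/
theorem germSpan_monomial (hy : y₀ ∈ c.domain) (hy' : y₀ ∈ c'.domain) (α : MultiIndex n k) :
    GermSpan n JetPoint.pt y₀ (c.monosGE k (profile α)) (c'.monomial α) := by
  have h1 : c'.monomial α = ∏ l, ∏ j : Fin k, c'.jetCoord l ((j : ℕ) + 1) ^ α l j := by
    funext q
    simp [monomial, Finset.prod_apply]
  rw [profile_eq_sum, h1]
  exact c.germSpan_prod _ fun l _ => c.germSpan_prod _ fun j _ => c.germSpan_pow _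
    (c.germSpan_jetCoord_transition c' hy hy' l (Nat.succ_pos _) j.2)

end AdaptedChart

/-- Conditions on exponents that pass to exponents of larger profile. -/
def IsUpward (N : ℕ) (S : Set (MultiIndex n k)) : Prop :=
  ∀ α ∈ S, ∀ β, totalWeight α = N → totalWeight β = N → profile α ≤ profile β → β ∈ S

namespace AdaptedChart

variable [IsManifold 𝓘(ℂ, Fin n → ℂ) ω Y] (c c' : AdaptedChart Δ π)

/-- A change of chart introduces only monomials of larger or equal profile and the same total
weight, and these remain in an upward set. -/
theorem monomialSpan_le {S : Set (MultiIndex n k)} (hS : IsUpward N S) {U : Opens Y}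
    (hU : U ≤ c.domain) (hU' : U ≤ c'.domain) :
    c'.monomialSpan k N S U ≤ c.monomialSpan k N S U := by
  refine Submodule.span_le.2 ?_
  rintro _ ⟨α, hα, hN, rfl⟩
  refine c.mem_monomialSpan_of_germSpan hU fun y hy =>
    (c.germSpan_monomial c' (hU hy) (hU' hy) α).mono ?_
  rintro _ ⟨β, h1, h2, rfl⟩
  exact ⟨β, hS α hα β hN (h2.trans hN) h1, h2.trans hN, rfl⟩

theorem jetDiff_eq {U : Opens Y} (hU : U ≤ c.domain) :
    JetDiff Δ π k N U = c.monomialSpan k N Set.univ U := by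
  have h1 : ∀ V : Opens Y, c.monomialSpan k N Set.univ V = Submodule.span (Hol n V) (Set.range
      fun α : {α : MultiIndex n k // totalWeight α = N} =>
        LocFun.of (JetPoint.pt (Δ := Δ) (π := π)) (c.monomial α.1) V) := by
    intro V
    rw [monomialSpan]
    congr 1
    ext s
    constructor
    · rintro ⟨α, -, h2, rfl⟩
      exact ⟨⟨α, h2⟩, rfl⟩
    · rintro ⟨α, rfl⟩
      exact ⟨α.1, trivial, α.2, rfl⟩
  rw [h1]
  refine generatedSheaf_eq_span (e := fun α : {α : MultiIndex n k // totalWeight α = N} =>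
    c.monomial α.1) hU (fun α => ⟨c, α.1, α.2, rfl⟩)
    (fun V hV => c.linearIndependent_monomial hV) ?_
  rintro _ ⟨c', α, hα, rfl⟩ y hy hy'
  refine (c.germSpan_monomial c' hy hy' α).mono ?_
  rintro _ ⟨β, -, h2, rfl⟩
  exact ⟨⟨β, h2.trans hα⟩, rfl⟩

/-- For an upward condition, holding in one chart implies holding in all others, so the test over
all charts reduces to `c`. -/
theorem filt_eq {S : Set (MultiIndex n k)} (hS : IsUpward N S) {U : Opens Y} (hU : U ≤ c.domain) :
    filt Δ π k N S U = c.monomialSpan k N S U := by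
  refine le_antisymm (fun s hs => hs.2 c U le_rfl hU) fun s hs => ⟨?_, fun c' V h hV => ?_⟩
  · rw [c.jetDiff_eq hU]
    exact c.monomialSpan_mono (Set.subset_univ _) U hs
  · exact c'.monomialSpan_le c hS hV (h.trans hU) (c.res_mem_monomialSpan h hs)

theorem orbForms_eq {U : Opens Y} (hU : U ≤ c.domain) :
    OrbForms Δ π U = Submodule.span (Hol n U) (Set.range
      fun l => LocFun.of (TangentPoint.pt (Δ := Δ) (π := π)) (c.form l) U) := by
  refine generatedSheaf_eq_span (e := c.form) hU (fun l => ⟨c, l, rfl⟩)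
    (fun V hV => c.linearIndependent_form hV) ?_
  rintro _ ⟨c', l, rfl⟩ y hy hy'
  exact c.germSpan_form c' hy hy' l

end AdaptedChart

theorem isSubsheaf_jetDiff : IsSubsheaf (JetDiff Δ π k N) := by
  refine ⟨fun U V h s hs => res_mem_generatedSheaf h hs, fun U s hs y hy => ?_⟩
  obtain ⟨V, hyV, hV, hs⟩ := hs y hy
  obtain ⟨W, hyW, hW, hs⟩ := hs y hyV
  exact ⟨W, hyW, hW.trans hV, hs⟩

theorem isSubsheaf_filt (S : Set (MultiIndex n k)) : IsSubsheaf (filt Δ π k N S) := by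
  refine ⟨fun U V h s hs => ⟨res_mem_generatedSheaf h hs.1, fun c W hW hc =>
    hs.2 c W (hW.trans h) hc⟩, fun U s hs => ⟨isSubsheaf_jetDiff.2 U s fun y hy => ?_,
      fun c V h hV => c.mem_monomialSpan_of_local hV fun y hy => ?_⟩⟩
  · obtain ⟨W, hyW, hW, hs⟩ := hs y hy
    exact ⟨W, hyW, hW, hs.1⟩
  · obtain ⟨W, hyW, hW, hs⟩ := hs y (h hy)
    exact ⟨W ⊓ V, ⟨hyW, hy⟩, inf_le_right, hs.2 c (W ⊓ V) inf_le_left (inf_le_right.trans hV)⟩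

theorem filt_mono {S S' : Set (MultiIndex n k)}
    (h : ∀ α ∈ S, totalWeight α = N → α ∈ S') (U : Opens Y) :
    filt Δ π k N S U ≤ filt Δ π k N S' U := fun _ hs =>
  ⟨hs.1, fun c V hV hc => by
    refine Submodule.span_mono ?_ (hs.2 c V hV hc)
    rintro _ ⟨α, h1, h2, rfl⟩
    exact ⟨α, h α h1 h2, h2, rfl⟩⟩

/-- The lexicographic order refines the pointwise order, so all lexicographic conditions are upward.
-/
theorem weightVector_le_of_profile_le {α β : MultiIndex n k} (h : profile α ≤ profile β) :
    weightVector α ≤ weightVector β :=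
  Pi.toLex_monotone fun _ => h _

theorem isUpward_degGE (q m : ℕ) : IsUpward N (degGE (n := n) k q m) :=
  fun _ hα _ _ _ h => le_trans (α := ℕ) hα (h q)

theorem isUpward_lexGE (d : Lex (Fin (k - 1) → ℕ)) : IsUpward N (lexGE (n := n) k d) :=
  fun _ hα _ _ _ h => le_trans (α := Lex (Fin (k - 1) → ℕ)) hα (weightVector_le_of_profile_le h)

theorem isUpward_lexGT (d : Lex (Fin (k - 1) → ℕ)) : IsUpward N (lexGT (n := n) k d) :=
  fun _ hα _ _ _ h => lt_of_lt_of_le (α := Lex (Fin (k - 1) → ℕ)) hα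
    (weightVector_le_of_profile_le h)

theorem partialWeight_le_totalWeight (q : ℕ) (α : MultiIndex n k) :
    partialWeight q α ≤ totalWeight α :=
  Finset.sum_le_sum fun j _ => by
    rw [if_pos (show (j : ℕ) + 1 ≤ k from j.2)]
    split_ifs
    · exact le_rfl
    · exact Nat.zero_le _

theorem lexGE_zero : lexGE (n := n) k (toLex fun _ => 0) = Set.univ :=
  Set.eq_univ_of_forall fun _ => Pi.toLex_monotone fun _ => Nat.zero_le _

theorem filt_univ (U : Opens Y) [IsManifold 𝓘(ℂ, Fin n → ℂ) ω Y] :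
    filt Δ π k N Set.univ U = JetDiff Δ π k N U :=
  le_antisymm (fun _ hs => hs.1) fun _ hs => ⟨hs, fun c V h hV => by
    rw [← c.jetDiff_eq hV]; exact res_mem_generatedSheaf h hs⟩

/-- No partial weight exceeds the total weight `N`, so no monomial lies strictly above `(N, …, N)`.
Adapted charts at all points are needed to conclude that a section vanishes. -/
theorem filt_lexGT_eq_bot (hπ : IsAdapted Δ π) (U : Opens Y) :
    filt Δ π k N (lexGT k (toLex fun _ => N)) U = ⊥ := by
  refine (Submodule.eq_bot_iff _).2 fun s hs => funext fun q => ?_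
  obtain ⟨c, hc, -⟩ := hπ q.1.pt
  have h1 := hs.2 c (U ⊓ c.domain) inf_le_left inf_le_right
  have h2 : c.monomialSpan k N (lexGT k (toLex fun _ => N)) (U ⊓ c.domain) = ⊥ := by
    rw [AdaptedChart.monomialSpan, Submodule.span_eq_bot]
    rintro _ ⟨α, h3, h4, -⟩
    refine absurd h3 (not_lt_of_ge (Pi.toLex_monotone fun r => ?_))
    exact (partialWeight_le_totalWeight _ α).trans h4.le
  rw [h2, Submodule.mem_bot] at h1
  exact congrFun h1 ⟨q.1, q.2, hc⟩

end Frames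

/-! ### Spanning sets of symmetric powers, reindexed direct sums, and maps to quotients -/

section Algebra

open scoped Pointwise in
-- The symmetric power is the power of a submodule inside the symmetric algebra, and the power of a
-- span is the span of the products of generators.
theorem span_symProd_eq_top {R M A : Type*} [CommRing R] [AddCommGroup M] [Module R M] {b : A → M}
    (hb : Submodule.span R (Set.range b) = ⊤) (m : ℕ) :
    Submodule.span R (Set.range fun l : Fin m → A => symProd R fun t => b (l t)) = ⊤ := by
  refine Submodule.map_injective_of_injective (SymPow R M m).injective_subtype ?_
  rw [Submodule.map_span, Submodule.map_top, Submodule.range_subtype, ← Set.range_comp]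
  change _ = LinearMap.range (SymmetricAlgebra.ι R M) ^ m
  rw [LinearMap.range_eq_map, ← hb, Submodule.map_span, Submodule.span_pow, ← Set.range_comp]
  congr 1
  induction m with
  | zero =>
    rw [pow_zero]
    ext x
    simp [symProd, eq_comm]
  | succ m ih =>
    rw [pow_succ', ← ih]
    ext x
    rw [Set.mem_mul]
    constructor
    · rintro ⟨l, rfl⟩
      exact ⟨_, ⟨l 0, rfl⟩, _, ⟨fun t => l t.succ, rfl⟩, 
        (Fin.prod_univ_succ fun t => SymmetricAlgebra.ι R M (b (l t))).symm⟩
    · rintro ⟨_, ⟨a, rfl⟩, _, ⟨l, rfl⟩, rfl⟩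
      exact ⟨Fin.cons a l, by simp [symProd, Fin.prod_univ_succ]⟩

theorem prod_eq_prod_pow_card {S A : Type*} [CommMonoid S] [Fintype A] [DecidableEq A] {m : ℕ}
    (f : A → S) (l : Fin m → A) :
    ∏ t, f (l t) = ∏ r, f r ^ (Finset.univ.filter fun t => l t = r).card := by
  rw [← Finset.prod_fiberwise Finset.univ l fun t => f (l t)]
  refine Finset.prod_congr rfl fun r _ => ?_
  rw [Finset.prod_congr rfl (g := fun _ => f r), Finset.prod_const]
  intro t ht
  rw [(Finset.mem_filter.1 ht).2]

theorem exists_card_fiber_eq {A : Type*} [Fintype A] [DecidableEq A] (α : A → ℕ) {m : ℕ}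
    (h : ∑ r, α r = m) :
    ∃ l : Fin m → A, ∀ r, (Finset.univ.filter fun t => l t = r).card = α r := by
  have e : (Σ r, Fin (α r)) ≃ Fin m := Fintype.equivFinOfCardEq (by simpa using h)
  refine ⟨fun t => (e.symm t).1, fun r => ?_⟩
  have h1 : (Finset.univ.filter fun t => (e.symm t).1 = r) =
      (Finset.univ : Finset (Fin (α r))).map
        ((Function.Embedding.sigmaMk (β := fun r => Fin (α r)) r).trans e.toEmbedding) := by
    ext t
    simp only [Finset.mem_filter, Finset.mem_univ, true_and, Finset.mem_map,
      Function.Embedding.trans_apply, Function.Embedding.sigmaMk_apply, Equiv.coe_toEmbedding]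
    constructor
    · rintro rfl
      exact ⟨(e.symm t).2, by simp⟩
    · rintro ⟨i, rfl⟩
      simp
  rw [h1, Finset.card_map, Finset.card_univ, Fintype.card_fin]

/-- A direct sum, reindexed along an injection outside whose image the summands vanish. -/
theorem bijective_toModule_lof {R I J : Type*} [CommRing R] [DecidableEq I] [DecidableEq J]
    {M : I → Type*} {P : J → Type*} [∀ i, AddCommMonoid (M i)] [∀ i, Module R (M i)]
    [∀ j, AddCommMonoid (P j)] [∀ j, Module R (P j)] {f : I → J} (hf : Function.Injective f)
    (g : ∀ i, M i →ₗ[R] P (f i)) (hg : ∀ i, Function.Bijective (g i))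
    (hP : ∀ j, j ∉ Set.range f → Subsingleton (P j)) :
    Function.Bijective (DirectSum.toModule R I (⨁ j, P j)
      fun i => DirectSum.lof R J P (f i) ∘ₗ g i) := by
  constructor
  · have key : ∀ i, DirectSum.component R J P (f i) ∘ₗ (DirectSum.toModule R I (⨁ j, P j)
        fun i => DirectSum.lof R J P (f i) ∘ₗ g i) = g i ∘ₗ DirectSum.component R I M i := by
      intro i
      refine DirectSum.linearMap_ext R fun i' => LinearMap.ext fun x => ?_
      simp only [LinearMap.comp_apply, DirectSum.toModule_lof]
      by_cases h : i' = i
      · subst h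
        rw [DirectSum.component.lof_self, DirectSum.component.lof_self]
      · rw [DirectSum.component.of, DirectSum.component.of, dif_neg h, map_zero,
          dif_neg fun h' => h (hf h')]
    intro x y hxy
    refine DirectSum.ext_component R fun i => (hg i).1 ?_
    have hx := LinearMap.congr_fun (key i) x
    have hy := LinearMap.congr_fun (key i) y
    rw [LinearMap.comp_apply, LinearMap.comp_apply] at hx hy
    rw [← hx, ← hy, hxy]
  · rw [← LinearMap.range_eq_top, eq_top_iff]
    rintro x -
    induction x using DirectSum.induction_on with
    | zero => exact Submodule.zero_mem _
    | add x y hx hy => exact Submodule.add_mem _ hx hy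
    | of j y =>
      by_cases hj : j ∈ Set.range f
      · obtain ⟨i, rfl⟩ := hj
        obtain ⟨x, rfl⟩ := (hg i).2 y
        exact ⟨DirectSum.lof R I M i x, DirectSum.toModule_lof R i x⟩
      · have := hP j hj
        rw [Subsingleton.elim y 0, map_zero]
        exact Submodule.zero_mem _

/-- The isomorphism of direct sums defined by isomorphisms of the summands. -/
def reindexEquiv {R I J : Type*} [CommRing R] [DecidableEq I] [DecidableEq J]
    {M : I → Type*} {P : J → Type*} [∀ i, AddCommMonoid (M i)] [∀ i, Module R (M i)]
    [∀ j, AddCommMonoid (P j)] [∀ j, Module R (P j)] {f : I → J} (hf : Function.Injective f)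
    (g : ∀ i, M i →ₗ[R] P (f i)) (hg : ∀ i, Function.Bijective (g i))
    (hP : ∀ j, j ∉ Set.range f → Subsingleton (P j)) : (⨁ j, P j) ≃ₗ[R] ⨁ i, M i :=
  (LinearEquiv.ofBijective _ (bijective_toModule_lof hf g hg hP)).symm

theorem reindexEquiv_lof_eq_iff {R I J : Type*} [CommRing R] [DecidableEq I] [DecidableEq J]
    {M : I → Type*} {P : J → Type*} [∀ i, AddCommMonoid (M i)] [∀ i, Module R (M i)]
    [∀ j, AddCommMonoid (P j)] [∀ j, Module R (P j)] {f : I → J} (hf : Function.Injective f)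
    (g : ∀ i, M i →ₗ[R] P (f i)) (hg : ∀ i, Function.Bijective (g i))
    (hP : ∀ j, j ∉ Set.range f → Subsingleton (P j)) (i : I) (y : P (f i)) (x : M i) :
    reindexEquiv hf g hg hP (DirectSum.lof R J P (f i) y) = DirectSum.lof R I M i x ↔
      y = g i x := by
  rw [reindexEquiv, LinearEquiv.symm_apply_eq, LinearEquiv.ofBijective_apply,
    DirectSum.toModule_lof, LinearMap.comp_apply]
  exact (DirectSum.of_injective (β := P) (f i)).eq_iff

section Quotient

variable {R M L B I : Type*} [CommRing R] [AddCommMonoid M] [Module R M] [AddCommGroup L]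
  [Module R L] {T : M →ₗ[R] L} {e : B → M} {v : I → L} {i : B → I} {S S' : Set I}

theorem apply_mem_span_image (he : Submodule.span R (Set.range e) = ⊤)
    (hT : ∀ b, T (e b) = v (i b)) (hS : ∀ b, i b ∈ S) (x : M) :
    T x ∈ Submodule.span R (v '' S) := by
  have h : x ∈ Submodule.span R (Set.range e) := he ▸ trivial
  induction h using Submodule.span_induction with
  | mem x hx =>
    obtain ⟨b, rfl⟩ := hx
    rw [hT]
    exact Submodule.subset_span ⟨_, hS b, rfl⟩
  | zero => rw [map_zero]; exact Submodule.zero_mem _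
  | add x y _ _ hx hy => rw [map_add]; exact Submodule.add_mem _ hx hy
  | smul a x _ hx => rw [map_smul]; exact Submodule.smul_mem _ a hx

/-- The family `e` may have repetitions and is not assumed independent. One representative is kept
for each value of `i`; the images of the representatives are distinct members of an independent
family, indexed outside `S'`, so coefficients can be compared modulo the span over `S'`. -/
theorem eq_of_sub_mem_span_image [Finite I] (he : Submodule.span R (Set.range e) = ⊤)
    (hT : ∀ b, T (e b) = v (i b)) (hi : ∀ b b', i b = i b' → e b = e b')
    (hv : LinearIndependent R v) (hS : ∀ b, i b ∉ S') {x y : M}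
    (h : T x - T y ∈ Submodule.span R (v '' S')) : x = y := by
  have := Fintype.ofFinite (Set.range i)
  choose l hl using fun a : Set.range i => a.2
  have hspan : ∀ x, ∃ f : Set.range i → R, ∑ a, f a • e (l a) = x := by
    have h1 : Set.range e = Set.range fun a => e (l a) := by
      refine Set.Subset.antisymm ?_ ?_
      · rintro _ ⟨b, rfl⟩
        exact ⟨⟨_, b, rfl⟩, hi _ _ (hl ⟨_, b, rfl⟩)⟩
      · rintro _ ⟨a, rfl⟩
        exact ⟨_, rfl⟩
    intro x
    exact (Submodule.mem_span_range_iff_exists_fun R).1 (h1 ▸ he ▸ trivial)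
  obtain ⟨f, rfl⟩ := hspan x
  obtain ⟨g, rfl⟩ := hspan y
  have hsum : ∀ f : Set.range i → R, T (∑ a, f a • e (l a)) = ∑ a, f a • v a.1 := by
    intro f
    rw [map_sum]
    refine Finset.sum_congr rfl fun a _ => ?_
    rw [map_smul, hT, hl]
  rw [hsum, hsum, ← Finset.sum_sub_distrib] at h
  simp only [← sub_smul] at h
  have hd := hv.disjoint_span_image (s := Set.range i) (t := S') (by
    rw [Set.disjoint_left]
    rintro _ ⟨b, rfl⟩
    exact hS b)
  have h0 := (Submodule.disjoint_def.1 hd) _ (Submodule.sum_mem _ fun a _ =>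
      Submodule.smul_mem _ _ (Submodule.subset_span ⟨a.1, a.2, rfl⟩)) h
  have hf := Fintype.linearIndependent_iff.1 (hv.comp _ Subtype.val_injective) _ h0
  exact Finset.sum_congr rfl fun a _ => by rw [sub_eq_zero.1 (hf a)]

theorem exists_sub_mem_span_image (hT : ∀ b, T (e b) = v (i b))
    (hS : ∀ a ∈ S, a ∈ S' ∨ a ∈ Set.range i) {s : L} (hs : s ∈ Submodule.span R (v '' S)) :
    ∃ x, s - T x ∈ Submodule.span R (v '' S') := by
  induction hs using Submodule.span_induction with
  | mem s hs =>
    obtain ⟨a, ha, rfl⟩ := hs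
    rcases hS a ha with h | ⟨b, rfl⟩
    · exact ⟨0, by rw [map_zero, sub_zero]; exact Submodule.subset_span ⟨a, h, rfl⟩⟩
    · exact ⟨e b, by rw [hT, sub_self]; exact Submodule.zero_mem _⟩
  | zero => exact ⟨0, by rw [map_zero, sub_zero]; exact Submodule.zero_mem _⟩
  | add s s' _ _ hs hs' =>
    obtain ⟨x, hx⟩ := hs
    obtain ⟨x', hx'⟩ := hs'
    refine ⟨x + x', ?_⟩
    rw [map_add, add_sub_add_comm]
    exact Submodule.add_mem _ hx hx'
  | smul a s _ hs =>
    obtain ⟨x, hx⟩ := hs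
    refine ⟨a • x, ?_⟩
    rw [map_smul, ← smul_sub]
    exact Submodule.smul_mem _ a hx

/-- The map to a quotient `F / F'` induced by a map to `F`. -/
def quotMap (F F' : Submodule R L) (T : M →ₗ[R] L) (hF : ∀ x, T x ∈ F) :
    M →ₗ[R] F ⧸ F'.comap F.subtype :=
  Submodule.mkQ _ ∘ₗ T.codRestrict F hF

theorem mk_eq_quotMap_iff {F F' : Submodule R L} (hF : ∀ x, T x ∈ F) (s : F) (x : M) :
    (Submodule.Quotient.mk s : F ⧸ F'.comap F.subtype) = quotMap F F' T hF x ↔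
      s.1 - T x ∈ F' :=
  Submodule.Quotient.eq _

theorem quotMap_eq_quotMap_iff {F F' : Submodule R L} {T' : M →ₗ[R] L} (hF : ∀ x, T x ∈ F)
    (hF' : ∀ x, T' x ∈ F) (x y : M) :
    quotMap F F' T hF x = quotMap F F' T' hF' y ↔ T x - T' y ∈ F' :=
  Submodule.Quotient.eq _

/-- Freeness of `M` is not needed: a spanning set that maps, up to harmless repetitions, onto the
part of a basis lying in `S` but not in `S'` already forces bijectivity. -/
theorem quotMap_bijective [Finite I] {F F' : Submodule R L} (hF : ∀ x, T x ∈ F)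
    (he : Submodule.span R (Set.range e) = ⊤) (hT : ∀ b, T (e b) = v (i b))
    (hi : ∀ b b', i b = i b' → e b = e b') (hv : LinearIndependent R v) (hS' : ∀ b, i b ∉ S')
    (hS : ∀ a ∈ S, a ∈ S' ∨ a ∈ Set.range i) (hFS : F = Submodule.span R (v '' S))
    (hFS' : F' = Submodule.span R (v '' S')) : Function.Bijective (quotMap F F' T hF) := by
  subst hFS hFS'
  refine ⟨fun x y h => eq_of_sub_mem_span_image he hT hi hv hS'
    ((quotMap_eq_quotMap_iff hF hF x y).1 h), fun y => ?_⟩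
  obtain ⟨s, rfl⟩ := Submodule.Quotient.mk_surjective _ y
  obtain ⟨x, hx⟩ := exists_sub_mem_span_image hT hS s.2
  exact ⟨x, ((mk_eq_quotMap_iff hF s x).2 hx).symm⟩

end Quotient

end Algebra

/-! ### Multidegrees and weight vectors -/

section Weights

variable {n k N : ℕ}

/-- The partial weights of a multidegree. -/
def weightSum (ℓ : Fin k → ℕ) (q : ℕ) : ℕ :=
  ∑ j : Fin k, if (j : ℕ) + 1 ≤ q then ((j : ℕ) + 1) * ℓ j else 0

theorem weightSum_k (ℓ : Fin k → ℕ) : weightSum ℓ k = ∑ j : Fin k, ((j : ℕ) + 1) * ℓ j :=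
  Finset.sum_congr rfl fun j _ => if_pos (show (j : ℕ) + 1 ≤ k from j.2)

theorem weightSum_zero (ℓ : Fin k → ℕ) : weightSum ℓ 0 = 0 := by simp [weightSum]

theorem weightSum_succ (ℓ : Fin k → ℕ) (i : Fin k) :
    weightSum ℓ ((i : ℕ) + 1) = weightSum ℓ i + ((i : ℕ) + 1) * ℓ i := by
  have h1 : ∀ j : Fin k, (if (j : ℕ) + 1 ≤ (i : ℕ) + 1 then ((j : ℕ) + 1) * ℓ j else 0) =
      (if (j : ℕ) + 1 ≤ (i : ℕ) then ((j : ℕ) + 1) * ℓ j else 0) +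
        if j = i then ((j : ℕ) + 1) * ℓ j else 0 := by
    intro j
    rcases lt_trichotomy j i with h | h | h
    · have h' : (j : ℕ) < i := h
      rw [if_pos (by omega), if_pos (by omega), if_neg h.ne, add_zero]
    · subst h; simp
    · have h' : (i : ℕ) < j := h
      rw [if_neg (by omega), if_neg (by omega), if_neg h.ne']
  rw [weightSum, Finset.sum_congr rfl fun j _ => h1 j, Finset.sum_add_distrib]
  simp [weightSum]

/-- Consecutive differences of the partial weights are `(i + 1) * ℓ i`. -/
theorem weightSum_injective {ℓ ℓ' : Fin k → ℕ} (h : ∀ q ≤ k, weightSum ℓ q = weightSum ℓ' q) :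
    ℓ = ℓ' := by
  funext i
  have h1 := h ((i : ℕ) + 1) i.2
  rw [weightSum_succ, weightSum_succ, h i i.2.le] at h1
  exact Nat.eq_of_mul_eq_mul_left (Nat.succ_pos _) (Nat.add_left_cancel h1)

theorem weightSum_eq_of_toLex_eq {ℓ ℓ' : Fin k → ℕ} (hk : weightSum ℓ k = weightSum ℓ' k)
    (h : (fun r : Fin (k - 1) => weightSum ℓ (k - 1 - (r : ℕ))) =
      fun r : Fin (k - 1) => weightSum ℓ' (k - 1 - (r : ℕ))) : ℓ = ℓ' := by
  refine weightSum_injective fun q hq => ?_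
  rcases Nat.eq_zero_or_pos q with rfl | h0
  · rw [weightSum_zero, weightSum_zero]
  · rcases hq.eq_or_lt with rfl | hlt
    · exact hk
    · have := congrFun h ⟨k - 1 - q, by omega⟩
      simp only at this
      rwa [show k - 1 - (k - 1 - q) = q by omega] at this

theorem partialWeight_eq_weightSum (q : ℕ) (α : MultiIndex n k) :
    partialWeight q α = weightSum (fun j => ∑ l, α l j) q := by
  simp only [partialWeight, weightSum, Finset.mul_sum]

theorem Weights.degree_eq (ℓ : Weights k N) :
    ℓ.degree = toLex fun r : Fin (k - 1) => weightSum ℓ.1 (k - 1 - (r : ℕ)) := rfl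

theorem weightVector_eq (α : MultiIndex n k) : weightVector α =
    toLex fun r : Fin (k - 1) => weightSum (fun j => ∑ l, α l j) (k - 1 - (r : ℕ)) := by
  simp only [weightVector, partialWeight_eq_weightSum]

theorem Weights.weightSum_eq (ℓ : Weights k N) : weightSum ℓ.1 k = N :=
  (weightSum_k ℓ.1).trans ℓ.2

/-- The weight vector omits only the partial weight at `q = k`, which is fixed by `‖ℓ‖ = N`. Hence
each graded piece contains a single multidegree. -/
theorem Weights.degree_injective : Function.Injective (Weights.degree (k := k) (N := N)) :=
  fun ℓ ℓ' h => Subtype.ext (weightSum_eq_of_toLex_eq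
    (ℓ.weightSum_eq.trans ℓ'.weightSum_eq.symm) (toLex.injective h))

/-- The multidegree of an exponent. -/
def multidegree {α : MultiIndex n k} (h : totalWeight α = N) : Weights k N :=
  ⟨fun j => ∑ l, α l j, by
    rw [← weightSum_k, ← partialWeight_eq_weightSum]; exact h⟩

theorem degree_multidegree {α : MultiIndex n k} (h : totalWeight α = N) :
    (multidegree h).degree = weightVector α := (weightVector_eq α).symm

/-- The profiles agree at `q = 0` and for `q ≥ k`, so the strict inequality occurs at some `0 < q <
k`, which the weight vector records. -/
theorem weightVector_lt_of_profile_lt {α β : MultiIndex n k} (h : profile α < profile β)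
    (hN : totalWeight α = totalWeight β) : weightVector α < weightVector β := by
  obtain ⟨hle, q, hq⟩ := Pi.lt_def.1 h
  refine Pi.toLex_strictMono (Pi.lt_def.2 ⟨fun r => hle _, ?_⟩)
  have hge : ∀ γ : MultiIndex n k, k ≤ q → partialWeight q γ = totalWeight γ := by
    intro γ hkq
    refine Finset.sum_congr rfl fun j _ => ?_
    rw [if_pos (show (j : ℕ) + 1 ≤ q by omega), if_pos (show (j : ℕ) + 1 ≤ k from j.2)]
  have hk : q < k := by
    by_contra hk
    push Not at hk
    simp only [profile] at hq
    rw [hge α hk, hge β hk, hN] at hq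
    exact lt_irrefl _ hq
  have h0 : 0 < q := by
    by_contra h0
    have : q = 0 := by omega
    subst this
    simp [profile, partialWeight] at hq
  refine ⟨⟨k - 1 - q, by omega⟩, ?_⟩
  simp only
  rwa [show k - 1 - (k - 1 - q) = q by omega]

/-- The exponents of `∏ j, ∏ t, x (l j t) j`. -/
def countIndex {ℓ : Fin k → ℕ} (l : ∀ j : Fin k, Fin (ℓ j) → Fin n) : MultiIndex n k :=
  fun r j => (Finset.univ.filter fun t => l j t = r).card

theorem sum_countIndex {ℓ : Fin k → ℕ} (l : ∀ j : Fin k, Fin (ℓ j) → Fin n) (j : Fin k) :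
    ∑ r, countIndex l r j = ℓ j := by
  have := Finset.card_eq_sum_card_fiberwise (s := (Finset.univ : Finset (Fin (ℓ j))))
    (t := (Finset.univ : Finset (Fin n))) (f := l j) fun _ _ => Finset.mem_univ _
  rw [Finset.card_univ, Fintype.card_fin] at this
  exact this.symm

theorem totalWeight_countIndex (ℓ : Weights k N) (l : ∀ j : Fin k, Fin (ℓ.1 j) → Fin n) :
    totalWeight (countIndex l) = N := by
  rw [totalWeight, partialWeight_eq_weightSum]
  simp only [sum_countIndex]
  exact ℓ.weightSum_eq

theorem weightVector_countIndex (ℓ : Weights k N) (l : ∀ j : Fin k, Fin (ℓ.1 j) → Fin n) :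
    weightVector (countIndex l) = ℓ.degree := by
  rw [weightVector_eq, Weights.degree_eq]
  simp only [sum_countIndex]

/-- The weight vector determines the multidegree, so for each `j` there are exactly enough slots to
list every `l` with multiplicity `α_{l,j}`. -/
theorem exists_countIndex_eq (ℓ : Weights k N) {α : MultiIndex n k} (hN : totalWeight α = N)
    (h : weightVector α = ℓ.degree) :
    ∃ l : ∀ j : Fin k, Fin (ℓ.1 j) → Fin n, countIndex l = α := by
  have h1 : multidegree hN = ℓ := Weights.degree_injective ((degree_multidegree hN).trans h)
  have h2 : ∀ j, ∑ r, α r j = ℓ.1 j := fun j => congrFun (congrArg Subtype.val h1) j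
  choose l hl using fun j => exists_card_fiber_eq (fun r => α r j) (h2 j)
  exact ⟨l, funext fun r => funext fun j => hl j r⟩

theorem profile_countIndex {ℓ : Fin k → ℕ} (l : ∀ j : Fin k, Fin (ℓ j) → Fin n) :
    profile (countIndex l) = ∑ j : Fin k, ∑ _t : Fin (ℓ j), jetProfile ((j : ℕ) + 1) := by
  rw [profile_eq_sum, Finset.sum_comm]
  refine Finset.sum_congr rfl fun j _ => ?_
  rw [← Finset.sum_smul, sum_countIndex, Finset.sum_const, Finset.card_univ, Fintype.card_fin]

end Weights

/-! ### Functions on a family as an algebra, where forms can be multiplied -/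

section LocRing

variable {n : ℕ} {T Y : Type*} [TopologicalSpace Y] [ChartedSpace (Fin n → ℂ) Y] (pr : T → Y)

/-- The ring of functions on the part of a family that lies over `U`. -/
def LocRing (U : Opens Y) := {t : T // pr t ∈ U} → ℂ

instance (U : Opens Y) : CommRing (LocRing pr U) :=
  inferInstanceAs (CommRing ({t : T // pr t ∈ U} → ℂ))

instance (U : Opens Y) : Algebra (Hol n U) (LocRing pr U) :=
  RingHom.toAlgebra
    { toFun := fun f t => f ⟨pr t.1, t.2⟩
      map_one' := rfl
      map_mul' := fun _ _ => rfl
      map_zero' := rfl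
      map_add' := fun _ _ => rfl }

/-- The functions over `U`, as a module. -/
def LocRing.toLocFun (U : Opens Y) : LocRing pr U →ₗ[Hol n U] LocFun pr U where
  toFun s := s
  map_add' _ _ := rfl
  map_smul' _ _ := rfl

variable {pr}

theorem LocRing.prod_apply {κ : Type*} (L : Finset κ) {U : Opens Y} (f : κ → LocRing pr U)
    (t : {t : T // pr t ∈ U}) : (∏ i ∈ L, f i) t = ∏ i ∈ L, f i t :=
  Finset.prod_apply t L (f : κ → {t : T // pr t ∈ U} → ℂ)

end LocRing

/-! ### The graded pieces as tensor products of symmetric powers -/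

section Graded

variable {n : ℕ} {ι X Y : Type*}
  [TopologicalSpace X] [ChartedSpace (Fin n → ℂ) X]
  [TopologicalSpace Y] [ChartedSpace (Fin n → ℂ) Y]
  {Δ : OrbifoldDivisor n ι X} {π : Y → X} {k N : ℕ} {U : Opens Y}

namespace AdaptedChart

variable (c c' : AdaptedChart Δ π)

/-- The function on curves that a form defines through the `j`th Taylor coefficients of the
coordinates. -/
def pull (j : ℕ) (U : Opens Y) :
    OrbForms (Δ.trunc j) π U →ₗ[Hol n U] LocRing (JetPoint.pt (Δ := Δ) (π := π)) U where
  toFun θ := fun q => θ.1 ⟨c.tangentLift j q.1, q.2⟩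
  map_add' _ _ := rfl
  map_smul' _ _ := rfl

theorem pull_formSection_self (hU : U ≤ c.domain) (j : ℕ) (l : Fin n)
    (q : {q : JetPoint Δ π // q.pt ∈ U}) :
    c.pull j U ((c.trunc j).formSection hU l) q = c.jetCoord l j q.1 :=
  c.form_tangentLift j l (hU q.2)

/-- The extension of `pull` to symmetric powers. -/
def symPull (j m : ℕ) (U : Opens Y) : SymPow (Hol n U) (OrbForms (Δ.trunc j) π U) m →ₗ[Hol n U]
    LocRing (JetPoint.pt (Δ := Δ) (π := π)) U :=
  (SymmetricAlgebra.lift (c.pull j U)).toLinearMap ∘ₗ Submodule.subtype _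

theorem symPull_symProd (j m : ℕ) (s : Fin m → OrbForms (Δ.trunc j) π U) :
    c.symPull j m U (symProd (Hol n U) s) = ∏ t, c.pull j U (s t) := by
  change SymmetricAlgebra.lift (c.pull j U) (∏ t, SymmetricAlgebra.ι (Hol n U) _ (s t)) = _
  rw [map_prod]
  exact Finset.prod_congr rfl fun t _ => SymmetricAlgebra.lift_ι_apply _ _

/-- The extension of `pull` to tensor products of symmetric powers. -/
def tensorPull (ℓ : Weights k N) (U : Opens Y) : TensorPiece Δ π ℓ U →ₗ[Hol n U]
    LocFun (JetPoint.pt (Δ := Δ) (π := π)) U :=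
  LocRing.toLocFun _ U ∘ₗ PiTensorProduct.lift
    ((MultilinearMap.mkPiAlgebra (Hol n U) (Fin k)
      (LocRing (JetPoint.pt (Δ := Δ) (π := π)) U)).compLinearMap
        fun j => c.symPull ((j : ℕ) + 1) (ℓ.1 j) U)

theorem tensorPull_pureTensor (ℓ : Weights k N)
    (s : ∀ j : Fin k, Fin (ℓ.1 j) → OrbForms (Δ.trunc ((j : ℕ) + 1)) π U)
    (q : {q : JetPoint Δ π // q.pt ∈ U}) :
    c.tensorPull ℓ U (pureTensor ℓ s) q = ∏ j : Fin k, ∏ t, c.pull ((j : ℕ) + 1) U (s j t) q := by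
  have h1 : c.tensorPull ℓ U (pureTensor ℓ s) =
      LocRing.toLocFun (n := n) _ U (∏ j : Fin k, ∏ t, c.pull ((j : ℕ) + 1) U (s j t)) := by
    rw [tensorPull, LinearMap.comp_apply, pureTensor, PiTensorProduct.lift.tprod,
      MultilinearMap.compLinearMap_apply, MultilinearMap.mkPiAlgebra_apply]
    congr 1
    exact Finset.prod_congr rfl fun j _ => c.symPull_symProd _ _ _
  rw [h1]
  change (∏ j : Fin k, ∏ t, c.pull ((j : ℕ) + 1) U (s j t) :
    LocRing (JetPoint.pt (Δ := Δ) (π := π)) U) q = _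
  refine (LocRing.prod_apply _ _ q).trans (Finset.prod_congr rfl fun j _ => ?_)
  exact LocRing.prod_apply _ _ q

theorem res_tensorPull {V : Opens Y} (h : V ≤ U)
    (ℓ : Weights k N) (θ : ∀ j : Fin k, Fin (ℓ.1 j) → OrbForms (Δ.trunc ((j : ℕ) + 1)) π U) :
    LocFun.res h (c.tensorPull ℓ U (pureTensor ℓ θ)) =
      c.tensorPull ℓ V (pureTensor ℓ fun j t => OrbForms.res h (θ j t)) := by
  funext q
  refine (c.tensorPull_pureTensor ℓ θ ⟨q.1, h q.2⟩).trans ?_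
  rw [tensorPull_pureTensor]
  rfl

/-- The product of generators with indices `l`. -/
def frameTensor (hU : U ≤ c.domain) (ℓ : Weights k N) (l : ∀ j : Fin k, Fin (ℓ.1 j) → Fin n) :
    TensorPiece Δ π ℓ U :=
  pureTensor ℓ fun j t => (c.trunc ((j : ℕ) + 1)).formSection hU (l j t)

theorem prod_jetCoord_eq (ℓ : Weights k N) (l : ∀ j : Fin k, Fin (ℓ.1 j) → Fin n)
    (q : JetPoint Δ π) :
    ∏ j, ∏ t, c.jetCoord (l j t) ((j : ℕ) + 1) q = c.monomial (countIndex l) q := by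
  rw [monomial, Finset.prod_comm]
  exact Finset.prod_congr rfl fun j _ =>
    prod_eq_prod_pow_card (fun r => c.jetCoord r ((j : ℕ) + 1) q) (l j)

/-- In its own chart a generator evaluated on the lift of a jet is exactly a jet coordinate, so
products of generators become monomials with no correction terms. -/
theorem tensorPull_frameTensor (hU : U ≤ c.domain) (ℓ : Weights k N)
    (l : ∀ j : Fin k, Fin (ℓ.1 j) → Fin n) :
    c.tensorPull ℓ U (c.frameTensor hU ℓ l) = LocFun.of _ (c.monomial (countIndex l)) U := by
  funext q
  rw [frameTensor, tensorPull_pureTensor]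
  simp only [pull_formSection_self]
  exact c.prod_jetCoord_eq ℓ l q.1

/-- By commutativity, a symmetric product depends only on how often each generator occurs. -/
theorem frameTensor_eq_of_countIndex_eq (hU : U ≤ c.domain) (ℓ : Weights k N)
    {l l' : ∀ j : Fin k, Fin (ℓ.1 j) → Fin n} (h : countIndex l = countIndex l') :
    c.frameTensor hU ℓ l = c.frameTensor hU ℓ l' := by
  rw [frameTensor, frameTensor, pureTensor, pureTensor]
  congr 1
  funext j
  refine Subtype.ext ?_
  simp only [symProd]
  rw [prod_eq_prod_pow_card (fun r => SymmetricAlgebra.ι (Hol n U) _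
      ((c.trunc ((j : ℕ) + 1)).formSection hU r)) (l j),
    prod_eq_prod_pow_card (fun r => SymmetricAlgebra.ι (Hol n U) _
      ((c.trunc ((j : ℕ) + 1)).formSection hU r)) (l' j)]
  refine Finset.prod_congr rfl fun r _ => ?_
  congr 1
  exact congrFun (congrFun h r) j

theorem monomialSpan_eq_image (S : Set (MultiIndex n k)) (U : Opens Y) :
    c.monomialSpan k N S U = Submodule.span (Hol n U)
      ((fun α : {α : MultiIndex n k // totalWeight α = N} =>
        LocFun.of (JetPoint.pt (Δ := Δ) (π := π)) (c.monomial α.1) U) '' {α | α.1 ∈ S}) := by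
  rw [monomialSpan]
  congr 1
  ext s
  constructor
  · rintro ⟨α, h1, h2, rfl⟩
    exact ⟨⟨α, h2⟩, h1, rfl⟩
  · rintro ⟨α, h, rfl⟩
    exact ⟨α.1, h, α.2, rfl⟩

/-- The exponents of the image of a product of generators. -/
def frameIndex (ℓ : Weights k N) (l : ∀ j : Fin k, Fin (ℓ.1 j) → Fin n) :
    {α : MultiIndex n k // totalWeight α = N} := ⟨countIndex l, totalWeight_countIndex ℓ l⟩

variable [IsManifold 𝓘(ℂ, Fin n → ℂ) ω Y]

theorem span_formSection_eq_top (hU : U ≤ c.domain) :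
    Submodule.span (Hol n U) (Set.range fun l => c.formSection hU l) = ⊤ := by
  refine Submodule.map_injective_of_injective (OrbForms Δ π U).injective_subtype ?_
  rw [Submodule.map_span, Submodule.map_top, Submodule.range_subtype, ← Set.range_comp]
  exact (c.orbForms_eq hU).symm

theorem span_frameTensor_eq_top (hU : U ≤ c.domain) (ℓ : Weights k N) :
    Submodule.span (Hol n U) (Set.range (c.frameTensor hU ℓ)) = ⊤ :=
  PiTensorProduct.submodule_span_eq_top (R := Hol n U)
    (M := fun j : Fin k => SymPow (Hol n U) (OrbForms (Δ.trunc ((j : ℕ) + 1)) π U) (ℓ.1 j))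
    (g := fun j (l : Fin (ℓ.1 j) → Fin n) => symProd (Hol n U) fun t =>
      (c.trunc ((j : ℕ) + 1)).formSection hU (l t))
    fun j => span_symProd_eq_top ((c.trunc ((j : ℕ) + 1)).span_formSection_eq_top hU) (ℓ.1 j)

theorem tensorPull_mem (hU : U ≤ c.domain) (ℓ : Weights k N) (x : TensorPiece Δ π ℓ U) :
    c.tensorPull ℓ U x ∈ filt Δ π k N (lexGE k ℓ.degree) U := by
  rw [c.filt_eq (isUpward_lexGE _) hU, monomialSpan_eq_image]
  exact apply_mem_span_image (c.span_frameTensor_eq_top hU ℓ) (i := frameIndex ℓ)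
    (fun l => c.tensorPull_frameTensor hU ℓ l) (fun l => (weightVector_countIndex ℓ l).ge) x

/-- The map from a tensor product of symmetric powers to a graded piece in an adapted chart. -/
def grMap (hU : U ≤ c.domain) (ℓ : Weights k N) :
    TensorPiece Δ π ℓ U →ₗ[Hol n U] GrPiece Δ π k N ℓ.degree U :=
  quotMap (filt Δ π k N (lexGE k ℓ.degree) U) (filt Δ π k N (lexGT k ℓ.degree) U)
    (c.tensorPull ℓ U) (c.tensorPull_mem hU ℓ)

theorem mk_eq_grMap_iff (hU : U ≤ c.domain) (ℓ : Weights k N)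
    (s : filt Δ π k N (lexGE k ℓ.degree) U) (x : TensorPiece Δ π ℓ U) :
    (Submodule.Quotient.mk s : GrPiece Δ π k N ℓ.degree U) = c.grMap hU ℓ x ↔
      s.1 - c.tensorPull ℓ U x ∈ filt Δ π k N (lexGT k ℓ.degree) U :=
  mk_eq_quotMap_iff (c.tensorPull_mem hU ℓ) s x

/-- Products of generators span the tensor product and map to the monomials of weight vector exactly
`ℓ.degree`, all of which arise in this way; these are the part of the frame that lies in `F^d` but
not in `F^{>d}`. -/
theorem grMap_bijective (hU : U ≤ c.domain) (ℓ : Weights k N) :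
    Function.Bijective (c.grMap hU ℓ) := by
  refine quotMap_bijective (c.tensorPull_mem hU ℓ) (c.span_frameTensor_eq_top hU ℓ)
    (i := frameIndex ℓ) (S := {α | α.1 ∈ lexGE k ℓ.degree}) (S' := {α | α.1 ∈ lexGT k ℓ.degree})
    (fun l => c.tensorPull_frameTensor hU ℓ l)
    (fun l l' h => c.frameTensor_eq_of_countIndex_eq hU ℓ (Subtype.ext_iff.1 h))
    (c.linearIndependent_monomial hU) (fun l => (weightVector_countIndex ℓ l).not_gt)
    (fun α h => ?_) ?_ ?_
  · rcases (show ℓ.degree ≤ weightVector α.1 from h).eq_or_lt with h | h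
    · obtain ⟨l, hl⟩ := exists_countIndex_eq ℓ α.2 h.symm
      exact Or.inr ⟨l, Subtype.ext hl⟩
    · exact Or.inl h
  · rw [c.filt_eq (isUpward_lexGE _) hU, monomialSpan_eq_image]
  · rw [c.filt_eq (isUpward_lexGT _) hU, monomialSpan_eq_image]

/-- The map to the graded piece does not depend on the adapted chart. -/
theorem grMap_eq (hU : U ≤ c.domain) (hU' : U ≤ c'.domain) (ℓ : Weights k N) :
    c.grMap hU ℓ = c'.grMap hU' ℓ := by
  refine LinearMap.ext_on_range (c.span_frameTensor_eq_top hU ℓ) fun l => ?_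
  refine (c'.mk_eq_grMap_iff hU' ℓ ⟨_, c.tensorPull_mem hU ℓ _⟩ _).2 ?_
  rw [c'.filt_eq (isUpward_lexGT _) hU']
  -- On generators of `c`, the pullback through `c` gives its jet coordinates, while that through
  -- `c'` gives the corresponding forms on the lift by `c'`. Factor by factor these differ by terms
  -- of larger profile.
  have h1 : c.tensorPull ℓ U (c.frameTensor hU ℓ l) - c'.tensorPull ℓ U (c.frameTensor hU ℓ l) =
      LocFun.of _ ((∏ j : Fin k, ∏ t, c.jetCoord (l j t) ((j : ℕ) + 1)) -
        ∏ j : Fin k, ∏ t, fun q => (c.trunc ((j : ℕ) + 1)).form (l j t)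
          (c'.tangentLift ((j : ℕ) + 1) q)) U := by
    funext q
    change c.tensorPull ℓ U (c.frameTensor hU ℓ l) q - c'.tensorPull ℓ U (c.frameTensor hU ℓ l) q =
      (∏ j : Fin k, ∏ t, c.jetCoord (l j t) ((j : ℕ) + 1)) q.1 -
        (∏ j : Fin k, ∏ t, fun q => (c.trunc ((j : ℕ) + 1)).form (l j t)
          (c'.tangentLift ((j : ℕ) + 1) q)) q.1
    rw [frameTensor, tensorPull_pureTensor, tensorPull_pureTensor]
    simp only [Finset.prod_apply, pull_formSection_self]
    rfl
  rw [h1]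
  refine c'.mem_monomialSpan_of_germSpan hU' fun y hy => ?_
  have hpos : ∀ j : Fin k, 0 < (j : ℕ) + 1 := fun j => Nat.succ_pos _
  have h2 := c'.germSpan_prod_sub (y₀ := y) (k := k) (Finset.univ : Finset (Fin k))
    (f := fun j => ∏ t, c.jetCoord (l j t) ((j : ℕ) + 1))
    (g := fun j => ∏ t, fun q => (c.trunc ((j : ℕ) + 1)).form (l j t)
          (c'.tangentLift ((j : ℕ) + 1) q))
    (v := fun j => ∑ _t : Fin (ℓ.1 j), jetProfile ((j : ℕ) + 1))
    (fun j _ => c'.germSpan_prod _ fun t _ =>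
      c'.germSpan_jetCoord_transition c (hU' hy) (hU hy) _ (hpos j) j.2)
    (fun j _ => c'.germSpan_prod_sub _
      (fun t _ => c'.germSpan_jetCoord_transition c (hU' hy) (hU hy) _ (hpos j) j.2)
      (fun t _ => c'.germSpan_jetCoord_sub c (hU' hy) (hU hy) _ (hpos j) j.2))
  rw [← profile_countIndex] at h2
  refine h2.mono ?_
  rintro _ ⟨β, h3, h4, rfl⟩
  have h5 : totalWeight (countIndex l) = totalWeight β := h4.symm
  refine ⟨β, ?_, h5.symm.trans (totalWeight_countIndex ℓ l), rfl⟩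
  have := weightVector_lt_of_profile_lt h3 h5
  rwa [weightVector_countIndex] at this

end AdaptedChart

theorem lexGE_subset_lexGT {d d' : Lex (Fin (k - 1) → ℕ)} (h : d < d') :
    lexGE (n := n) k d' ⊆ lexGT k d :=
  fun α (hα : d' ≤ weightVector α) => (h.trans_le hα : d < weightVector α)

theorem lexGT_subset_lexGE (d : Lex (Fin (k - 1) → ℕ)) : lexGT (n := n) k d ⊆ lexGE k d :=
  fun α (hα : d < weightVector α) => (hα.le : d ≤ weightVector α)

/-- A monomial with weight vector `d` would have a multidegree of degree `d`. If there is none, then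
`F^d = F^{>d}`. -/
theorem subsingleton_grPiece (d : Lex (Fin (k - 1) → ℕ))
    (hd : d ∉ Set.range (Weights.degree (k := k) (N := N))) :
    Subsingleton (GrPiece Δ π k N d U) := by
  rw [Submodule.Quotient.subsingleton_iff, Submodule.comap_subtype_eq_top]
  refine filt_mono (fun α h1 h2 => ?_) U
  refine lt_of_le_of_ne (show d ≤ weightVector α from h1) fun h => hd ⟨multidegree h2, ?_⟩
  rw [degree_multidegree, h]

variable [IsManifold 𝓘(ℂ, Fin n → ℂ) ω Y]

/-- The isomorphism of the associated graded module with the direct sum of the tensor products of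
symmetric powers, in an adapted chart. -/
def AdaptedChart.grEquiv (c : AdaptedChart Δ π) (hU : U ≤ c.domain) (k N : ℕ) :
    (⨁ d : Lex (Fin (k - 1) → ℕ), GrPiece Δ π k N d U) ≃ₗ[Hol n U]
      ⨁ ℓ : Weights k N, TensorPiece Δ π ℓ U :=
  reindexEquiv (M := fun ℓ : Weights k N => TensorPiece Δ π ℓ U)
    (P := fun d : Lex (Fin (k - 1) → ℕ) => GrPiece Δ π k N d U) Weights.degree_injective
    (fun ℓ => c.grMap hU ℓ) (fun ℓ => c.grMap_bijective hU ℓ) subsingleton_grPiece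

theorem AdaptedChart.grEquiv_lof_eq_iff (c : AdaptedChart Δ π) (hU : U ≤ c.domain)
    (ℓ : Weights k N) (y : GrPiece Δ π k N ℓ.degree U) (x : TensorPiece Δ π ℓ U) :
    c.grEquiv hU k N (DirectSum.lof (Hol n U) _ (fun d => GrPiece Δ π k N d U) ℓ.degree y) =
      DirectSum.lof (Hol n U) _ (fun ℓ' : Weights k N => TensorPiece Δ π ℓ' U) ℓ x ↔
      y = c.grMap hU ℓ x :=
  by
  rw [grEquiv]
  have h := @reindexEquiv_lof_eq_iff (Hol n U) (Weights k N) (Lex (Fin (k - 1) → ℕ)) _ _ _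
    (fun ℓ : Weights k N => TensorPiece Δ π ℓ U)
    (fun d : Lex (Fin (k - 1) → ℕ) => GrPiece Δ π k N d U) _ _ _ _ _ Weights.degree_injective
    (fun ℓ => c.grMap hU ℓ) (fun ℓ => c.grMap_bijective hU ℓ) subsingleton_grPiece ℓ y x
  exact h

/-- The isomorphism built from `c` can be tested in any other chart `d`. This frees the later
arguments from the arbitrary choice of a chart for each open set. -/
theorem AdaptedChart.mk_grEquiv_iff (c d : AdaptedChart Δ π) (hc : U ≤ c.domain)
    (hd : U ≤ d.domain) (ℓ : Weights k N) (s : filt Δ π k N (lexGE k ℓ.degree) U)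
    (x : TensorPiece Δ π ℓ U) :
    c.grEquiv hc k N (DirectSum.lof (Hol n U) _ (fun d => GrPiece Δ π k N d U) ℓ.degree
        (Submodule.Quotient.mk s)) =
      DirectSum.lof (Hol n U) _ (fun ℓ' : Weights k N => TensorPiece Δ π ℓ' U) ℓ x ↔
      s.1 - d.tensorPull ℓ U x ∈ filt Δ π k N (lexGT k ℓ.degree) U := by
  rw [c.grEquiv_lof_eq_iff hc, c.grMap_eq d hc hd, d.mk_eq_grMap_iff hd]

theorem AdaptedChart.mk_grEquiv_of_tensorPull_eq (c d : AdaptedChart Δ π) (hc : U ≤ c.domain)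
    (hd : U ≤ d.domain) (ℓ : Weights k N) (s : filt Δ π k N (lexGE k ℓ.degree) U)
    (x : TensorPiece Δ π ℓ U) (h : d.tensorPull ℓ U x = s.1) :
    c.grEquiv hc k N (DirectSum.lof (Hol n U) _ (fun d => GrPiece Δ π k N d U) ℓ.degree
        (Submodule.Quotient.mk s)) =
      DirectSum.lof (Hol n U) _ (fun ℓ' : Weights k N => TensorPiece Δ π ℓ' U) ℓ x := by
  refine (c.mk_grEquiv_iff d hc hd ℓ s x).2 ?_
  have h1 : s.1 - d.tensorPull ℓ U x = 0 := sub_eq_zero.2 h.symm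
  rw [h1]
  exact Submodule.zero_mem _

end Graded

end OrbifoldJets

end

/-! ### The theorem -/

theorem mainTheorem3 {n : ℕ} {ι X Y : Type*}
    [TopologicalSpace X] [ChartedSpace (Fin n → ℂ) X] [IsManifold 𝓘(ℂ, Fin n → ℂ) ω X]
    [TopologicalSpace Y] [ChartedSpace (Fin n → ℂ) Y] [IsManifold 𝓘(ℂ, Fin n → ℂ) ω Y]
    (Δ : OrbifoldDivisor n ι X) (π : Y → X) (hπ : IsAdapted Δ π) (k N : ℕ) :
    -- `E_{k,N}` is locally free: in any adapted coordinates, the monomials are a frame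
    (∀ (c : AdaptedChart Δ π) (U : Opens Y), U ≤ c.domain →
      LinearIndependent (Hol n U) (fun α : {α : MultiIndex n k // totalWeight α = N} =>
        LocFun.of (JetPoint.pt (Δ := Δ) (π := π)) (c.monomial α.1) U) ∧
      JetDiff Δ π k N U = c.monomialSpan k N Set.univ U) ∧
    -- the conditions `‖·‖_q ≥ m` and `(‖·‖_{k-1}, …, ‖·‖_1) ≥ d` do not depend on the adapted
    -- coordinates, and they define subbundles
    (∀ (q m : ℕ) (c : AdaptedChart Δ π) (U : Opens Y), U ≤ c.domain →
      filt Δ π k N (degGE k q m) U = c.monomialSpan k N (degGE k q m) U) ∧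
    (∀ (d : Lex (Fin (k - 1) → ℕ)) (c : AdaptedChart Δ π) (U : Opens Y), U ≤ c.domain →
      filt Δ π k N (lexGE k d) U = c.monomialSpan k N (lexGE k d) U ∧
      filt Δ π k N (lexGT k d) U = c.monomialSpan k N (lexGT k d) U) ∧
    -- they give finite descending filtrations of `E_{k,N}` by subsheaves
    IsSubsheaf (JetDiff Δ π k N) ∧
    (∀ q m : ℕ, IsSubsheaf (filt Δ π k N (degGE k q m))) ∧
    (∀ d, IsSubsheaf (filt Δ π k N (lexGE k d)) ∧ IsSubsheaf (filt Δ π k N (lexGT k d))) ∧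
    (∀ d d' : Lex (Fin (k - 1) → ℕ), d < d' → ∀ U,
      filt Δ π k N (lexGE k d') U ≤ filt Δ π k N (lexGT k d) U ∧
      filt Δ π k N (lexGT k d) U ≤ filt Δ π k N (lexGE k d) U) ∧
    (∀ U, filt Δ π k N (lexGE k (toLex fun _ => 0)) U = JetDiff Δ π k N U) ∧
    (∃ d, ∀ U, filt Δ π k N (lexGT k d) U = ⊥) ∧
    -- the associated graded sheaf, on the basis of coordinate open sets
    ∃ Φ : ∀ U : Opens Y, IsCoordOpen Δ π U →
        ((⨁ d : Lex (Fin (k - 1) → ℕ), GrPiece Δ π k N d U) ≃ₗ[Hol n U]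
          ⨁ ℓ : Weights k N, TensorPiece Δ π ℓ U),
      -- compatibility with restrictions
      (∀ (U V : Opens Y) (hU : IsCoordOpen Δ π U) (hV : IsCoordOpen Δ π V) (h : V ≤ U)
        (ℓ : Weights k N) (s : filt Δ π k N (lexGE k ℓ.degree) U)
        (s' : filt Δ π k N (lexGE k ℓ.degree) V)
        (θ : ∀ j : Fin k, Fin (ℓ.1 j) → OrbForms (Δ.trunc ((j : ℕ) + 1)) π U),
        s'.1 = LocFun.res h s.1 →
        Φ U hU (DirectSum.lof (Hol n U) _ (fun d => GrPiece Δ π k N d U) ℓ.degree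
            (Submodule.Quotient.mk s)) =
          DirectSum.lof (Hol n U) _ (fun ℓ' : Weights k N => TensorPiece Δ π ℓ' U) ℓ
            (pureTensor ℓ θ) →
        Φ V hV (DirectSum.lof (Hol n V) _ (fun d => GrPiece Δ π k N d V) ℓ.degree
            (Submodule.Quotient.mk s')) =
          DirectSum.lof (Hol n V) _ (fun ℓ' : Weights k N => TensorPiece Δ π ℓ' V) ℓ
            (pureTensor ℓ fun j t => OrbForms.res h (θ j t))) ∧
      -- in all adapted coordinates, the class of a product of the functions
      -- `w_l ^ (-p_l max (1 - j / m_l) 0) π^* d^j z_l` is mapped to the corresponding product of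
      -- the forms `w_l ^ (-p_l max (1 - j / m_l) 0) π^* dz_l`
      (∀ (U : Opens Y) (hU : IsCoordOpen Δ π U) (c : AdaptedChart Δ π) (hc : U ≤ c.domain)
        (ℓ : Weights k N) (l : ∀ j : Fin k, Fin (ℓ.1 j) → Fin n)
        (s : filt Δ π k N (lexGE k ℓ.degree) U),
        s.1 = LocFun.of _ (fun q => ∏ j, ∏ t, c.jetCoord (l j t) ((j : ℕ) + 1) q) U →
        Φ U hU (DirectSum.lof (Hol n U) _ (fun d => GrPiece Δ π k N d U) ℓ.degree
            (Submodule.Quotient.mk s)) =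
          DirectSum.lof (Hol n U) _ (fun ℓ' : Weights k N => TensorPiece Δ π ℓ' U) ℓ
            (pureTensor ℓ fun j t => (c.trunc ((j : ℕ) + 1)).formSection hc (l j t))) := by
  refine ⟨fun c U hU => ⟨c.linearIndependent_monomial hU, c.jetDiff_eq hU⟩,
    fun q m c U hU => c.filt_eq (isUpward_degGE q m) hU,
    fun d c U hU => ⟨c.filt_eq (isUpward_lexGE d) hU, c.filt_eq (isUpward_lexGT d) hU⟩,
    isSubsheaf_jetDiff, fun q m => isSubsheaf_filt _,
    fun d => ⟨isSubsheaf_filt _, isSubsheaf_filt _⟩,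
    fun d d' h U => ⟨filt_mono (fun α hα _ => lexGE_subset_lexGT h hα) U,
      filt_mono (fun α hα _ => lexGT_subset_lexGE d hα) U⟩,
    fun U => by rw [lexGE_zero, filt_univ],
    ⟨toLex fun _ => N, filt_lexGT_eq_bot hπ⟩,
    fun U hU => hU.choose.grEquiv hU.choose_spec k N, ?_, ?_⟩
  · intro U V hU hV h ℓ s s' θ hs hΦ
    have h1 := AdaptedChart.mk_grEquiv_iff hU.choose hU.choose hU.choose_spec hU.choose_spec ℓ s
      (pureTensor ℓ θ)
    -- The chart chosen for `V` may be unrelated to that for `U`, so the condition over `V` is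
    -- expressed in the chart of `U`. There `tensorPull` commutes with restriction, and the claim is
    -- that `F^{>d}` restricts.
    have h2 := AdaptedChart.mk_grEquiv_iff hV.choose hU.choose hV.choose_spec
      (h.trans hU.choose_spec) ℓ s' (pureTensor ℓ fun j t => OrbForms.res h (θ j t))
    rw [← AdaptedChart.res_tensorPull, hs] at h2
    have h3 := h1.1 hΦ
    have h4 := h2.2 ((isSubsheaf_filt _).1 U V h _ h3)
    exact h4
  · intro U hU c hc ℓ l s hs
    refine AdaptedChart.mk_grEquiv_of_tensorPull_eq hU.choose c hU.choose_spec hc ℓ s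
      (c.frameTensor hc ℓ l) ?_
    rw [c.tensorPull_frameTensor hc, hs, funext (c.prod_jetCoord_eq ℓ l)]
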